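/- **Setting.** Let $M$ be a smooth $n$-manifold and let $E\to M$ be an exact real Courant algebroid: a smooth real vector bundle with a nondegenerate symmetric pairing $\langle\cdot,\cdot\rangle$, an anchor $\pi:E\to T=TM$ and a Courant bracket $[\cdot,\cdot]$ on smooth sections (taken in its non-skew form), satisfying the usual Courant algebroid axioms, and such that $0\to T^*\xrightarrow{\pi^*}E\xrightarrow{\pi}T\to 0$ is exact, where $E^*$ is identified with $E$ through the pairing, so that $\langle\pi^*\xi,e\rangle=\xi(\pi e)$. A bilinear form $m$ on $T$ is also read as the map $m:T\to T^*$, $X\mapsto m(X,\cdot)$. Fix a smooth isotropic splitting $s_0:T\to E$ of $\pi$ and let $H_0(X,Y,Z)=\langle[s_0X,s_0Y],s_0Z\rangle$, a three-form on $M$. A *generalized metric* is a smooth bundle endomorphism $\mathbf G$ of $E$ with $\mathbf G^2=\mathrm{Id}$, $\mathbf G^*=\mathbf G$ and $\langle\mathbf G\cdot,\cdot\rangle$ positive definite. It induces a Riemannian metric $g$ by $g^{-1}=\pi\mathbf G\pi^*$, a splitting $s_{\mathbf G}=\mathbf G\pi^*g$, and the two-form $b$ (torsion potential) determined by $s_{\mathbf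 G}=e^bs_0$, where $e^b=\mathrm{Id}+\pi^*b\,\pi$. Let $P_\pm=\tfrac12(\mathrm{Id}\pm\mathbf G)$ and $X^\pm=(\mathbf G\pm\mathrm{Id})\pi^*gX$ for a vector field $X$. The Bismut connections on $T$ are $\nabla^\pm_XY=\pi P_\pm[X^\mp,Y^\pm]$. The Ricci tensor of a connection is $\mathrm{Rc}(Y,Z)=\mathrm{tr}\,(X\mapsto R(X,Y)Z)$, with $R(X,Y)Z=\nabla_X\nabla_YZ-\nabla_Y\nabla_XZ-\nabla_{[X,Y]}Z$. The *generalized Ricci tensor* of $\mathbf G$ is $$\mathcal R=P_-\,\eta\,P_+-P_+\,\eta^*P_-\in\mathfrak{so}(E),\qquad \eta=\pi^*\,\mathrm{Rc}(\nabla^-)\,\pi .$$ Let $J\subseteq\mathbb R$ be an interval and let $(\mathbf G_t)_{t\in J}$ be a one-parameter family of generalized metrics, with generalized Ricci tensors $\mathcal R_t$. Time derivatives are taken at each point of $M$ (one-sided at end points of $J$). **Theorem 1.1.** The three-form $H_0$ and the induced pairs $(g_t,b_t)$ of Riemannian metrics and torsion potentials are well defined and unique, and $\mathbf G_t$ solves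 generalized Ricci flow on $J$, $$\frac{\partial}{\partial t}\mathbf G=-2[\mathcal R,\mathbf G],$$ if and only if $(g_t,b_t)$ solves the $B$-field renormalization group flow on $J$: with $H=H_0+db$, $$\frac{\partial}{\partial t}g_{ij}=-2\,\mathrm{Rc}_{ij}+\tfrac12H_{ipq}H_j{}^{pq},\qquad \frac{\partial}{\partial t}b=-d^*_gH .$$ Here $\mathrm{Rc}$ is the Ricci tensor of the Levi-Civita connection $\nabla$ of $g$, and $(d^*_gH)_{jk}=-\nabla^iH_{ijk}$. -/

import Mathlib

open scoped Manifold ContDiff Bundle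

noncomputable section

/-! ## Tensor calculus on a smooth manifold

`M` is an `n`-dimensional manifold modelled on `EuclideanSpace ℝ (Fin n)`.  Fields and tensor fields
are arbitrary (fibrewise multilinear) families over `M`; smoothness is imposed by predicates. A
fibrewise multilinear family is smooth exactly when it sends smooth fields to smooth fields. -/

section Manifold

variable {n : ℕ} {M : Type*} [TopologicalSpace M] [ChartedSpace (EuclideanSpace ℝ (Fin n)) M]
  [IsManifold (𝓡 n) ∞ M]

variable (n M) in
/-- (Not necessarily smooth) vector fields on `M`. -/
abbrev VField := ∀ x : M, TangentSpace (𝓡 n) x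

variable (n M) in
/-- Sections of `T* ⊗ T*`. A value `h x` is also read as the map `T → T*`, `v ↦ h x v`. -/
abbrev TwoTensor := ∀ x : M, TangentSpace (𝓡 n) x →ₗ[ℝ] TangentSpace (𝓡 n) x →ₗ[ℝ] ℝ

variable (n M) in
/-- Sections of `T* ⊗ T* ⊗ T*`. -/
abbrev ThreeTensor := ∀ x : M, TangentSpace (𝓡 n) x →ₗ[ℝ] TangentSpace (𝓡 n) x →ₗ[ℝ]
  TangentSpace (𝓡 n) x →ₗ[ℝ] ℝ

/-- Smooth vector fields. -/
def IsSmoothVField (X : VField n M) : Prop :=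
  ContMDiff (𝓡 n) (𝓡 n).tangent ∞ (fun x => (⟨x, X x⟩ : TangentBundle (𝓡 n) M))

variable (n) in
/-- Smooth real functions. -/
def IsSmoothFun (f : M → ℝ) : Prop := ContMDiff (𝓡 n) 𝓘(ℝ, ℝ) ∞ f

variable (n) in
/-- The differential of a real function at a point, as a covector. -/
def dfun (f : M → ℝ) (x : M) : Module.Dual ℝ (TangentSpace (𝓡 n) x) :=
  (mfderiv (𝓡 n) 𝓘(ℝ, ℝ) f x : TangentSpace (𝓡 n) x →L[ℝ] ℝ).toLinearMap

/-- The Lie bracket of vector fields. -/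
def lieBr (X Y : VField n M) : VField n M := VectorField.mlieBracket (𝓡 n) X Y

/-- A (smooth) Riemannian metric. -/
structure IsRiemannianMetric (g : TwoTensor n M) : Prop where
  symm : ∀ x v w, g x v w = g x w v
  pos : ∀ x v, v ≠ 0 → 0 < g x v v
  smooth : ∀ X Y : VField n M, IsSmoothVField X → IsSmoothVField Y →
    IsSmoothFun n (fun x => g x (X x) (Y x))

/-- A (smooth) differential two-form. -/
structure IsTwoForm (b : TwoTensor n M) : Prop where
  skew : ∀ x v w, b x v w = - b x w v
  smooth : ∀ X Y : VField n M, IsSmoothVField X → IsSmoothVField Y →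
    IsSmoothFun n (fun x => b x (X x) (Y x))

/-- `db` is the exterior derivative of the two-form `b`. -/
def IsExteriorDerivative (b : TwoTensor n M) (db : ThreeTensor n M) : Prop :=
  ∀ X Y Z : VField n M, IsSmoothVField X → IsSmoothVField Y → IsSmoothVField Z → ∀ x,
    db x (X x) (Y x) (Z x) =
      dfun n (fun y => b y (Y y) (Z y)) x (X x)
      - dfun n (fun y => b y (X y) (Z y)) x (Y x)
      + dfun n (fun y => b y (X y) (Y y)) x (Z x)
      - b x (lieBr X Y x) (Z x) + b x (lieBr X Z x) (Y x) - b x (lieBr Y Z x) (X x)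

/-- `D X Y = ∇_X Y` is an affine connection. Only its values on smooth fields matter. -/
structure IsAffineConnection (D : VField n M → VField n M → VField n M) : Prop where
  smooth : ∀ X Y, IsSmoothVField X → IsSmoothVField Y → IsSmoothVField (D X Y)
  add_left : ∀ X X' Y, IsSmoothVField X → IsSmoothVField X' → IsSmoothVField Y → ∀ x,
    D (fun y => X y + X' y) Y x = D X Y x + D X' Y x
  smul_left : ∀ (f : M → ℝ) X Y, IsSmoothFun n f → IsSmoothVField X → IsSmoothVField Y → ∀ x,
    D (fun y => f y • X y) Y x = f x • D X Y x
  add_right : ∀ X Y Y', IsSmoothVField X → IsSmoothVField Y → IsSmoothVField Y' → ∀ x,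
    D X (fun y => Y y + Y' y) x = D X Y x + D X Y' x
  leibniz : ∀ (f : M → ℝ) X Y, IsSmoothFun n f → IsSmoothVField X → IsSmoothVField Y → ∀ x,
    D X (fun y => f y • Y y) x = f x • D X Y x + dfun n f x (X x) • Y x

/-- `D` is the Levi-Civita connection of `g`. -/
structure IsLeviCivita (g : TwoTensor n M) (D : VField n M → VField n M → VField n M) : Prop
    extends IsAffineConnection D where
  torsion_free : ∀ X Y, IsSmoothVField X → IsSmoothVField Y → ∀ x,
    D X Y x - D Y X x = lieBr X Y x
  metric : ∀ X Y Z, IsSmoothVField X → IsSmoothVField Y → IsSmoothVField Z → ∀ x,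
    dfun n (fun y => g y (Y y) (Z y)) x (X x) = g x (D X Y x) (Z x) + g x (Y x) (D X Z x)

/-- `Rc` is the Ricci tensor of the connection `D`, which may have torsion:
`Rc(v, w)` is the trace of `u ↦ R(u, v)w`, where `R(X, Y)Z = ∇_X∇_Y Z - ∇_Y∇_X Z - ∇_[X,Y] Z`. -/
def IsRicciTensor (D : VField n M → VField n M → VField n M) (Rc : TwoTensor n M) : Prop :=
  ∃ Rm : ∀ x : M, TangentSpace (𝓡 n) x →ₗ[ℝ] TangentSpace (𝓡 n) x →ₗ[ℝ]
      TangentSpace (𝓡 n) x →ₗ[ℝ] TangentSpace (𝓡 n) x,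
    (∀ X Y Z : VField n M, IsSmoothVField X → IsSmoothVField Y → IsSmoothVField Z → ∀ x,
      Rm x (X x) (Y x) (Z x) = D X (D Y Z) x - D Y (D X Z) x - D (lieBr X Y) Z x) ∧
    ∀ x v w, Rc x v w =
      LinearMap.trace ℝ (TangentSpace (𝓡 n) x) (((Rm x).flip v).flip w)

variable (n) in
/-- The `i`-th vector of the standard basis of `T_x M`. -/
def tanBasis (x : M) (i : Fin n) : TangentSpace (𝓡 n) x :=
  (EuclideanSpace.single i 1 : EuclideanSpace ℝ (Fin n))

/-- The inverse matrix `g^{ij}` of the matrix `g_{ij} = g(e_i, e_j)`. -/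
def gInv (g : TwoTensor n M) (x : M) : Matrix (Fin n) (Fin n) ℝ :=
  (Matrix.of fun i j => g x (tanBasis n x i) (tanBasis n x j))⁻¹

/-- The contraction `H(v, e_p, e_q) H(w, e^p, e^q)`, that is `H_{ipq} H_j^{pq}`. -/
def hSquare (g : TwoTensor n M) (H : ThreeTensor n M) (x : M) (v w : TangentSpace (𝓡 n) x) : ℝ :=
  ∑ p, ∑ q, ∑ r, ∑ s, gInv g x p r * gInv g x q s *
    H x v (tanBasis n x p) (tanBasis n x q) * H x w (tanBasis n x r) (tanBasis n x s)

/-- `δ = d^*_g H`, that is `δ(v, w) = - g^{ij} (∇_{e_i} H)(e_j, v, w)`, where `D` is the Levi-Civita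
connection of `g` and `DH = ∇H`. -/
def IsCodifferential (g : TwoTensor n M) (D : VField n M → VField n M → VField n M)
    (H : ThreeTensor n M) (δ : TwoTensor n M) : Prop :=
  ∃ DH : ∀ x : M, TangentSpace (𝓡 n) x →ₗ[ℝ] TangentSpace (𝓡 n) x →ₗ[ℝ]
      TangentSpace (𝓡 n) x →ₗ[ℝ] TangentSpace (𝓡 n) x →ₗ[ℝ] ℝ,
    (∀ W X Y Z : VField n M, IsSmoothVField W → IsSmoothVField X → IsSmoothVField Y →
      IsSmoothVField Z → ∀ x,
      DH x (W x) (X x) (Y x) (Z x) = dfun n (fun y => H y (X y) (Y y) (Z y)) x (W x)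
        - H x (D W X x) (Y x) (Z x) - H x (X x) (D W Y x) (Z x) - H x (X x) (Y x) (D W Z x)) ∧
    ∀ x v w, δ x v w =
      - ∑ i, ∑ j, gInv g x i j * DH x (tanBasis n x i) (tanBasis n x j) v w

/-- The `B`-field renormalization group flow on the set of times `J`, with background three-form
`H₀`: with `H = H₀ + db`,
`∂g/∂t = -2 Rc + (1/2) H_{ipq} H_j^{pq}` and `∂b/∂t = - d^*_g H`. -/
def IsBFieldRGFlow (J : Set ℝ) (H₀ : ThreeTensor n M) (g b : ℝ → TwoTensor n M) : Prop :=
  ∀ t ∈ J, IsRiemannianMetric (g t) ∧ IsTwoForm (b t) ∧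
    ∃ (db : ThreeTensor n M) (D : VField n M → VField n M → VField n M) (Rc δ : TwoTensor n M),
      IsExteriorDerivative (b t) db ∧ IsLeviCivita (g t) D ∧ IsRicciTensor D Rc ∧
      IsCodifferential (g t) D (fun x => H₀ x + db x) δ ∧
      ∀ (x : M) (v w : TangentSpace (𝓡 n) x),
        HasDerivWithinAt (fun τ => g τ x v w)
          (-2 * Rc x v w + 1 / 2 * hSquare (g t) (fun x => H₀ x + db x) x v w) J t ∧
        HasDerivWithinAt (fun τ => b τ x v w) (- δ x v w) J t

end Manifold

/-! ## Exact Courant algebroids -/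

/-- An exact real Courant algebroid over `M`, on the smooth vector bundle `E` with fibre `F`.  The
bracket is the non-skew (Dorfman) form of the Courant bracket. -/
structure ExactCourantAlgebroid (n : ℕ) (M : Type*) [TopologicalSpace M]
    [ChartedSpace (EuclideanSpace ℝ (Fin n)) M] [IsManifold (𝓡 n) ∞ M]
    (F : Type*) [NormedAddCommGroup F] [NormedSpace ℝ F]
    (E : M → Type*) [TopologicalSpace (Bundle.TotalSpace F E)]
    [∀ x, AddCommGroup (E x)] [∀ x, Module ℝ (E x)] [∀ x, TopologicalSpace (E x)]
    [FiberBundle F E] [VectorBundle ℝ F E] where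
  /-- The anchor `π : E → T`. -/
  anchor : ∀ x : M, E x →ₗ[ℝ] TangentSpace (𝓡 n) x
  anchor_smooth : ∀ a : Cₛ^∞⟮𝓡 n; F, E⟯, IsSmoothVField (fun x => anchor x (a x))
  /-- The bundle metric `⟨·, ·⟩` on `E`. -/
  pairing : ∀ x : M, E x →ₗ[ℝ] E x →ₗ[ℝ] ℝ
  pairing_smooth : ∀ a b : Cₛ^∞⟮𝓡 n; F, E⟯, IsSmoothFun n (fun x => pairing x (a x) (b x))
  pairing_symm : ∀ x e e', pairing x e e' = pairing x e' e
  pairing_nondegenerate : ∀ x e, (∀ e', pairing x e e' = 0) → e = 0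
  /-- The map `π^* : T* → E* = E` dual to the anchor, where `E* = E` through the bundle metric. -/
  coanchor : ∀ x : M, Module.Dual ℝ (TangentSpace (𝓡 n) x) →ₗ[ℝ] E x
  pairing_coanchor : ∀ x ξ e, pairing x (coanchor x ξ) e = ξ (anchor x e)
  /-- The sequence `0 → T* → E → T → 0` is exact (injectivity of `π^*` is dual to surjectivity of
  `π`). -/
  anchor_surjective : ∀ x, Function.Surjective (anchor x)
  ker_anchor : ∀ x, LinearMap.ker (anchor x) = LinearMap.range (coanchor x)
  /-- The Courant bracket on smooth sections. -/
  bracket : Cₛ^∞⟮𝓡 n; F, E⟯ →ₗ[ℝ] Cₛ^∞⟮𝓡 n; F, E⟯ →ₗ[ℝ] Cₛ^∞⟮𝓡 n; F, E⟯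
  jacobi : ∀ a b c, bracket a (bracket b c) = bracket (bracket a b) c + bracket b (bracket a c)
  anchor_bracket : ∀ a b : Cₛ^∞⟮𝓡 n; F, E⟯, ∀ x, anchor x (bracket a b x) =
    lieBr (fun y => anchor y (a y)) (fun y => anchor y (b y)) x
  leibniz : ∀ (f : M → ℝ) (a b fb : Cₛ^∞⟮𝓡 n; F, E⟯), IsSmoothFun n f →
    (∀ x, fb x = f x • b x) →
    ∀ x, bracket a fb x = f x • bracket a b x + dfun n f x (anchor x (a x)) • b x
  pairing_invariant : ∀ (a b c : Cₛ^∞⟮𝓡 n; F, E⟯) (x : M),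
    dfun n (fun y => pairing y (b y) (c y)) x (anchor x (a x)) =
      pairing x (bracket a b x) (c x) + pairing x (b x) (bracket a c x)
  bracket_symm_part : ∀ (a b : Cₛ^∞⟮𝓡 n; F, E⟯) (x : M),
    bracket a b x + bracket b a x = coanchor x (dfun n (fun y => pairing y (a y) (b y)) x)

namespace ExactCourantAlgebroid

variable {n : ℕ} {M : Type*} [TopologicalSpace M] [ChartedSpace (EuclideanSpace ℝ (Fin n)) M]
  [IsManifold (𝓡 n) ∞ M]
  {F : Type*} [NormedAddCommGroup F] [NormedSpace ℝ F]
  {E : M → Type*} [TopologicalSpace (Bundle.TotalSpace F E)]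
  [∀ x, AddCommGroup (E x)] [∀ x, Module ℝ (E x)] [∀ x, TopologicalSpace (E x)]
  [FiberBundle F E] [VectorBundle ℝ F E]

variable (n F) in
/-- Smooth sections of `E`. -/
def IsSmoothSection (a : ∀ x : M, E x) : Prop :=
  ContMDiff (𝓡 n) ((𝓡 n).prod 𝓘(ℝ, F)) ∞ (fun x => Bundle.TotalSpace.mk' F x (a x))

variable (C : ExactCourantAlgebroid n M F E)

open scoped Classical in
/-- The Courant bracket of two sections given as families; it is set to zero unless both are
smooth. -/
def bracketFun (a b : ∀ x : M, E x) : ∀ x : M, E x :=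
  if h : IsSmoothSection n F a ∧ IsSmoothSection n F b then
    fun x => C.bracket ⟨a, h.1⟩ ⟨b, h.2⟩ x
  else fun _ => 0

/-- A smooth isotropic splitting `s : T → E` of the anchor. -/
structure IsIsotropicSplitting (s : ∀ x : M, TangentSpace (𝓡 n) x →ₗ[ℝ] E x) : Prop where
  smooth : ∀ X : VField n M, IsSmoothVField X → IsSmoothSection n F (fun x => s x (X x))
  splits : ∀ x v, C.anchor x (s x v) = v
  isotropic : ∀ x v w, C.pairing x (s x v) (s x w) = 0

/-- `H` is the three-form of the splitting `s`: `H(X, Y, Z) = ⟨[sX, sY], sZ⟩`. -/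
def IsTorsionForm (s : ∀ x : M, TangentSpace (𝓡 n) x →ₗ[ℝ] E x) (H : ThreeTensor n M) : Prop :=
  ∀ X Y Z : VField n M, IsSmoothVField X → IsSmoothVField Y → IsSmoothVField Z → ∀ x,
    H x (X x) (Y x) (Z x) =
      C.pairing x (C.bracketFun (fun y => s y (X y)) (fun y => s y (Y y)) x) (s x (Z x))

/-- A generalized metric: a smooth self-adjoint involution `G` of `E` with `⟨G ·, ·⟩` positive
definite. -/
structure IsGeneralizedMetric (G : ∀ x : M, E x →ₗ[ℝ] E x) : Prop where
  smooth : ∀ a : ∀ x : M, E x, IsSmoothSection n F a → IsSmoothSection n F (fun x => G x (a x))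
  involutive : ∀ x e, G x (G x e) = e
  selfAdjoint : ∀ x e e', C.pairing x (G x e) e' = C.pairing x e (G x e')
  pos : ∀ x e, e ≠ 0 → 0 < C.pairing x (G x e) e

/-- `g` is the Riemannian metric induced by `G`: as maps, `g : T → T*` is the inverse of
`π G π^* : T* → T`. -/
structure IsInducedMetric (G : ∀ x : M, E x →ₗ[ℝ] E x) (g : TwoTensor n M) : Prop where
  riemannian : IsRiemannianMetric g
  inverse : ∀ x v ξ, g x v = ξ ↔ C.anchor x (G x (C.coanchor x ξ)) = v

/-- The splitting `s_G = G π^* g`. -/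
def metricSplitting (G : ∀ x : M, E x →ₗ[ℝ] E x) (g : TwoTensor n M) (x : M) :
    TangentSpace (𝓡 n) x →ₗ[ℝ] E x :=
  G x ∘ₗ C.coanchor x ∘ₗ g x

/-- The endomorphism `π^* m π` of `E` defined by `m : T → T*`. -/
def bElement (m : TwoTensor n M) (x : M) : E x →ₗ[ℝ] E x :=
  C.coanchor x ∘ₗ m x ∘ₗ C.anchor x

/-- The orthogonal map `e^b = 1 + π^* b π`. -/
def expB (b : TwoTensor n M) (x : M) : E x →ₗ[ℝ] E x := LinearMap.id + C.bElement b x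

/-- `(g, b)` is the pair of metric and torsion potential induced by `G` and the background
splitting `s₀`: `g` is the induced metric and `s_G = e^b s₀`. -/
structure IsInducedPair (s₀ : ∀ x : M, TangentSpace (𝓡 n) x →ₗ[ℝ] E x)
    (G : ∀ x : M, E x →ₗ[ℝ] E x) (g b : TwoTensor n M) : Prop where
  metric : C.IsInducedMetric G g
  twoForm : IsTwoForm b
  splitting : ∀ x, C.metricSplitting G g x = C.expB b x ∘ₗ s₀ x

/-- The projections `P_± = (1 ± G)/2`, with `ε = ±1`. -/
def proj (G : ∀ x : M, E x →ₗ[ℝ] E x) (ε : ℝ) (x : M) : E x →ₗ[ℝ] E x :=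
  (1 / 2 : ℝ) • (LinearMap.id + ε • G x)

/-- The lift `X^± = (G ± 1) π^* g X` of a vector field, with `ε = ±1`. -/
def lift (G : ∀ x : M, E x →ₗ[ℝ] E x) (g : TwoTensor n M) (ε : ℝ) (X : VField n M) (x : M) : E x :=
  (G x + ε • (LinearMap.id : E x →ₗ[ℝ] E x)) (C.coanchor x (g x (X x)))

/-- The Bismut connections `∇^±_X Y = π P_± [X^∓, Y^±]`, with `ε = ±1`. -/
def bismut (G : ∀ x : M, E x →ₗ[ℝ] E x) (g : TwoTensor n M) (ε : ℝ) (X Y : VField n M) :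
    VField n M :=
  fun x => C.anchor x (proj G ε x (C.bracketFun (C.lift G g (-ε) X) (C.lift G g ε Y) x))

/-- The element `P_- η P_+ - P_+ η^* P_-` of `so(E)` associated with `m ∈ T* ⊗ T*`, where
`η = π^* m π`. The adjoint of `η` is `η^* = π^* mᵗ π` with `mᵗ(v, w) = m(w, v)`. -/
def lieElement (G : ∀ x : M, E x →ₗ[ℝ] E x) (m : TwoTensor n M) (x : M) : E x →ₗ[ℝ] E x :=
  proj G (-1) x ∘ₗ C.bElement m x ∘ₗ proj G 1 x
    - proj G 1 x ∘ₗ C.bElement (fun y => (m y).flip) x ∘ₗ proj G (-1) x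

/-- Generalized Ricci flow `∂G/∂t = -2 [𝓡, G]` on the set of times `J`, where `𝓡` is the element of
`so(E)` associated with the Ricci tensor of `∇^-`. -/
def IsGeneralizedRicciFlow [∀ x, IsTopologicalAddGroup (E x)] [∀ x, ContinuousSMul ℝ (E x)]
    (J : Set ℝ) (G : ℝ → ∀ x : M, E x →ₗ[ℝ] E x) : Prop :=
  ∀ t ∈ J, C.IsGeneralizedMetric (G t) ∧
    ∃ g Rc : TwoTensor n M, C.IsInducedMetric (G t) g ∧
      IsRicciTensor (C.bismut (G t) g (-1)) Rc ∧
      ∀ (x : M) (e : E x),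
        HasDerivWithinAt (fun τ => G τ x e)
          ((-2 : ℝ) • (C.lieElement (G t) Rc x ∘ₗ G t x - G t x ∘ₗ C.lieElement (G t) Rc x) e) J t

end ExactCourantAlgebroid

end

/-! A generalized metric `G` on an exact Courant algebroid is the same as a pair `(g, b)`: its
eigenbundles are the graphs of `b ± g` over the background splitting, parametrized by the lifts
`X^± = s₀ X + π^* (b ± g) X` (`IsInducedPair.pointLift_eq`). The equivalence of the two flows
rests on two facts.

*The Ricci tensor of `∇^-`.* The connections `∇^±` are metric and have opposite torsion
(`bismut_metric`, `bismut_sub_bismut_neg`), so their mean is the Levi-Civita connection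
(`isLeviCivita_meanConnection`). Their difference is the three-form of the splitting `s_G`
(`metric_bismut_sub_bismut`), which is `H = H₀ + db` (`torsionFun_expB`). Thus `g(∇^-_X Y, Z) =
g(∇_X Y, Z) - H(X, Y, Z) / 2`, and a curvature computation gives `Rc(∇^-) = Rc - (1/4) H² + (1/2)
d^*H` (`ricci_of_skew_torsion`). The first two terms are symmetric and the third one is skew, so
`∂(g + b)/∂t = -2 Rc(∇^-)` is the `B`-field renormalization group flow.

*Linear algebra at a point.* For a bilinear form `r`, with associated element `ℛ` of `so(E)`, the
equation `∂G/∂t = -2 [ℛ, G]` is equivalent to `∂(g + b)/∂t = -2 r`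
(`hasDerivWithinAt_generalizedMetric_iff`). Both sides are compared on the lifts. If `X^+` is
taken at time `t` and `Y^-` at time `τ`, then `⟨(G_τ - G_t) X^+, Y^-⟩ = 2 ((g + b)_τ - (g +
b)_t)(X, Y)` exactly, while `⟨-2 [ℛ, G] X^+, Y^-⟩ = -4 r(X, Y)`, and the pairings of two lifts of
the same sign vanish on both sides. Replacing `Y^-` at time `τ` by its value at time `t` costs a
term of second order, once `g`, `b` and `G` are differentiable; each of `G` and `(g, b)` is a
rational function of the other, so differentiability passes in both directions.

The statement also contains the existence of tensors: `H₀`, the induced pair, `db`, Ricci tensors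
and `d^*H` are obtained from operations on smooth fields that are linear over the smooth functions
(`exists_linearMap_of_tensorial`). Smoothness of the induced pair follows from Cramer's rule in a
smooth frame (`isSmoothSection_of_pairing`). -/

open scoped Manifold ContDiff Bundle
open ExactCourantAlgebroid Filter Topology

set_option linter.unusedSectionVars false

/-! ### Smooth sections and frames -/

section Frames

variable {n : ℕ} {M : Type*} [TopologicalSpace M]
  [ChartedSpace (EuclideanSpace ℝ (Fin n)) M] [IsManifold (𝓡 n) ∞ M]

theorem IsSmoothFun.neg {f : M → ℝ} (hf : IsSmoothFun n f) :
    IsSmoothFun n (fun x => - f x) := ContMDiff.neg hf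

theorem IsSmoothFun.mul {f g : M → ℝ} (hf : IsSmoothFun n f) (hg : IsSmoothFun n g) :
    IsSmoothFun n (fun x => f x * g x) := ContMDiff.mul hf hg

theorem isSmoothFun_const (c : ℝ) : IsSmoothFun n (fun _ : M => c) := contMDiff_const

variable {F : Type*} [NormedAddCommGroup F] [NormedSpace ℝ F]
  {E : M → Type*} [TopologicalSpace (Bundle.TotalSpace F E)]
  [∀ x, AddCommGroup (E x)] [∀ x, Module ℝ (E x)] [∀ x, TopologicalSpace (E x)]
  [FiberBundle F E] [VectorBundle ℝ F E]

namespace ExactCourantAlgebroid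

theorem IsSmoothSection.add {a b : ∀ x : M, E x} (ha : IsSmoothSection n F a)
    (hb : IsSmoothSection n F b) : IsSmoothSection n F (fun x => a x + b x) :=
  ContMDiff.add_section ha hb

theorem IsSmoothSection.sub {a b : ∀ x : M, E x} (ha : IsSmoothSection n F a)
    (hb : IsSmoothSection n F b) : IsSmoothSection n F (fun x => a x - b x) :=
  ContMDiff.sub_section ha hb

theorem IsSmoothSection.smul {f : M → ℝ} {a : ∀ x : M, E x} (hf : IsSmoothFun n f)
    (ha : IsSmoothSection n F a) : IsSmoothSection n F (fun x => f x • a x) :=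
  ContMDiff.smul_section hf ha

theorem IsSmoothSection.const_smul (c : ℝ) {a : ∀ x : M, E x} (ha : IsSmoothSection n F a) :
    IsSmoothSection n F (fun x => c • a x) :=
  ContMDiff.const_smul_section ha

theorem IsSmoothSection.sum {ι : Type*} {s : Finset ι} {a : ι → ∀ x : M, E x}
    (ha : ∀ i ∈ s, IsSmoothSection n F (a i)) :
    IsSmoothSection n F (fun x => ∑ i ∈ s, a i x) :=
  ContMDiff.sum_section ha

end ExactCourantAlgebroid

variable [T2Space M] [FiniteDimensional ℝ F] [ContMDiffVectorBundle ∞ F E (𝓡 n)]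

variable (n F E) in
/-- Around every point there are finitely many global smooth sections which form a frame near the
point, and which generate the module of smooth sections after multiplication by a cut-off
function `φ`. The sections are a local frame times a bump function `ψ`, and `φ = ψ²`: one factor
goes into the sections, the other one makes the coefficients globally smooth. -/
theorem exists_smooth_frame (x₀ : M) :
    ∃ s : Fin (Module.finrank ℝ F) → ∀ x : M, E x, (∀ i, IsSmoothSection n F (s i)) ∧
      (∃ u ∈ 𝓝 x₀, IsLocalFrameOn (𝓡 n) F ∞ s u) ∧
      ∃ φ : M → ℝ, IsSmoothFun n φ ∧ φ x₀ = 1 ∧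
        ∀ σ : ∀ x : M, E x, IsSmoothSection n F σ →
          ∃ c : Fin (Module.finrank ℝ F) → M → ℝ, (∀ i, IsSmoothFun n (c i)) ∧
            (∀ x, φ x • σ x = ∑ i, c i x • s i x) ∧ (σ x₀ = 0 → ∀ i, c i x₀ = 0) := by
  have : ContMDiffVectorBundle 1 F E (𝓡 n) := ContMDiffVectorBundle.of_le (n := ∞) (by simp)
  set e := trivializationAt F E x₀
  have hx₀ : x₀ ∈ e.baseSet := FiberBundle.mem_baseSet_trivializationAt' x₀
  have hb := e.open_baseSet.mem_nhds hx₀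
  let bs := Module.finBasis ℝ F
  obtain ⟨ψ, hψ, -⟩ := (SmoothBumpFunction.nhds_basis_support (I := 𝓡 n) hb).mem_iff.1 hb
  have hψ1 := ψ.eventuallyEq_one
  have hframe := e.isLocalFrameOn_localFrame_baseSet (𝓡 n) ∞ bs
  have hs : ∀ i, IsSmoothSection n F (fun x => ψ x • e.localFrame bs i x) := fun i =>
    (ψ.contMDiff.contMDiffOn).smul_section_of_tsupport e.open_baseSet hψ (hframe.contMDiffOn i)
  refine ⟨fun i x => ψ x • e.localFrame bs i x, hs, ⟨e.baseSet ∩ {x | ψ x = 1}, inter_mem hb hψ1,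
    (hframe.mono Set.inter_subset_left).congr fun i x hx => ?_⟩,
    fun x => ψ x * ψ x, ψ.contMDiff.mul ψ.contMDiff, ?_, fun σ hσ => ?_⟩
  · have : ψ x = 1 := hx.2
    simp [this]
  · simp
  · refine ⟨fun i x => ψ x • e.localFrameCoeff (𝓡 n) bs i x (σ x), fun i => ?_, fun x => ?_,
      fun h i => by simp [h]⟩
    · refine contMDiff_of_tsupport fun x hx => ψ.contMDiff.contMDiffAt.smul ?_
      have hx' : x ∈ e.baseSet := hψ (closure_mono (Function.support_smul_subset_left _ _) hx)
      exact contMDiffAt_localFrameCoeff bs hx' (hσ x) i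
    · by_cases hx : x ∈ e.baseSet
      · conv_lhs => rw [e.eq_sum_localFrameCoeff_smul (I := 𝓡 n) (b := bs) (s := σ) hx]
        simp only [Finset.smul_sum, smul_smul, smul_eq_mul]
        exact Finset.sum_congr rfl fun i _ => by ring_nf
      · have : ψ x = 0 := by
          by_contra h
          exact hx (hψ (subset_closure h))
        simp [this]

theorem exists_smooth_section (x : M) (e : E x) :
    ∃ a : ∀ x : M, E x, IsSmoothSection n F a ∧ a x = e := by
  obtain ⟨s, hs, ⟨u, hu, hfr⟩, -⟩ := exists_smooth_frame n F E x
  refine ⟨fun y => ∑ i, (hfr.toBasisAt (mem_of_mem_nhds hu)).repr e i • s i y,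
    IsSmoothSection.sum fun i _ => (hs i).const_smul _, ?_⟩
  simpa using (hfr.toBasisAt (mem_of_mem_nhds hu)).sum_repr e

theorem contMDiffAt_matrix_det {ι : Type*} [Fintype ι] [DecidableEq ι] {A : M → Matrix ι ι ℝ}
    {x : M} (hA : ∀ i j, ContMDiffAt (𝓡 n) 𝓘(ℝ, ℝ) ∞ (fun y => A y i j) x) :
    ContMDiffAt (𝓡 n) 𝓘(ℝ, ℝ) ∞ (fun y => (A y).det) x := by
  simp only [Matrix.det_apply]
  refine contMDiffAt_finsetSum fun σ _ => ?_
  simp only [Units.smul_def, zsmul_eq_mul]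
  exact contMDiffAt_const.mul (contMDiffAt_finsetProd fun i _ => hA _ _)

/-- If a fibrewise nondegenerate smooth bilinear form `Q` pairs a section `e` with every smooth
section to a smooth function, then `e` is smooth: by Cramer's rule its coefficients in a smooth
frame are quotients of smooth determinants. -/
theorem isSmoothSection_of_pairing (Q : ∀ x : M, E x →ₗ[ℝ] E x →ₗ[ℝ] ℝ)
    (hQ : ∀ a b : ∀ x : M, E x, IsSmoothSection n F a → IsSmoothSection n F b →
      IsSmoothFun n (fun x => Q x (a x) (b x)))
    (hnd : ∀ x e, (∀ e', Q x e e' = 0) → e = 0)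
    (e : ∀ x : M, E x)
    (he : ∀ a : ∀ x : M, E x, IsSmoothSection n F a → IsSmoothFun n (fun x => Q x (e x) (a x))) :
    IsSmoothSection n F e := by
  intro x₀
  obtain ⟨s, hs, ⟨u, hu, hfr⟩, -⟩ := exists_smooth_frame n F E x₀
  refine hfr.contMDiffAt_of_coeff (fun i => ?_) hu
  set N : M → Matrix (Fin (Module.finrank ℝ F)) (Fin (Module.finrank ℝ F)) ℝ :=
    fun y => Matrix.of fun j k => Q y (s k y) (s j y) with hN
  set v : M → Fin (Module.finrank ℝ F) → ℝ := fun y j => Q y (e y) (s j y) with hv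
  have hdet : ∀ y ∈ u, (N y).det ≠ 0 := by
    intro y hy h0
    obtain ⟨w, hw, hw0⟩ := Matrix.exists_mulVec_eq_zero_iff.2 h0
    refine hw ?_
    have hz : ∑ k, w k • s k y = 0 := by
      refine hnd y _ fun e' => ?_
      rw [← (hfr.toBasisAt hy).sum_repr e', map_sum]
      refine Finset.sum_eq_zero fun j _ => ?_
      have := congrFun hw0 j
      simp only [Matrix.mulVec, dotProduct, hN, Matrix.of_apply, Pi.zero_apply] at this
      simp only [map_smul, IsLocalFrameOn.toBasisAt_coe, map_sum, LinearMap.sum_apply,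
        LinearMap.smul_apply, smul_eq_mul]
      rw [← mul_zero ((hfr.toBasisAt hy).repr e' j), ← this]
      simp [mul_comm]
    exact funext fun k => Fintype.linearIndependent_iff.1 (hfr.linearIndependent hy) w hz k
  -- Cramer's rule for the system `N c = v` satisfied by the coefficients `c` of `e`
  have hcoef : ∀ y ∈ u, hfr.coeff i y (e y) = ((N y).updateCol i (v y)).det / (N y).det := by
    intro y hy
    have h1 : (N y).mulVec (fun k => hfr.coeff k y (e y)) = v y := by
      ext j
      simp only [Matrix.mulVec, dotProduct, hN, Matrix.of_apply, hv]
      conv_rhs => rw [hfr.coeff_sum_eq e hy]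
      simp [mul_comm]
    rw [← h1, ← Matrix.cramer_apply, Matrix.cramer_eq_adjugate_mulVec, Matrix.mulVec_mulVec,
      Matrix.adjugate_mul, Matrix.smul_mulVec, Matrix.one_mulVec, eq_div_iff (hdet y hy)]
    simp [mul_comm]
  have hNs : ∀ j k, ContMDiffAt (𝓡 n) 𝓘(ℝ, ℝ) ∞ (fun y => N y j k) x₀ :=
    fun j k => hQ _ _ (hs k) (hs j) x₀
  have h2 : ContMDiffAt (𝓡 n) 𝓘(ℝ, ℝ) ∞
      (fun y => ((N y).updateCol i (v y)).det / (N y).det) x₀ := by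
    refine ContMDiffAt.div₀ (contMDiffAt_matrix_det fun j k => ?_) (contMDiffAt_matrix_det hNs)
      (hdet _ (mem_of_mem_nhds hu))
    by_cases hk : k = i
    · subst hk
      simpa [Matrix.updateCol_apply] using he _ (hs j) x₀
    · simpa [Matrix.updateCol_apply, hk] using hNs j k
  exact h2.congr_of_eventuallyEq (eventually_of_mem hu fun y hy => hcoef y hy)

end Frames

/-! ### Tensors from operations on smooth vector fields -/

section Tensoriality

variable {n : ℕ} {M : Type*} [TopologicalSpace M]
  [ChartedSpace (EuclideanSpace ℝ (Fin n)) M] [IsManifold (𝓡 n) ∞ M]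

theorem IsSmoothVField.isSmoothSection {X : VField n M} (hX : IsSmoothVField X) :
    IsSmoothSection n (EuclideanSpace ℝ (Fin n)) X := hX

theorem IsSmoothVField.add {X Y : VField n M} (hX : IsSmoothVField X) (hY : IsSmoothVField Y) :
    IsSmoothVField (fun x => X x + Y x) := hX.isSmoothSection.add hY

theorem IsSmoothVField.sub {X Y : VField n M} (hX : IsSmoothVField X) (hY : IsSmoothVField Y) :
    IsSmoothVField (fun x => X x - Y x) := hX.isSmoothSection.sub hY

theorem IsSmoothVField.smul {f : M → ℝ} {X : VField n M} (hf : IsSmoothFun n f)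
    (hX : IsSmoothVField X) : IsSmoothVField (fun x => f x • X x) :=
  IsSmoothSection.smul hf hX.isSmoothSection

theorem IsSmoothVField.const_smul (c : ℝ) {X : VField n M} (hX : IsSmoothVField X) :
    IsSmoothVField (fun x => c • X x) :=
  IsSmoothSection.const_smul c hX.isSmoothSection

theorem isSmoothVField_zero : IsSmoothVField (fun x => (0 : TangentSpace (𝓡 n) x) : VField n M) :=
  Bundle.contMDiff_zeroSection _ _

/-- An operation on vector fields is tensorial at `x` if on smooth fields it is additive and
multiplication of the field by a smooth function `f` multiplies the value by `f x`. -/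
structure IsTensorialAt (x : M) {W : Type*} [AddCommGroup W] [Module ℝ W]
    (Φ : VField n M → W) : Prop where
  add : ∀ X Y, IsSmoothVField X → IsSmoothVField Y → Φ (fun y => X y + Y y) = Φ X + Φ Y
  smul : ∀ (f : M → ℝ) X, IsSmoothFun n f → IsSmoothVField X → Φ (fun y => f y • X y) = f x • Φ X

variable [T2Space M]

theorem exists_smooth_vField (x : M) (v : TangentSpace (𝓡 n) x) :
    ∃ X : VField n M, IsSmoothVField X ∧ X x = v :=
  exists_smooth_section (F := EuclideanSpace ℝ (Fin n)) (E := (TangentSpace (𝓡 n) : M → Type _)) x v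

variable {W : Type*} [AddCommGroup W] [Module ℝ W]

namespace IsTensorialAt

theorem map_zero {x : M} {Φ : VField n M → W} (hΦ : IsTensorialAt x Φ) :
    Φ (fun _ => 0) = 0 := by
  have := hΦ.smul (fun _ => 0) (fun _ => 0) (isSmoothFun_const 0) isSmoothVField_zero
  simpa using this

theorem map_sum {x : M} {Φ : VField n M → W} (hΦ : IsTensorialAt x Φ) {ι : Type*} (s : Finset ι)
    (X : ι → VField n M) (hX : ∀ i, IsSmoothVField (X i)) :
    Φ (fun y => ∑ i ∈ s, X i y) = ∑ i ∈ s, Φ (X i) := by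
  classical
  induction s using Finset.induction_on with
  | empty => simpa using hΦ.map_zero
  | insert i s hi ih =>
    simp only [Finset.sum_insert hi]
    rw [hΦ.add _ _ (hX i) (IsSmoothSection.sum (F := EuclideanSpace ℝ (Fin n))
      (E := (TangentSpace (𝓡 n) : M → Type _)) fun i _ => hX i), ih]

/-- Near `x` a field `X` with `X x = 0` is a combination of frame fields with coefficients that
vanish at `x`; the cut-off function with value `1` at `x` makes this combination global. -/
theorem eq_zero {x : M} {Φ : VField n M → W} (hΦ : IsTensorialAt x Φ) {X : VField n M}
    (hX : IsSmoothVField X) (h0 : X x = 0) : Φ X = 0 := by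
  obtain ⟨s, hs, -, φ, hφ, hφx, hexp⟩ := exists_smooth_frame n (EuclideanSpace ℝ (Fin n))
    (TangentSpace (𝓡 n) : M → Type _) x
  obtain ⟨c, hc, hsum, hc0⟩ := hexp X hX
  have h1 := hΦ.smul φ X hφ hX
  rw [hφx, one_smul, funext hsum, hΦ.map_sum _ (fun i y => c i y • s i y)
    fun i => IsSmoothVField.smul (hc i) (hs i)] at h1
  rw [← h1]
  refine Finset.sum_eq_zero fun i _ => ?_
  rw [hΦ.smul (c i) (s i) (hc i) (hs i), hc0 h0 i, zero_smul]

theorem congr_point {x : M} {Φ : VField n M → W} (hΦ : IsTensorialAt x Φ) {X Y : VField n M}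
    (hX : IsSmoothVField X) (hY : IsSmoothVField Y) (h : X x = Y x) : Φ X = Φ Y := by
  have h1 := hΦ.eq_zero (hX.sub hY) (by simp [h])
  have h2 := hΦ.add _ _ (hX.sub hY) hY
  simpa [h1] using h2

end IsTensorialAt

/-- If the relation `P X L` determines an element `L` of a vector space for each smooth field `X`,
tensorially in `X`, then this element is a linear function of the value `X x`. The relational form
allows induction on the number of arguments: there `L` is the tensor in the remaining arguments. -/
theorem exists_linearMap_of_tensorial (x : M) (P : VField n M → W → Prop)
    (hex : ∀ X, IsSmoothVField X → ∃ L, P X L)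
    (huniq : ∀ X L L', IsSmoothVField X → P X L → P X L' → L = L')
    (hadd : ∀ X Y L L', IsSmoothVField X → IsSmoothVField Y → P X L → P Y L' →
      P (fun y => X y + Y y) (L + L'))
    (hsmul : ∀ (f : M → ℝ) X L, IsSmoothFun n f → IsSmoothVField X → P X L →
      P (fun y => f y • X y) (f x • L)) :
    ∃ 𝓛 : TangentSpace (𝓡 n) x →ₗ[ℝ] W, ∀ X, IsSmoothVField X → P X (𝓛 (X x)) := by
  classical
  choose! Φ hΦ using hex
  have hT : IsTensorialAt x Φ :=
    { add := fun X Y hX hY => huniq _ _ _ (hX.add hY) (hΦ _ (hX.add hY))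
        (hadd _ _ _ _ hX hY (hΦ _ hX) (hΦ _ hY))
      smul := fun f X hf hX => huniq _ _ _ (hX.smul hf) (hΦ _ (hX.smul hf))
        (hsmul _ _ _ hf hX (hΦ _ hX)) }
  choose ext hext hextx using exists_smooth_vField (n := n) x
  refine ⟨{ toFun := fun v => Φ (ext v), map_add' := fun v w => ?_, map_smul' := fun c v => ?_ },
    fun X hX => ?_⟩
  · rw [← hT.add _ _ (hext v) (hext w)]
    exact hT.congr_point (hext _) ((hext v).add (hext w)) (by simp [hextx])
  · rw [RingHom.id_apply, ← hT.smul (fun _ => c) _ (isSmoothFun_const c) (hext v)]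
    exact hT.congr_point (hext _) ((hext v).const_smul c) (by simp [hextx])
  · have : Φ (ext (X x)) = Φ X := hT.congr_point (hext _) hX (hextx _)
    simpa [this] using hΦ X hX

theorem IsTensorialAt.exists_linearMap {x : M} {Φ : VField n M → W} (hΦ : IsTensorialAt x Φ) :
    ∃ L : TangentSpace (𝓡 n) x →ₗ[ℝ] W, ∀ X, IsSmoothVField X → Φ X = L (X x) :=
  exists_linearMap_of_tensorial x (fun X L => Φ X = L) (fun _ _ => ⟨_, rfl⟩)
    (fun _ _ _ _ h h' => h.symm.trans h')
    (fun X Y L L' hX hY h h' => by rw [hΦ.add X Y hX hY, h, h'])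
    (fun f X L hf hX h => by rw [hΦ.smul f X hf hX, h])

theorem exists_bilinearMap_of_tensorial {x : M} {Φ : VField n M → VField n M → W}
    (h₁ : ∀ Y, IsSmoothVField Y → IsTensorialAt x (fun X => Φ X Y))
    (h₂ : ∀ X, IsSmoothVField X → IsTensorialAt x (fun Y => Φ X Y)) :
    ∃ L : TangentSpace (𝓡 n) x →ₗ[ℝ] TangentSpace (𝓡 n) x →ₗ[ℝ] W,
      ∀ X Y, IsSmoothVField X → IsSmoothVField Y → Φ X Y = L (X x) (Y x) := by
  refine (exists_linearMap_of_tensorial x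
    (fun X (L : TangentSpace (𝓡 n) x →ₗ[ℝ] W) => ∀ Y, IsSmoothVField Y → Φ X Y = L (Y x))
    (fun X hX => (h₂ X hX).exists_linearMap) (fun X L L' hX h h' => ?_)
    (fun X Y L L' hX hY h h' Z hZ => ?_) (fun f X L hf hX h Z hZ => ?_)).imp
    fun L hL X Y hX hY => hL X hX Y hY
  · ext v
    obtain ⟨Y, hY, rfl⟩ := exists_smooth_vField x v
    rw [← h Y hY, h' Y hY]
  · rw [(h₁ Z hZ).add X Y hX hY, h Z hZ, h' Z hZ, LinearMap.add_apply]
  · rw [(h₁ Z hZ).smul f X hf hX, h Z hZ, LinearMap.smul_apply]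

theorem exists_trilinearMap_of_tensorial {x : M} {Φ : VField n M → VField n M → VField n M → W}
    (h₁ : ∀ Y Z, IsSmoothVField Y → IsSmoothVField Z → IsTensorialAt x (fun X => Φ X Y Z))
    (h₂ : ∀ X Z, IsSmoothVField X → IsSmoothVField Z → IsTensorialAt x (fun Y => Φ X Y Z))
    (h₃ : ∀ X Y, IsSmoothVField X → IsSmoothVField Y → IsTensorialAt x (fun Z => Φ X Y Z)) :
    ∃ L : TangentSpace (𝓡 n) x →ₗ[ℝ] TangentSpace (𝓡 n) x →ₗ[ℝ] TangentSpace (𝓡 n) x →ₗ[ℝ] W,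
      ∀ X Y Z, IsSmoothVField X → IsSmoothVField Y → IsSmoothVField Z →
        Φ X Y Z = L (X x) (Y x) (Z x) := by
  refine (exists_linearMap_of_tensorial x
    (fun X (L : TangentSpace (𝓡 n) x →ₗ[ℝ] TangentSpace (𝓡 n) x →ₗ[ℝ] W) =>
      ∀ Y Z, IsSmoothVField Y → IsSmoothVField Z → Φ X Y Z = L (Y x) (Z x))
    (fun X hX => exists_bilinearMap_of_tensorial (fun Z hZ => h₂ X Z hX hZ)
      (fun Y hY => h₃ X Y hX hY)) (fun X L L' hX h h' => ?_)
    (fun X X' L L' hX hX' h h' Y Z hY hZ => ?_) (fun f X L hf hX h Y Z hY hZ => ?_)).imp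
    fun L hL X Y Z hX hY hZ => hL X hX Y Z hY hZ
  · ext v w
    obtain ⟨Y, hY, rfl⟩ := exists_smooth_vField x v
    obtain ⟨Z, hZ, rfl⟩ := exists_smooth_vField x w
    rw [← h Y Z hY hZ, h' Y Z hY hZ]
  · rw [(h₁ Y Z hY hZ).add X X' hX hX', h Y Z hY hZ, h' Y Z hY hZ, LinearMap.add_apply,
      LinearMap.add_apply]
  · rw [(h₁ Y Z hY hZ).smul f X hf hX, h Y Z hY hZ, LinearMap.smul_apply, LinearMap.smul_apply]

theorem exists_quadrilinearMap_of_tensorial {x : M}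
    {Φ : VField n M → VField n M → VField n M → VField n M → W}
    (h₀ : ∀ X Y Z, IsSmoothVField X → IsSmoothVField Y → IsSmoothVField Z →
      IsTensorialAt x (fun V => Φ V X Y Z))
    (h₁ : ∀ V Y Z, IsSmoothVField V → IsSmoothVField Y → IsSmoothVField Z →
      IsTensorialAt x (fun X => Φ V X Y Z))
    (h₂ : ∀ V X Z, IsSmoothVField V → IsSmoothVField X → IsSmoothVField Z →
      IsTensorialAt x (fun Y => Φ V X Y Z))
    (h₃ : ∀ V X Y, IsSmoothVField V → IsSmoothVField X → IsSmoothVField Y →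
      IsTensorialAt x (fun Z => Φ V X Y Z)) :
    ∃ L : TangentSpace (𝓡 n) x →ₗ[ℝ] TangentSpace (𝓡 n) x →ₗ[ℝ] TangentSpace (𝓡 n) x →ₗ[ℝ]
        TangentSpace (𝓡 n) x →ₗ[ℝ] W,
      ∀ V X Y Z, IsSmoothVField V → IsSmoothVField X → IsSmoothVField Y → IsSmoothVField Z →
        Φ V X Y Z = L (V x) (X x) (Y x) (Z x) := by
  refine (exists_linearMap_of_tensorial x
    (fun V (L : TangentSpace (𝓡 n) x →ₗ[ℝ] TangentSpace (𝓡 n) x →ₗ[ℝ]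
        TangentSpace (𝓡 n) x →ₗ[ℝ] W) =>
      ∀ X Y Z, IsSmoothVField X → IsSmoothVField Y → IsSmoothVField Z →
        Φ V X Y Z = L (X x) (Y x) (Z x))
    (fun V hV => exists_trilinearMap_of_tensorial (fun Y Z hY hZ => h₁ V Y Z hV hY hZ)
      (fun X Z hX hZ => h₂ V X Z hV hX hZ) (fun X Y hX hY => h₃ V X Y hV hX hY))
    (fun V L L' hV h h' => ?_)
    (fun V V' L L' hV hV' h h' X Y Z hX hY hZ => ?_) (fun f V L hf hV h X Y Z hX hY hZ => ?_)).imp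
    fun L hL V X Y Z hV hX hY hZ => hL V hV X Y Z hX hY hZ
  · ext u v w
    obtain ⟨X, hX, rfl⟩ := exists_smooth_vField x u
    obtain ⟨Y, hY, rfl⟩ := exists_smooth_vField x v
    obtain ⟨Z, hZ, rfl⟩ := exists_smooth_vField x w
    rw [← h X Y Z hX hY hZ, h' X Y Z hX hY hZ]
  · rw [(h₀ X Y Z hX hY hZ).add V V' hV hV', h X Y Z hX hY hZ, h' X Y Z hX hY hZ]
    simp only [LinearMap.add_apply]
  · rw [(h₀ X Y Z hX hY hZ).smul f V hf hV, h X Y Z hX hY hZ]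
    simp only [LinearMap.smul_apply]

/-- A trilinear tensorial operation on vector fields is given by a field of trilinear maps. -/
theorem exists_trilinearField_of_tensorial {W : M → Type*} [∀ x, AddCommGroup (W x)]
    [∀ x, Module ℝ (W x)] {Φ : VField n M → VField n M → VField n M → ∀ x : M, W x}
    (h₁ : ∀ x Y Z, IsSmoothVField Y → IsSmoothVField Z → IsTensorialAt x (fun X => Φ X Y Z x))
    (h₂ : ∀ x X Z, IsSmoothVField X → IsSmoothVField Z → IsTensorialAt x (fun Y => Φ X Y Z x))
    (h₃ : ∀ x X Y, IsSmoothVField X → IsSmoothVField Y → IsTensorialAt x (fun Z => Φ X Y Z x)) :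
    ∃ L : ∀ x : M, TangentSpace (𝓡 n) x →ₗ[ℝ] TangentSpace (𝓡 n) x →ₗ[ℝ]
        TangentSpace (𝓡 n) x →ₗ[ℝ] W x,
      ∀ X Y Z, IsSmoothVField X → IsSmoothVField Y → IsSmoothVField Z → ∀ x,
        L x (X x) (Y x) (Z x) = Φ X Y Z x := by
  choose L hL using fun x => exists_trilinearMap_of_tensorial (Φ := fun X Y Z => Φ X Y Z x)
    (h₁ x) (h₂ x) (h₃ x)
  exact ⟨L, fun X Y Z hX hY hZ x => (hL x X Y Z hX hY hZ).symm⟩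

/-- A quadrilinear tensorial operation on vector fields is given by a field of quadrilinear
forms. -/
theorem exists_quadrilinearField_of_tensorial
    {Φ : VField n M → VField n M → VField n M → VField n M → M → ℝ}
    (h₀ : ∀ x X Y Z, IsSmoothVField X → IsSmoothVField Y → IsSmoothVField Z →
      IsTensorialAt x (fun V => Φ V X Y Z x))
    (h₁ : ∀ x V Y Z, IsSmoothVField V → IsSmoothVField Y → IsSmoothVField Z →
      IsTensorialAt x (fun X => Φ V X Y Z x))
    (h₂ : ∀ x V X Z, IsSmoothVField V → IsSmoothVField X → IsSmoothVField Z →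
      IsTensorialAt x (fun Y => Φ V X Y Z x))
    (h₃ : ∀ x V X Y, IsSmoothVField V → IsSmoothVField X → IsSmoothVField Y →
      IsTensorialAt x (fun Z => Φ V X Y Z x)) :
    ∃ L : ∀ x : M, TangentSpace (𝓡 n) x →ₗ[ℝ] TangentSpace (𝓡 n) x →ₗ[ℝ]
        TangentSpace (𝓡 n) x →ₗ[ℝ] TangentSpace (𝓡 n) x →ₗ[ℝ] ℝ,
      ∀ V X Y Z, IsSmoothVField V → IsSmoothVField X → IsSmoothVField Y → IsSmoothVField Z →
        ∀ x, L x (V x) (X x) (Y x) (Z x) = Φ V X Y Z x := by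
  choose L hL using fun x => exists_quadrilinearMap_of_tensorial
    (Φ := fun V X Y Z => Φ V X Y Z x) (h₀ x) (h₁ x) (h₂ x) (h₃ x)
  exact ⟨L, fun V X Y Z hV hX hY hZ x => (hL x V X Y Z hV hX hY hZ).symm⟩

end Tensoriality

/-! ### Differentials, Lie brackets, connections and curvature -/

section Calculus

variable {n : ℕ} {M : Type*} [TopologicalSpace M]
  [ChartedSpace (EuclideanSpace ℝ (Fin n)) M] [IsManifold (𝓡 n) ∞ M]

theorem IsSmoothFun.mdifferentiableAt {f : M → ℝ} (hf : IsSmoothFun n f) (x : M) :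
    MDifferentiableAt (𝓡 n) 𝓘(ℝ, ℝ) f x :=
  (hf x).mdifferentiableAt (by simp)

theorem IsSmoothVField.mdifferentiableAt {X : VField n M} (hX : IsSmoothVField X) (x : M) :
    MDifferentiableAt (𝓡 n) (𝓡 n).tangent (fun x => (⟨x, X x⟩ : TangentBundle (𝓡 n) M)) x :=
  (hX x).mdifferentiableAt (by simp)

theorem dfun_add {f g : M → ℝ} (hf : IsSmoothFun n f) (hg : IsSmoothFun n g) (x : M) :
    dfun n (fun y => f y + g y) x = dfun n f x + dfun n g x := by
  have h := ((hf.mdifferentiableAt x).hasMFDerivAt.add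
    (hg.mdifferentiableAt x).hasMFDerivAt).mfderiv
  ext v
  exact DFunLike.congr_fun h v

theorem dfun_neg {f : M → ℝ} (hf : IsSmoothFun n f) (x : M) :
    dfun n (fun y => - f y) x = - dfun n f x := by
  have h := ((hf.mdifferentiableAt x).hasMFDerivAt.neg).mfderiv
  ext v
  exact DFunLike.congr_fun h v

theorem dfun_sub {f g : M → ℝ} (hf : IsSmoothFun n f) (hg : IsSmoothFun n g) (x : M) :
    dfun n (fun y => f y - g y) x = dfun n f x - dfun n g x := by
  have h := ((hf.mdifferentiableAt x).hasMFDerivAt.sub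
    (hg.mdifferentiableAt x).hasMFDerivAt).mfderiv
  ext v
  exact DFunLike.congr_fun h v

theorem dfun_mul {f g : M → ℝ} (hf : IsSmoothFun n f) (hg : IsSmoothFun n g) (x : M) :
    dfun n (fun y => f y * g y) x = f x • dfun n g x + g x • dfun n f x := by
  have h := ((hf.mdifferentiableAt x).hasMFDerivAt.mul
    (hg.mdifferentiableAt x).hasMFDerivAt).mfderiv
  ext v
  exact DFunLike.congr_fun h v

theorem dfun_const (c : ℝ) (x : M) : dfun n (fun _ : M => c) x = 0 := by
  ext v
  simp only [dfun, mfderiv_const]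
  rfl

theorem IsSmoothFun.dfun_apply {f : M → ℝ} (hf : IsSmoothFun n f) {X : VField n M}
    (hX : IsSmoothVField X) : IsSmoothFun n (fun x => dfun n f x (X x)) := by
  have h1 : ContMDiff (𝓡 n).tangent 𝓘(ℝ, ℝ).tangent ∞ (tangentMap (𝓡 n) 𝓘(ℝ, ℝ) f) :=
    ContMDiff.contMDiff_tangentMap hf (by simp)
  exact (contMDiff_snd_tangentBundle_modelSpace ℝ 𝓘(ℝ, ℝ)).comp (h1.comp hX)

theorem lieBr_swap (X Y : VField n M) (x : M) : lieBr X Y x = - lieBr Y X x :=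
  VectorField.mlieBracket_swap_apply

theorem IsSmoothVField.lieBr {X Y : VField n M} (hX : IsSmoothVField X) (hY : IsSmoothVField Y) :
    IsSmoothVField (lieBr X Y) := by
  have : IsManifold (𝓡 n) ((⊤ : ℕ∞) + 1) M := by
    simpa using (inferInstance : IsManifold (𝓡 n) ∞ M)
  have : IsManifold (𝓡 n) (minSmoothness ℝ 2) M := by
    rw [minSmoothness_of_isRCLikeNormedField]
    infer_instance
  have : IsManifold (𝓡 n) (minSmoothness ℝ 3) M := by
    rw [minSmoothness_of_isRCLikeNormedField]
    infer_instance
  exact ContDiff.mlieBracket_vectorField (n := ⊤) (m := ⊤) hX hY (by simp)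

theorem lieBr_add_right {X Y Z : VField n M} (hY : IsSmoothVField Y) (hZ : IsSmoothVField Z)
    (x : M) : lieBr X (fun y => Y y + Z y) x = lieBr X Y x + lieBr X Z x :=
  VectorField.mlieBracket_add_right (hY.mdifferentiableAt x) (hZ.mdifferentiableAt x)

theorem lieBr_add_left {X Y Z : VField n M} (hX : IsSmoothVField X) (hY : IsSmoothVField Y)
    (x : M) : lieBr (fun y => X y + Y y) Z x = lieBr X Z x + lieBr Y Z x :=
  VectorField.mlieBracket_add_left (hX.mdifferentiableAt x) (hY.mdifferentiableAt x)

theorem lieBr_smul_right {f : M → ℝ} {X Y : VField n M} (hf : IsSmoothFun n f)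
    (hY : IsSmoothVField Y) (x : M) :
    lieBr X (fun y => f y • Y y) x = f x • lieBr X Y x + dfun n f x (X x) • Y x := by
  rw [add_comm]
  exact VectorField.mlieBracket_smul_right (hf.mdifferentiableAt x) (hY.mdifferentiableAt x)

theorem lieBr_smul_left {f : M → ℝ} {X Y : VField n M} (hf : IsSmoothFun n f)
    (hX : IsSmoothVField X) (x : M) :
    lieBr (fun y => f y • X y) Y x = f x • lieBr X Y x - dfun n f x (Y x) • X x := by
  rw [lieBr_swap, lieBr_smul_right hf hX, lieBr_swap X Y, smul_neg]
  abel

theorem lieBr_jacobi {X Y Z : VField n M} (hX : IsSmoothVField X) (hY : IsSmoothVField Y)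
    (hZ : IsSmoothVField Z) (x : M) :
    lieBr X (lieBr Y Z) x = lieBr (lieBr X Y) Z x + lieBr Y (lieBr X Z) x := by
  have h2 : minSmoothness ℝ 2 ≤ ∞ := by
    rw [minSmoothness_of_isRCLikeNormedField]
    exact ENat.LEInfty.out
  have : IsManifold (𝓡 n) (minSmoothness ℝ 3) M := by
    rw [minSmoothness_of_isRCLikeNormedField]
    infer_instance
  exact VectorField.leibniz_identity_mlieBracket_apply ((hX x).of_le h2) ((hY x).of_le h2)
    ((hZ x).of_le h2)

/-- The Lie bracket acts on functions as a commutator of derivations. The multiple of a field `Z`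
makes this a consequence of the Leibniz rule and the Jacobi identity applied to `f Z`. -/
theorem dfun_lieBr_smul {f : M → ℝ} {X Y Z : VField n M} (hf : IsSmoothFun n f)
    (hX : IsSmoothVField X) (hY : IsSmoothVField Y) (hZ : IsSmoothVField Z) (x : M) :
    dfun n f x (lieBr X Y x) • Z x =
      (dfun n (fun y => dfun n f y (Y y)) x (X x) - dfun n (fun y => dfun n f y (X y)) x (Y x))
        • Z x := by
  have key : ∀ {X Y : VField n M}, IsSmoothVField X → IsSmoothVField Y →
      lieBr X (lieBr Y (fun y => f y • Z y)) x = f x • lieBr X (lieBr Y Z) x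
        + dfun n f x (X x) • lieBr Y Z x + dfun n f x (Y x) • lieBr X Z x
        + dfun n (fun y => dfun n f y (Y y)) x (X x) • Z x := by
    intro X Y hX hY
    rw [funext (lieBr_smul_right (X := Y) hf hZ),
      lieBr_add_right ((hY.lieBr hZ).smul hf) (hZ.smul (hf.dfun_apply hY)),
      lieBr_smul_right hf (hY.lieBr hZ), lieBr_smul_right (hf.dfun_apply hY) hZ]
    abel
  have h := lieBr_jacobi hX hY (hZ.smul hf) x
  rw [key hX hY, key hY hX, lieBr_smul_right hf hZ, lieBr_jacobi hX hY hZ x] at h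
  rw [sub_smul, ← sub_eq_zero]
  rw [← sub_eq_zero] at h
  rw [← neg_eq_zero, ← h]
  module

end Calculus

section Connections

variable {n : ℕ} {M : Type*} [TopologicalSpace M]
  [ChartedSpace (EuclideanSpace ℝ (Fin n)) M] [IsManifold (𝓡 n) ∞ M]
  {D : VField n M → VField n M → VField n M}

/-- The curvature `R(X, Y)Z = D_X D_Y Z - D_Y D_X Z - D_[X,Y] Z`. -/
noncomputable def curvature (D : VField n M → VField n M → VField n M) (X Y Z : VField n M) :
    VField n M :=
  fun x => D X (D Y Z) x - D Y (D X Z) x - D (lieBr X Y) Z x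

theorem curvature_swap (hD : IsAffineConnection D) {X Y Z : VField n M} (hX : IsSmoothVField X)
    (hY : IsSmoothVField Y) (hZ : IsSmoothVField Z) (x : M) :
    curvature D X Y Z x = - curvature D Y X Z x := by
  have h : lieBr X Y = fun y => (-1 : ℝ) • lieBr Y X y := funext fun y => by
    rw [lieBr_swap X Y]; simp
  simp only [curvature, h]
  rw [hD.smul_left (fun _ => -1) _ _ (isSmoothFun_const _) (hY.lieBr hX) hZ]
  module

variable [T2Space M]

theorem isTensorialAt_curvature_left (hD : IsAffineConnection D) {Y Z : VField n M}
    (hY : IsSmoothVField Y) (hZ : IsSmoothVField Z) (x : M) :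
    IsTensorialAt x (fun X => curvature D X Y Z x) where
  add X X' hX hX' := by
    simp only [curvature]
    rw [hD.add_left _ _ _ hX hX' (hD.smooth _ _ hY hZ), funext (hD.add_left _ _ _ hX hX' hZ),
      hD.add_right _ _ _ hY (hD.smooth _ _ hX hZ) (hD.smooth _ _ hX' hZ),
      funext (lieBr_add_left (Z := Y) hX hX'), hD.add_left _ _ _ (hX.lieBr hY) (hX'.lieBr hY) hZ]
    abel
  smul f X hf hX := by
    simp only [curvature]
    have h : lieBr (fun y => f y • X y) Y =
        fun y => f y • lieBr X Y y + (- dfun n f y (Y y)) • X y := funext fun y => by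
      rw [lieBr_smul_left hf hX]; module
    rw [hD.smul_left _ _ _ hf hX (hD.smooth _ _ hY hZ), funext (hD.smul_left _ _ _ hf hX hZ),
      hD.leibniz _ _ _ hf hY (hD.smooth _ _ hX hZ), h,
      hD.add_left _ _ _ ((hX.lieBr hY).smul hf) (hX.smul (hf.dfun_apply hY).neg) hZ,
      hD.smul_left _ _ _ hf (hX.lieBr hY) hZ,
      hD.smul_left _ _ _ (hf.dfun_apply hY).neg hX hZ]
    module

theorem isTensorialAt_curvature_right (hD : IsAffineConnection D) {X Y : VField n M}
    (hX : IsSmoothVField X) (hY : IsSmoothVField Y) (x : M) :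
    IsTensorialAt x (fun Z => curvature D X Y Z x) where
  add Z Z' hZ hZ' := by
    simp only [curvature]
    rw [funext (hD.add_right _ _ _ hY hZ hZ'), funext (hD.add_right _ _ _ hX hZ hZ'),
      hD.add_right _ _ _ (hX.lieBr hY) hZ hZ',
      hD.add_right _ _ _ hX (hD.smooth _ _ hY hZ) (hD.smooth _ _ hY hZ'),
      hD.add_right _ _ _ hY (hD.smooth _ _ hX hZ) (hD.smooth _ _ hX hZ')]
    abel
  smul f Z hf hZ := by
    have key : ∀ {X Y : VField n M}, IsSmoothVField X → IsSmoothVField Y →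
        D X (D Y (fun y => f y • Z y)) x = f x • D X (D Y Z) x
          + dfun n f x (X x) • D Y Z x + dfun n f x (Y x) • D X Z x
          + dfun n (fun y => dfun n f y (Y y)) x (X x) • Z x := by
      intro X Y hX hY
      rw [funext (hD.leibniz _ _ _ hf hY hZ),
        hD.add_right _ _ _ hX ((hD.smooth _ _ hY hZ).smul hf) (hZ.smul (hf.dfun_apply hY)),
        hD.leibniz _ _ _ hf hX (hD.smooth _ _ hY hZ),
        hD.leibniz _ _ _ (hf.dfun_apply hY) hX hZ]
      abel
    simp only [curvature]
    rw [key hX hY, key hY hX, hD.leibniz _ _ _ hf (hX.lieBr hY) hZ, dfun_lieBr_smul hf hX hY hZ]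
    module

theorem exists_curvatureTensor (hD : IsAffineConnection D) :
    ∃ Rm : ∀ x : M, TangentSpace (𝓡 n) x →ₗ[ℝ] TangentSpace (𝓡 n) x →ₗ[ℝ]
      TangentSpace (𝓡 n) x →ₗ[ℝ] TangentSpace (𝓡 n) x,
    ∀ X Y Z : VField n M, IsSmoothVField X → IsSmoothVField Y → IsSmoothVField Z → ∀ x,
      Rm x (X x) (Y x) (Z x) = curvature D X Y Z x := by
  refine exists_trilinearField_of_tensorial (Φ := fun X Y Z => curvature D X Y Z)
    (fun x Y Z hY hZ => isTensorialAt_curvature_left hD hY hZ x) (fun x X Z hX hZ => ?_)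
    (fun x X Y hX hY => isTensorialAt_curvature_right hD hX hY x)
  have h := isTensorialAt_curvature_left hD hX hZ x
  constructor
  · intro Y Y' hY hY'
    rw [curvature_swap hD hX (hY.add hY') hZ, h.add _ _ hY hY', curvature_swap hD hX hY hZ,
      curvature_swap hD hX hY' hZ, neg_add]
  · intro f Y hf hY
    rw [curvature_swap hD hX (hY.smul hf) hZ, h.smul _ _ hf hY, curvature_swap hD hX hY hZ,
      smul_neg]

theorem exists_isRicciTensor (hD : IsAffineConnection D) :
    ∃ Rc : TwoTensor n M, IsRicciTensor D Rc := by
  obtain ⟨Rm, hRm⟩ := exists_curvatureTensor hD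
  refine ⟨fun x => LinearMap.mk₂ ℝ
    (fun v w => LinearMap.trace ℝ (TangentSpace (𝓡 n) x) (((Rm x).flip v).flip w))
    (fun _ _ _ => ?_) (fun _ _ _ => ?_) (fun _ _ _ => ?_) (fun _ _ _ => ?_), Rm, hRm,
    fun x v w => rfl⟩
  all_goals
    first
    | rw [← map_add]
    | rw [← map_smul]
    exact congrArg _ (LinearMap.ext fun u => by simp [LinearMap.flip_apply])

/-- The covariant derivative of a three-tensor is a tensor. -/
theorem exists_covariantDerivative (hD : IsAffineConnection D) (H : ThreeTensor n M)
    (hH : ∀ X Y Z : VField n M, IsSmoothVField X → IsSmoothVField Y → IsSmoothVField Z →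
      IsSmoothFun n (fun x => H x (X x) (Y x) (Z x))) :
    ∃ DH : ∀ x : M, TangentSpace (𝓡 n) x →ₗ[ℝ] TangentSpace (𝓡 n) x →ₗ[ℝ]
      TangentSpace (𝓡 n) x →ₗ[ℝ] TangentSpace (𝓡 n) x →ₗ[ℝ] ℝ,
    ∀ W X Y Z : VField n M, IsSmoothVField W → IsSmoothVField X → IsSmoothVField Y →
      IsSmoothVField Z → ∀ x,
      DH x (W x) (X x) (Y x) (Z x) = dfun n (fun y => H y (X y) (Y y) (Z y)) x (W x)
        - H x (D W X x) (Y x) (Z x) - H x (X x) (D W Y x) (Z x) - H x (X x) (Y x) (D W Z x) := by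
  refine exists_quadrilinearField_of_tensorial
    (Φ := fun W X Y Z x => dfun n (fun y => H y (X y) (Y y) (Z y)) x (W x)
        - H x (D W X x) (Y x) (Z x) - H x (X x) (D W Y x) (Z x) - H x (X x) (Y x) (D W Z x))
    (fun x X Y Z hX hY hZ => ⟨fun W W' hW hW' => ?_, fun f W hf hW => ?_⟩)
    (fun x W Y Z hW hY hZ => ⟨fun X X' hX hX' => ?_, fun f X hf hX => ?_⟩)
    (fun x W X Z hW hX hZ => ⟨fun Y Y' hY hY' => ?_, fun f Y hf hY => ?_⟩)
    (fun x W X Y hW hX hY => ⟨fun Z Z' hZ hZ' => ?_, fun f Z hf hZ => ?_⟩)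
  · simp only [hD.add_left _ _ _ hW hW' hX, hD.add_left _ _ _ hW hW' hY,
      hD.add_left _ _ _ hW hW' hZ, map_add, LinearMap.add_apply]
    ring
  · simp only [hD.smul_left _ _ _ hf hW hX, hD.smul_left _ _ _ hf hW hY,
      hD.smul_left _ _ _ hf hW hZ, map_smul, LinearMap.smul_apply, smul_eq_mul]
    ring
  · simp only [hD.add_right _ _ _ hW hX hX', map_add, LinearMap.add_apply,
      dfun_add (hH X Y Z hX hY hZ) (hH X' Y Z hX' hY hZ)]
    ring
  · simp only [hD.leibniz _ _ _ hf hW hX, map_add, map_smul, LinearMap.add_apply,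
      LinearMap.smul_apply, smul_eq_mul, dfun_mul hf (hH X Y Z hX hY hZ)]
    ring
  · simp only [hD.add_right _ _ _ hW hY hY', map_add, LinearMap.add_apply,
      dfun_add (hH X Y Z hX hY hZ) (hH X Y' Z hX hY' hZ)]
    ring
  · simp only [hD.leibniz _ _ _ hf hW hY, map_add, map_smul, LinearMap.add_apply,
      LinearMap.smul_apply, smul_eq_mul, dfun_mul hf (hH X Y Z hX hY hZ)]
    ring
  · simp only [hD.add_right _ _ _ hW hZ hZ', map_add, LinearMap.add_apply,
      dfun_add (hH X Y Z hX hY hZ) (hH X Y Z' hX hY hZ')]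
    ring
  · simp only [hD.leibniz _ _ _ hf hW hZ, map_add, map_smul, LinearMap.add_apply,
      LinearMap.smul_apply, smul_eq_mul, dfun_mul hf (hH X Y Z hX hY hZ)]
    ring

theorem exists_isCodifferential (hD : IsAffineConnection D) (g : TwoTensor n M)
    (H : ThreeTensor n M)
    (hH : ∀ X Y Z : VField n M, IsSmoothVField X → IsSmoothVField Y → IsSmoothVField Z →
      IsSmoothFun n (fun x => H x (X x) (Y x) (Z x))) :
    ∃ δ : TwoTensor n M, IsCodifferential g D H δ := by
  obtain ⟨DH, hDH⟩ := exists_covariantDerivative hD H hH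
  refine ⟨fun x => - ∑ i, ∑ j, gInv g x i j • DH x (tanBasis n x i) (tanBasis n x j), DH, hDH,
    fun x v w => ?_⟩
  simp [LinearMap.sum_apply]

/-- The Levi-Civita connection is unique: the difference of two such connections is symmetric in the
first two arguments and skew in the last two, so it vanishes. -/
theorem IsLeviCivita.unique {g : TwoTensor n M} (hg : IsRiemannianMetric g)
    {D' : VField n M → VField n M → VField n M} (hD : IsLeviCivita g D) (hD' : IsLeviCivita g D')
    {X Y : VField n M} (hX : IsSmoothVField X) (hY : IsSmoothVField Y) : D X Y = D' X Y := by
  funext x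
  have hsym : ∀ X Y, IsSmoothVField X → IsSmoothVField Y →
      D X Y x - D' X Y x = D Y X x - D' Y X x := by
    intro X Y hX hY
    have h1 := hD.torsion_free X Y hX hY x
    have h2 := hD'.torsion_free X Y hX hY x
    rw [← h2] at h1
    rw [sub_eq_sub_iff_add_eq_add] at h1 ⊢
    rw [h1]; abel
  have hskew : ∀ X Y Z, IsSmoothVField X → IsSmoothVField Y → IsSmoothVField Z →
      g x (D X Y x - D' X Y x) (Z x) = - g x (D X Z x - D' X Z x) (Y x) := by
    intro X Y Z hX hY hZ
    have h1 := hD.metric X Y Z hX hY hZ x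
    have h2 := hD'.metric X Y Z hX hY hZ x
    rw [hg.symm x (Y x)] at h1 h2
    simp only [map_sub, LinearMap.sub_apply]
    linarith
  have hall : ∀ Z, IsSmoothVField Z → g x (D X Y x - D' X Y x) (Z x) = 0 := by
    intro Z hZ
    have e1 := hskew X Y Z hX hY hZ
    rw [hsym X Z hX hZ, hskew Z X Y hZ hX hY, hsym Z Y hZ hY, hskew Y Z X hY hZ hX,
      hsym Y X hY hX] at e1
    linarith
  by_contra hne
  obtain ⟨Z, hZ, hZx⟩ := exists_smooth_vField x (D X Y x - D' X Y x)
  have := hall Z hZ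
  rw [hZx] at this
  exact (hg.pos x _ (sub_ne_zero.2 hne)).ne' this

end Connections

/-! ### The Courant bracket and the three-form of a splitting -/

namespace ExactCourantAlgebroid

variable {n : ℕ} {M : Type*} [TopologicalSpace M] [ChartedSpace (EuclideanSpace ℝ (Fin n)) M]
  [IsManifold (𝓡 n) ∞ M]
  {F : Type*} [NormedAddCommGroup F] [NormedSpace ℝ F]
  {E : M → Type*} [TopologicalSpace (Bundle.TotalSpace F E)]
  [∀ x, AddCommGroup (E x)] [∀ x, Module ℝ (E x)] [∀ x, TopologicalSpace (E x)]
  [FiberBundle F E] [VectorBundle ℝ F E]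
  (C : ExactCourantAlgebroid n M F E)

section Bracket

variable {a a' b b' c : ∀ x : M, E x}

theorem bracketFun_eq (ha : IsSmoothSection n F a) (hb : IsSmoothSection n F b) (x : M) :
    C.bracketFun a b x = C.bracket ⟨a, ha⟩ ⟨b, hb⟩ x := by
  simp [bracketFun, ha, hb]

theorem isSmoothSection_bracketFun (ha : IsSmoothSection n F a) (hb : IsSmoothSection n F b) :
    IsSmoothSection n F (C.bracketFun a b) := by
  rw [funext (C.bracketFun_eq ha hb)]
  exact (C.bracket ⟨a, ha⟩ ⟨b, hb⟩).contMDiff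

theorem isSmoothVField_anchor (ha : IsSmoothSection n F a) :
    IsSmoothVField (fun x => C.anchor x (a x)) := C.anchor_smooth ⟨a, ha⟩

theorem isSmoothFun_pairing (ha : IsSmoothSection n F a) (hb : IsSmoothSection n F b) :
    IsSmoothFun n (fun x => C.pairing x (a x) (b x)) := C.pairing_smooth ⟨a, ha⟩ ⟨b, hb⟩

theorem bracketFun_add_right (ha : IsSmoothSection n F a) (hb : IsSmoothSection n F b)
    (hb' : IsSmoothSection n F b') (x : M) :
    C.bracketFun a (fun y => b y + b' y) x = C.bracketFun a b x + C.bracketFun a b' x := by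
  rw [C.bracketFun_eq ha hb, C.bracketFun_eq ha hb', C.bracketFun_eq ha (hb.add hb')]
  exact congrArg (fun s : Cₛ^∞⟮𝓡 n; F, E⟯ => s x)
    (map_add (C.bracket ⟨a, ha⟩) ⟨b, hb⟩ ⟨b', hb'⟩)

theorem bracketFun_add_left (ha : IsSmoothSection n F a) (ha' : IsSmoothSection n F a')
    (hb : IsSmoothSection n F b) (x : M) :
    C.bracketFun (fun y => a y + a' y) b x = C.bracketFun a b x + C.bracketFun a' b x := by
  rw [C.bracketFun_eq ha hb, C.bracketFun_eq ha' hb, C.bracketFun_eq (ha.add ha') hb]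
  exact congrArg (fun s : Cₛ^∞⟮𝓡 n; F, E⟯ => s x)
    (LinearMap.map_add₂ C.bracket ⟨a, ha⟩ ⟨a', ha'⟩ ⟨b, hb⟩)

theorem bracketFun_smul_right {f : M → ℝ} (hf : IsSmoothFun n f) (ha : IsSmoothSection n F a)
    (hb : IsSmoothSection n F b) (x : M) :
    C.bracketFun a (fun y => f y • b y) x =
      f x • C.bracketFun a b x + dfun n f x (C.anchor x (a x)) • b x := by
  rw [C.bracketFun_eq ha hb, C.bracketFun_eq ha (IsSmoothSection.smul hf hb)]
  exact C.leibniz f ⟨a, ha⟩ ⟨b, hb⟩ ⟨_, IsSmoothSection.smul hf hb⟩ hf (fun _ => rfl) x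

theorem bracketFun_symm_part (ha : IsSmoothSection n F a) (hb : IsSmoothSection n F b) (x : M) :
    C.bracketFun a b x + C.bracketFun b a x =
      C.coanchor x (dfun n (fun y => C.pairing y (a y) (b y)) x) := by
  rw [C.bracketFun_eq ha hb, C.bracketFun_eq hb ha]
  exact C.bracket_symm_part ⟨a, ha⟩ ⟨b, hb⟩ x

theorem bracketFun_swap (ha : IsSmoothSection n F a) (hb : IsSmoothSection n F b) (x : M) :
    C.bracketFun a b x = - C.bracketFun b a x +
      C.coanchor x (dfun n (fun y => C.pairing y (a y) (b y)) x) := by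
  rw [← C.bracketFun_symm_part ha hb]; abel

theorem bracketFun_swap_of_orthogonal (ha : IsSmoothSection n F a) (hb : IsSmoothSection n F b)
    (h : ∀ x, C.pairing x (a x) (b x) = 0) (x : M) :
    C.bracketFun a b x = - C.bracketFun b a x := by
  rw [C.bracketFun_swap ha hb, funext h, dfun_const, map_zero, add_zero]

theorem bracketFun_smul_left {f : M → ℝ} (hf : IsSmoothFun n f) (ha : IsSmoothSection n F a)
    (hb : IsSmoothSection n F b) (x : M) :
    C.bracketFun (fun y => f y • a y) b x =
      f x • C.bracketFun a b x - dfun n f x (C.anchor x (b x)) • a x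
        + C.pairing x (a x) (b x) • C.coanchor x (dfun n f x) := by
  rw [C.bracketFun_swap (IsSmoothSection.smul hf ha) hb, C.bracketFun_smul_right hf hb ha,
    C.bracketFun_swap ha hb]
  simp only [map_smul, LinearMap.smul_apply, smul_eq_mul]
  rw [dfun_mul hf (C.isSmoothFun_pairing ha hb)]
  simp only [map_add, map_smul]
  module

theorem anchor_bracketFun (ha : IsSmoothSection n F a) (hb : IsSmoothSection n F b) (x : M) :
    C.anchor x (C.bracketFun a b x) =
      lieBr (fun y => C.anchor y (a y)) (fun y => C.anchor y (b y)) x := by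
  rw [C.bracketFun_eq ha hb]
  exact C.anchor_bracket ⟨a, ha⟩ ⟨b, hb⟩ x

theorem dfun_pairing (ha : IsSmoothSection n F a) (hb : IsSmoothSection n F b)
    (hc : IsSmoothSection n F c) (x : M) :
    dfun n (fun y => C.pairing y (b y) (c y)) x (C.anchor x (a x)) =
      C.pairing x (C.bracketFun a b x) (c x) + C.pairing x (b x) (C.bracketFun a c x) := by
  rw [C.bracketFun_eq ha hb, C.bracketFun_eq ha hc]
  exact C.pairing_invariant ⟨a, ha⟩ ⟨b, hb⟩ ⟨c, hc⟩ x

end Bracket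

section Fibre

variable {x : M}

theorem anchor_coanchor (ξ : Module.Dual ℝ (TangentSpace (𝓡 n) x)) :
    C.anchor x (C.coanchor x ξ) = 0 := by
  have : C.coanchor x ξ ∈ LinearMap.ker (C.anchor x) := by
    rw [C.ker_anchor]; exact ⟨ξ, rfl⟩
  exact this

theorem pairing_coanchor_right (ξ : Module.Dual ℝ (TangentSpace (𝓡 n) x)) (e : E x) :
    C.pairing x e (C.coanchor x ξ) = ξ (C.anchor x e) := by
  rw [C.pairing_symm, C.pairing_coanchor]

theorem coanchor_injective : Function.Injective (C.coanchor x) := by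
  rw [← LinearMap.ker_eq_bot, LinearMap.ker_eq_bot']
  intro ξ h
  ext v
  obtain ⟨e, rfl⟩ := C.anchor_surjective x v
  rw [← C.pairing_coanchor, h]
  simp

theorem exists_coanchor_eq {e : E x} (he : C.anchor x e = 0) : ∃ ξ, C.coanchor x ξ = e := by
  have : e ∈ LinearMap.ker (C.anchor x) := he
  rw [C.ker_anchor] at this
  exact this

/-- The kernel of the anchor is isotropic. -/
theorem pairing_vertical {e e' : E x} (he : C.anchor x e = 0) (he' : C.anchor x e' = 0) :
    C.pairing x e e' = 0 := by
  obtain ⟨ξ, rfl⟩ := C.exists_coanchor_eq he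
  rw [C.pairing_coanchor, he', map_zero]

end Fibre

section Vertical

variable {a b c : ∀ x : M, E x}

theorem anchor_bracketFun_vertical_left (ha : IsSmoothSection n F a) (hb : IsSmoothSection n F b)
    (h : ∀ x, C.anchor x (a x) = 0) (x : M) : C.anchor x (C.bracketFun a b x) = 0 := by
  rw [C.anchor_bracketFun ha hb, funext h]
  exact congrFun VectorField.mlieBracket_zero_left x

theorem anchor_bracketFun_vertical_right (ha : IsSmoothSection n F a) (hb : IsSmoothSection n F b)
    (h : ∀ x, C.anchor x (b x) = 0) (x : M) : C.anchor x (C.bracketFun a b x) = 0 := by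
  rw [C.anchor_bracketFun ha hb, funext h]
  exact congrFun VectorField.mlieBracket_zero_right x

theorem pairing_bracketFun_vertical (ha : IsSmoothSection n F a) (hb : IsSmoothSection n F b)
    (hc : IsSmoothSection n F c) (h : ∀ x, C.anchor x (a x) = 0) (h' : ∀ x, C.anchor x (b x) = 0)
    (x : M) : C.pairing x (C.bracketFun a b x) (c x) = 0 := by
  have h1 := C.dfun_pairing ha hb hc x
  rw [h, map_zero, C.pairing_vertical (h' x) (C.anchor_bracketFun_vertical_left ha hc h x)] at h1
  linarith

end Vertical

section Splitting

variable {C}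
variable {s : ∀ x : M, TangentSpace (𝓡 n) x →ₗ[ℝ] E x}

/-- The function `⟨[sX, sY], sZ⟩`, which defines the three-form of the splitting `s`. -/
noncomputable def torsionFun (C : ExactCourantAlgebroid n M F E)
    (s : ∀ x : M, TangentSpace (𝓡 n) x →ₗ[ℝ] E x) (X Y Z : VField n M) (x : M) : ℝ :=
  C.pairing x (C.bracketFun (fun y => s y (X y)) (fun y => s y (Y y)) x) (s x (Z x))

variable {X Y Z : VField n M}

theorem torsionFun_swap_left (hs : C.IsIsotropicSplitting s) (hX : IsSmoothVField X)
    (hY : IsSmoothVField Y) (Z : VField n M) (x : M) :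
    C.torsionFun s X Y Z x = - C.torsionFun s Y X Z x := by
  rw [torsionFun, C.bracketFun_swap_of_orthogonal (hs.smooth X hX) (hs.smooth Y hY)
    (fun x => hs.isotropic x _ _)]
  simp [torsionFun]

theorem torsionFun_swap_right (hs : C.IsIsotropicSplitting s) (hX : IsSmoothVField X)
    (hY : IsSmoothVField Y) (hZ : IsSmoothVField Z) (x : M) :
    C.torsionFun s X Y Z x = - C.torsionFun s X Z Y x := by
  have h := C.dfun_pairing (hs.smooth X hX) (hs.smooth Y hY) (hs.smooth Z hZ) x
  rw [funext fun y => hs.isotropic y (Y y) (Z y), dfun_const, LinearMap.zero_apply,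
    C.pairing_symm x (s x (Y x))] at h
  simp only [torsionFun]
  linarith

theorem isSmoothFun_torsionFun (hs : C.IsIsotropicSplitting s) (hX : IsSmoothVField X)
    (hY : IsSmoothVField Y) (hZ : IsSmoothVField Z) : IsSmoothFun n (C.torsionFun s X Y Z) :=
  C.isSmoothFun_pairing (C.isSmoothSection_bracketFun (hs.smooth X hX) (hs.smooth Y hY))
    (hs.smooth Z hZ)

variable [T2Space M]

/-- Tensoriality in `Z` is clear, and the function is skew in all arguments because the splitting is
isotropic. -/
theorem exists_isTorsionForm (hs : C.IsIsotropicSplitting s) :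
    ∃ H : ThreeTensor n M, C.IsTorsionForm s H := by
  have h3 : ∀ x X Y, IsTensorialAt x (fun Z => C.torsionFun s X Y Z x) := fun x X Y =>
    ⟨fun Z Z' _ _ => by simp [torsionFun], fun f Z _ _ => by simp [torsionFun]⟩
  have h2 : ∀ x X Z, IsSmoothVField X → IsSmoothVField Z →
      IsTensorialAt x (fun Y => C.torsionFun s X Y Z x) := fun x X Z hX hZ =>
    ⟨fun Y Y' hY hY' => by
      rw [torsionFun_swap_right hs hX (hY.add hY') hZ, (h3 x X Z).add Y Y' hY hY',
        torsionFun_swap_right hs hX hY hZ, torsionFun_swap_right hs hX hY' hZ, neg_add],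
    fun f Y hf hY => by
      rw [torsionFun_swap_right hs hX (hY.smul hf) hZ, (h3 x X Z).smul f Y hf hY,
        torsionFun_swap_right hs hX hY hZ, smul_neg]⟩
  exact exists_trilinearField_of_tensorial (Φ := fun X Y Z x => C.torsionFun s X Y Z x)
    (fun x Y Z hY hZ => ⟨fun X X' hX hX' => by
      rw [torsionFun_swap_left hs (hX.add hX') hY, (h2 x Y Z hY hZ).add X X' hX hX',
        torsionFun_swap_left hs hX hY, torsionFun_swap_left hs hX' hY, neg_add],
    fun f X hf hX => by
      rw [torsionFun_swap_left hs (hX.smul hf) hY, (h2 x Y Z hY hZ).smul f X hf hX,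
        torsionFun_swap_left hs hX hY, smul_neg]⟩)
    h2 (fun x X Y _ _ => h3 x X Y)

theorem threeTensor_ext {H H' : ThreeTensor n M}
    (h : ∀ X Y Z : VField n M, IsSmoothVField X → IsSmoothVField Y → IsSmoothVField Z → ∀ x,
      H x (X x) (Y x) (Z x) = H' x (X x) (Y x) (Z x)) : H = H' := by
  funext x
  ext u v w
  obtain ⟨X, hX, rfl⟩ := exists_smooth_vField x u
  obtain ⟨Y, hY, rfl⟩ := exists_smooth_vField x v
  obtain ⟨Z, hZ, rfl⟩ := exists_smooth_vField x w
  exact h X Y Z hX hY hZ x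

theorem IsTorsionForm.unique {H H' : ThreeTensor n M} (hH : C.IsTorsionForm s H)
    (hH' : C.IsTorsionForm s H') : H = H' :=
  threeTensor_ext fun X Y Z hX hY hZ x => by rw [hH X Y Z hX hY hZ, hH' X Y Z hX hY hZ]

theorem IsTorsionForm.swap_left {H : ThreeTensor n M} (hH : C.IsTorsionForm s H)
    (hs : C.IsIsotropicSplitting s) (x : M) (u v w : TangentSpace (𝓡 n) x) :
    H x u v w = - H x v u w := by
  obtain ⟨X, hX, rfl⟩ := exists_smooth_vField x u
  obtain ⟨Y, hY, rfl⟩ := exists_smooth_vField x v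
  obtain ⟨Z, hZ, rfl⟩ := exists_smooth_vField x w
  rw [hH X Y Z hX hY hZ, hH Y X Z hY hX hZ]
  exact torsionFun_swap_left hs hX hY Z x

theorem IsTorsionForm.swap_right {H : ThreeTensor n M} (hH : C.IsTorsionForm s H)
    (hs : C.IsIsotropicSplitting s) (x : M) (u v w : TangentSpace (𝓡 n) x) :
    H x u v w = - H x u w v := by
  obtain ⟨X, hX, rfl⟩ := exists_smooth_vField x u
  obtain ⟨Y, hY, rfl⟩ := exists_smooth_vField x v
  obtain ⟨Z, hZ, rfl⟩ := exists_smooth_vField x w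
  rw [hH X Y Z hX hY hZ, hH X Z Y hX hZ hY]
  exact torsionFun_swap_right hs hX hY hZ x

theorem IsTorsionForm.smooth {H : ThreeTensor n M} (hH : C.IsTorsionForm s H)
    (hs : C.IsIsotropicSplitting s) (hX : IsSmoothVField X) (hY : IsSmoothVField Y)
    (hZ : IsSmoothVField Z) : IsSmoothFun n (fun x => H x (X x) (Y x) (Z x)) := by
  rw [funext (hH X Y Z hX hY hZ)]
  exact isSmoothFun_torsionFun hs hX hY hZ

end Splitting

section ChangeOfSplitting

variable {C}
variable {s₀ s : ∀ x : M, TangentSpace (𝓡 n) x →ₗ[ℝ] E x} {b : TwoTensor n M}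
  {X Y Z : VField n M}

/-- Changing the splitting by a two-form `b` changes its three-form by `db`. -/
theorem torsionFun_expB (hs₀ : C.IsIsotropicSplitting s₀) (hs : C.IsIsotropicSplitting s)
    (hb : IsTwoForm b) (h : ∀ x v, s x v = s₀ x v + C.coanchor x (b x v))
    (hX : IsSmoothVField X) (hY : IsSmoothVField Y) (hZ : IsSmoothVField Z) (x : M) :
    C.torsionFun s X Y Z x = C.torsionFun s₀ X Y Z x +
      (dfun n (fun y => b y (Y y) (Z y)) x (X x)
      - dfun n (fun y => b y (X y) (Z y)) x (Y x)
      + dfun n (fun y => b y (X y) (Y y)) x (Z x)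
      - b x (lieBr X Y x) (Z x) + b x (lieBr X Z x) (Y x) - b x (lieBr Y Z x) (X x)) := by
  -- `s X = s₀ X + β X`; of the eight terms of the expansion, those with at least two `β` vanish
  set β : VField n M → ∀ x : M, E x := fun X x => C.coanchor x (b x (X x)) with hβ
  have hβs : ∀ {X}, IsSmoothVField X → IsSmoothSection n F (β X) := by
    intro X hX
    have h1 : β X = fun x => s x (X x) - s₀ x (X x) := funext fun x => by simp [h, hβ]
    rw [h1]
    exact (hs.smooth X hX).sub (hs₀.smooth X hX)
  have hβv : ∀ X x, C.anchor x (β X x) = 0 := fun X x => C.anchor_coanchor _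
  have hexp : ∀ X, (fun y => s y (X y)) = fun y => s₀ y (X y) + β X y :=
    fun X => funext fun y => h y _
  have e0 : ∀ {X Y Z}, IsSmoothVField X → IsSmoothVField Y → IsSmoothVField Z → ∀ x,
      C.pairing x (C.bracketFun (fun y => s₀ y (X y)) (β Y) x) (s₀ x (Z x)) =
        dfun n (fun y => b y (Y y) (Z y)) x (X x) - b x (Y x) (lieBr X Z x) := by
    intro X Y Z hX hY hZ x
    have h1 := C.dfun_pairing (hs₀.smooth X hX) (hβs hY) (hs₀.smooth Z hZ) x
    simp only [hβ, C.pairing_coanchor, hs₀.splits] at h1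
    rw [h1, C.anchor_bracketFun (hs₀.smooth X hX) (hs₀.smooth Z hZ)]
    simp only [hs₀.splits, add_sub_cancel_right]
    rfl
  have e1 : C.pairing x (C.bracketFun (fun y => s₀ y (X y)) (fun y => s₀ y (Y y)) x) (β Z x)
      = b x (Z x) (lieBr X Y x) := by
    simp only [hβ]
    rw [C.pairing_coanchor_right, C.anchor_bracketFun (hs₀.smooth X hX) (hs₀.smooth Y hY)]
    simp only [hs₀.splits]
  have e2 : C.pairing x (C.bracketFun (β X) (fun y => s₀ y (Y y)) x) (s₀ x (Z x)) =
      - (dfun n (fun y => b y (X y) (Z y)) x (Y x) - b x (X x) (lieBr Y Z x))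
        + dfun n (fun y => b y (X y) (Y y)) x (Z x) := by
    rw [C.bracketFun_swap (hβs hX) (hs₀.smooth Y hY), map_add, LinearMap.add_apply, map_neg,
      LinearMap.neg_apply, e0 hY hX hZ, C.pairing_coanchor, hs₀.splits]
    simp only [hβ, C.pairing_coanchor, hs₀.splits]
  have z1 := C.pairing_bracketFun_vertical (hβs hX) (hβs hY) (hs₀.smooth Z hZ) (hβv X) (hβv Y) x
  have z2 := C.pairing_bracketFun_vertical (hβs hX) (hβs hY) (hβs hZ) (hβv X) (hβv Y) x
  have z3 := C.pairing_vertical (C.anchor_bracketFun_vertical_left (hβs hX) (hs₀.smooth Y hY)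
    (hβv X) x) (hβv Z x)
  have z4 := C.pairing_vertical (C.anchor_bracketFun_vertical_right (hs₀.smooth X hX) (hβs hY)
    (hβv Y) x) (hβv Z x)
  have e00 := e0 hX hY hZ x
  simp only [torsionFun]
  rw [hexp X, hexp Y, show s x (Z x) = s₀ x (Z x) + β Z x from h x _,
    C.bracketFun_add_left (hs₀.smooth X hX) (hβs hX) ((hs₀.smooth Y hY).add (hβs hY)),
    C.bracketFun_add_right (hs₀.smooth X hX) (hs₀.smooth Y hY) (hβs hY),
    C.bracketFun_add_right (hβs hX) (hs₀.smooth Y hY) (hβs hY)]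
  simp only [map_add, LinearMap.add_apply]
  rw [e00, e1, e2, z1, z2, z3, z4, hb.skew x (Z x), hb.skew x (Y x), hb.skew x (X x)]
  ring

end ChangeOfSplitting

end ExactCourantAlgebroid

/-! ### The metric and torsion potential induced by a generalized metric -/

namespace ExactCourantAlgebroid

variable {n : ℕ} {M : Type*} [TopologicalSpace M] [ChartedSpace (EuclideanSpace ℝ (Fin n)) M]
  [IsManifold (𝓡 n) ∞ M]
  {F : Type*} [NormedAddCommGroup F] [NormedSpace ℝ F]
  {E : M → Type*} [TopologicalSpace (Bundle.TotalSpace F E)]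
  [∀ x, AddCommGroup (E x)] [∀ x, Module ℝ (E x)] [∀ x, TopologicalSpace (E x)]
  [FiberBundle F E] [VectorBundle ℝ F E]
  {C : ExactCourantAlgebroid n M F E} {G : ∀ x : M, E x →ₗ[ℝ] E x} {g b : TwoTensor n M}
  {s₀ : ∀ x : M, TangentSpace (𝓡 n) x →ₗ[ℝ] E x}

section InducedMetric

theorem IsGeneralizedMetric.pairing_map_map (hG : C.IsGeneralizedMetric G) (x : M) (e e' : E x) :
    C.pairing x (G x e) (G x e') = C.pairing x e e' := by
  rw [hG.selfAdjoint, hG.involutive]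

/-- `π G π^*` is bijective, because `ξ(π G π^* ξ) = ⟨G π^* ξ, π^* ξ⟩ > 0` for `ξ ≠ 0`. -/
theorem IsGeneralizedMetric.bijective_anchor_coanchor (hG : C.IsGeneralizedMetric G) (x : M) :
    Function.Bijective (C.anchor x ∘ₗ G x ∘ₗ C.coanchor x) := by
  have : FiniteDimensional ℝ (TangentSpace (𝓡 n) x) :=
    inferInstanceAs (FiniteDimensional ℝ (EuclideanSpace ℝ (Fin n)))
  have hinj : Function.Injective (C.anchor x ∘ₗ G x ∘ₗ C.coanchor x) := by
    rw [← LinearMap.ker_eq_bot, LinearMap.ker_eq_bot']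
    intro ξ hξ
    by_contra hne
    have h := hG.pos x (C.coanchor x ξ) fun h => hne (C.coanchor_injective (by simpa using h))
    rw [C.pairing_coanchor_right] at h
    simp only [LinearMap.comp_apply] at hξ
    rw [hξ, map_zero] at h
    exact lt_irrefl _ h
  exact ⟨hinj, (LinearMap.injective_iff_surjective_of_finrank_eq_finrank
    (Subspace.dual_finrank_eq (K := ℝ))).1 hinj⟩

/-- The fibrewise inverse of `π G π^*`. -/
noncomputable def inverseMetric (hG : C.IsGeneralizedMetric G) : TwoTensor n M := fun x =>
  (LinearEquiv.ofBijective _ (hG.bijective_anchor_coanchor x)).symm.toLinearMap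

theorem inverseMetric_eq_iff (hG : C.IsGeneralizedMetric G) (x : M) (v : TangentSpace (𝓡 n) x)
    (ξ : Module.Dual ℝ (TangentSpace (𝓡 n) x)) :
    inverseMetric hG x v = ξ ↔ C.anchor x (G x (C.coanchor x ξ)) = v := by
  have := (LinearEquiv.ofBijective _ (hG.bijective_anchor_coanchor x)).symm_apply_eq
    (x := v) (y := ξ)
  exact this.trans eq_comm

/-- `g : T → T^*` is inverse to `π G π^*`: the algebraic part of `IsInducedMetric`, without the
claim that `g` is a smooth Riemannian metric. -/
def IsInverseMetric (C : ExactCourantAlgebroid n M F E) (G : ∀ x : M, E x →ₗ[ℝ] E x)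
    (g : TwoTensor n M) : Prop :=
  ∀ x v ξ, g x v = ξ ↔ C.anchor x (G x (C.coanchor x ξ)) = v

namespace IsInverseMetric

theorem anchor_metricSplitting (hg : C.IsInverseMetric G g) (x : M) (v : TangentSpace (𝓡 n) x) :
    C.anchor x (metricSplitting C G g x v) = v := (hg x v _).1 rfl

theorem map_metricSplitting (hG : C.IsGeneralizedMetric G) (x : M) (v : TangentSpace (𝓡 n) x) :
    G x (metricSplitting C G g x v) = C.coanchor x (g x v) := hG.involutive x _

theorem pairing_metricSplitting_coanchor (hg : C.IsInverseMetric G g) (x : M)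
    (v : TangentSpace (𝓡 n) x) (ξ : Module.Dual ℝ (TangentSpace (𝓡 n) x)) :
    C.pairing x (metricSplitting C G g x v) (C.coanchor x ξ) = ξ v := by
  rw [C.pairing_coanchor_right, hg.anchor_metricSplitting]

theorem pairing_metricSplitting (hG : C.IsGeneralizedMetric G) (x : M)
    (v w : TangentSpace (𝓡 n) x) :
    C.pairing x (metricSplitting C G g x v) (metricSplitting C G g x w) = 0 := by
  simp only [metricSplitting, LinearMap.comp_apply]
  rw [hG.pairing_map_map, C.pairing_coanchor, C.anchor_coanchor, map_zero]

theorem apply_eq_pairing (hg : C.IsInverseMetric G g) (x : M) (v w : TangentSpace (𝓡 n) x) :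
    g x v w = C.pairing x (C.coanchor x (g x v)) (metricSplitting C G g x w) := by
  rw [C.pairing_coanchor, hg.anchor_metricSplitting]

theorem symm (hg : C.IsInverseMetric G g) (hG : C.IsGeneralizedMetric G) (x : M)
    (v w : TangentSpace (𝓡 n) x) : g x v w = g x w v := by
  rw [hg.apply_eq_pairing, hg.apply_eq_pairing x w v, C.pairing_symm x (C.coanchor x (g x w))]
  simp only [metricSplitting, LinearMap.comp_apply]
  rw [hG.selfAdjoint]

theorem pos (hg : C.IsInverseMetric G g) (hG : C.IsGeneralizedMetric G) (x : M)
    (v : TangentSpace (𝓡 n) x) (hv : v ≠ 0) : 0 < g x v v := by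
  rw [hg.apply_eq_pairing, C.pairing_symm]
  refine hG.pos x _ fun h => hv ?_
  have h' : C.coanchor x (g x v) = 0 := h
  rw [← hg.anchor_metricSplitting x v]
  simp [metricSplitting, h']

variable [T2Space M] [FiniteDimensional ℝ F] [ContMDiffVectorBundle ∞ F E (𝓡 n)]

/-- `s_G X` is characterized by `A (s_G X) = s₀ X`, where `A = G s₀ π G + s₀ π` is a smooth
endomorphism. It is injective, because `s₀ T` is isotropic and hence meets `G s₀ T` trivially, so
that `s_G X` is smooth by nondegeneracy of `⟨A ·, ·⟩`. -/
theorem isSmoothSection_metricSplitting (hg : C.IsInverseMetric G g)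
    (hG : C.IsGeneralizedMetric G) (hs₀ : C.IsIsotropicSplitting s₀) {X : VField n M}
    (hX : IsSmoothVField X) : IsSmoothSection n F (fun x => metricSplitting C G g x (X x)) := by
  let A : ∀ x : M, E x →ₗ[ℝ] E x := fun x =>
    G x ∘ₗ s₀ x ∘ₗ C.anchor x ∘ₗ G x + s₀ x ∘ₗ C.anchor x
  have hAs : ∀ a : ∀ x : M, E x, IsSmoothSection n F a → IsSmoothSection n F (fun x => A x (a x)) :=
    fun a ha => (hG.smooth _ (hs₀.smooth _ (C.isSmoothVField_anchor (hG.smooth _ ha)))).add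
      (hs₀.smooth _ (C.isSmoothVField_anchor ha))
  have hAinj : ∀ x e, A x e = 0 → e = 0 := by
    intro x e he
    have he' : G x (s₀ x (C.anchor x (G x e))) + s₀ x (C.anchor x e) = 0 := he
    have h1 : C.anchor x (G x e) = 0 := by
      by_contra hne
      have hpos := hG.pos x (s₀ x (C.anchor x (G x e))) fun h => hne (by
        rw [← hs₀.splits x (C.anchor x (G x e)), h, map_zero])
      rw [eq_neg_of_add_eq_zero_left he', map_neg, LinearMap.neg_apply, hs₀.isotropic,
        neg_zero] at hpos
      exact lt_irrefl _ hpos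
    have h2 : C.anchor x e = 0 := by
      rw [h1, map_zero, map_zero, zero_add] at he'
      rw [← hs₀.splits x (C.anchor x e), he', map_zero]
    by_contra hne
    have hpos := hG.pos x e hne
    rw [C.pairing_vertical h1 h2] at hpos
    exact lt_irrefl _ hpos
  have hAX : ∀ x, A x (metricSplitting C G g x (X x)) = s₀ x (X x) := by
    intro x
    simp only [A, LinearMap.add_apply, LinearMap.comp_apply]
    rw [map_metricSplitting hG, C.anchor_coanchor, hg.anchor_metricSplitting, map_zero, map_zero,
      zero_add]
  refine isSmoothSection_of_pairing (fun x => (C.pairing x) ∘ₗ A x)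
    (fun a b ha hb => C.isSmoothFun_pairing (hAs a ha) hb) (fun x e h => ?_) _ (fun a ha => ?_)
  · exact hAinj x e (C.pairing_nondegenerate x _ h)
  · simp only [LinearMap.comp_apply, hAX]
    exact C.isSmoothFun_pairing (hs₀.smooth X hX) ha

theorem isIsotropicSplitting (hg : C.IsInverseMetric G g) (hG : C.IsGeneralizedMetric G)
    (hs₀ : C.IsIsotropicSplitting s₀) : C.IsIsotropicSplitting (metricSplitting C G g) where
  smooth _ hX := hg.isSmoothSection_metricSplitting hG hs₀ hX
  splits := hg.anchor_metricSplitting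
  isotropic := pairing_metricSplitting hG

theorem isInducedMetric (hg : C.IsInverseMetric G g) (hG : C.IsGeneralizedMetric G)
    (hs₀ : C.IsIsotropicSplitting s₀) : C.IsInducedMetric G g where
  riemannian :=
    { symm := hg.symm hG
      pos := hg.pos hG
      smooth := fun X Y hX hY => by
        have h := hg.isIsotropicSplitting hG hs₀
        refine (C.isSmoothFun_pairing (hG.smooth _ (h.smooth X hX)) (h.smooth Y hY)).congr
          fun x => ?_
        rw [map_metricSplitting hG, ← hg.apply_eq_pairing] }
  inverse := hg

end IsInverseMetric

theorem IsInducedMetric.isInverseMetric (hg : C.IsInducedMetric G g) : C.IsInverseMetric G g :=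
  hg.inverse

theorem IsInverseMetric.unique {g' : TwoTensor n M} (hg : C.IsInverseMetric G g)
    (hg' : C.IsInverseMetric G g') : g = g' := by
  funext x
  refine LinearMap.ext fun v => ?_
  exact (hg x v _).2 ((hg' x v _).1 rfl)

theorem IsInducedPair.metricSplitting_apply (h : C.IsInducedPair s₀ G g b)
    (hs₀ : C.IsIsotropicSplitting s₀) (x : M) (v : TangentSpace (𝓡 n) x) :
    metricSplitting C G g x v = s₀ x v + C.coanchor x (b x v) := by
  rw [h.splitting]
  simp [expB, bElement, hs₀.splits]

theorem IsInducedPair.unique {g' b' : TwoTensor n M} (h : C.IsInducedPair s₀ G g b)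
    (h' : C.IsInducedPair s₀ G g' b') (hs₀ : C.IsIsotropicSplitting s₀) : g = g' ∧ b = b' := by
  obtain rfl := h.metric.isInverseMetric.unique h'.metric.isInverseMetric
  refine ⟨rfl, ?_⟩
  funext x
  refine LinearMap.ext fun v => ?_
  refine C.coanchor_injective (add_left_cancel (a := s₀ x v) ?_)
  rw [← h.metricSplitting_apply hs₀, ← h'.metricSplitting_apply hs₀]

variable [T2Space M] [FiniteDimensional ℝ F] [ContMDiffVectorBundle ∞ F E (𝓡 n)]

/-- The torsion potential is `b(v, w) = ⟨s_G v, s₀ w⟩`. -/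
theorem exists_isInducedPair (hG : C.IsGeneralizedMetric G) (hs₀ : C.IsIsotropicSplitting s₀) :
    ∃ g b : TwoTensor n M, C.IsInducedPair s₀ G g b := by
  have hg : C.IsInverseMetric G (inverseMetric hG) := inverseMetric_eq_iff hG
  have hs := hg.isIsotropicSplitting hG hs₀
  set s := metricSplitting C G (inverseMetric hG) with hsdef
  refine ⟨inverseMetric hG, fun x => (C.pairing x).compl₁₂ (s x) (s₀ x),
    hg.isInducedMetric hG hs₀, ⟨fun x v w => ?_, fun X Y hX hY => ?_⟩, fun x => ?_⟩
  · have h := C.pairing_vertical (x := x) (e := s x v - s₀ x v) (e' := s x w - s₀ x w)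
      (by simp [hs.splits, hs₀.splits]) (by simp [hs.splits, hs₀.splits])
    simp only [map_sub, LinearMap.sub_apply, hs.isotropic, hs₀.isotropic,
      C.pairing_symm x (s₀ x v)] at h
    simp only [LinearMap.compl₁₂_apply]
    linarith
  · exact C.isSmoothFun_pairing (hs.smooth X hX) (hs₀.smooth Y hY)
  · ext v
    obtain ⟨ζ, hζ⟩ := C.exists_coanchor_eq (x := x) (e := s x v - s₀ x v)
      (by simp [hs.splits, hs₀.splits])
    have h : (C.pairing x).compl₁₂ (s x) (s₀ x) v = ζ := by
      ext w
      have h1 := C.pairing_coanchor x ζ (s₀ x w)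
      rw [hζ, hs₀.splits, map_sub, LinearMap.sub_apply, hs₀.isotropic, sub_zero] at h1
      exact h1
    simp only [expB, bElement, LinearMap.comp_apply, LinearMap.add_apply, LinearMap.id_apply,
      hs₀.splits, h, hζ]
    abel

end InducedMetric

end ExactCourantAlgebroid

/-! ### Lifts to the eigenbundles and the Bismut connections -/

namespace ExactCourantAlgebroid

variable {n : ℕ} {M : Type*} [TopologicalSpace M] [ChartedSpace (EuclideanSpace ℝ (Fin n)) M]
  [IsManifold (𝓡 n) ∞ M]
  {F : Type*} [NormedAddCommGroup F] [NormedSpace ℝ F]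
  {E : M → Type*} [TopologicalSpace (Bundle.TotalSpace F E)]
  [∀ x, AddCommGroup (E x)] [∀ x, Module ℝ (E x)] [∀ x, TopologicalSpace (E x)]
  [FiberBundle F E] [VectorBundle ℝ F E]
  {C : ExactCourantAlgebroid n M F E} {G : ∀ x : M, E x →ₗ[ℝ] E x} {g : TwoTensor n M}
  {ε : ℝ} {X Y Z : VField n M}

section Lift

/-- The lift `v ↦ (G + ε) π^* g v = s_G v + ε π^* g v` at a point. -/
noncomputable def pointLift (C : ExactCourantAlgebroid n M F E) (G : ∀ x : M, E x →ₗ[ℝ] E x)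
    (g : TwoTensor n M) (ε : ℝ) (x : M) : TangentSpace (𝓡 n) x →ₗ[ℝ] E x :=
  metricSplitting C G g x + ε • (C.coanchor x ∘ₗ g x)

variable {x : M} {v w : TangentSpace (𝓡 n) x}

theorem pointLift_apply (C : ExactCourantAlgebroid n M F E) (G : ∀ x : M, E x →ₗ[ℝ] E x)
    (g : TwoTensor n M) (ε : ℝ) (x : M) (v : TangentSpace (𝓡 n) x) :
    C.pointLift G g ε x v = metricSplitting C G g x v + ε • C.coanchor x (g x v) := rfl

theorem lift_eq_pointLift (C : ExactCourantAlgebroid n M F E) (G : ∀ x : M, E x →ₗ[ℝ] E x)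
    (g : TwoTensor n M) (ε : ℝ) (X : VField n M) (x : M) :
    C.lift G g ε X x = C.pointLift G g ε x (X x) := rfl

theorem lift_add (X Y : VField n M) :
    C.lift G g ε (fun x => X x + Y x) = fun x => C.lift G g ε X x + C.lift G g ε Y x :=
  funext fun x => map_add (C.pointLift G g ε x) _ _

theorem lift_smul (f : M → ℝ) (X : VField n M) :
    C.lift G g ε (fun x => f x • X x) = fun x => f x • C.lift G g ε X x :=
  funext fun x => map_smul (C.pointLift G g ε x) _ _

theorem anchor_pointLift (hg : C.IsInverseMetric G g) :
    C.anchor x (C.pointLift G g ε x v) = v := by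
  rw [pointLift_apply, map_add, map_smul, C.anchor_coanchor, hg.anchor_metricSplitting, smul_zero,
    add_zero]

theorem anchor_lift (hg : C.IsInverseMetric G g) (x : M) : C.anchor x (C.lift G g ε X x) = X x :=
  anchor_pointLift hg

theorem map_pointLift (hG : C.IsGeneralizedMetric G) (hε : ε * ε = 1) :
    G x (C.pointLift G g ε x v) = ε • C.pointLift G g ε x v := by
  rw [pointLift_apply, map_add, map_smul, IsInverseMetric.map_metricSplitting hG, smul_add,
    smul_smul, hε, one_smul, add_comm]
  rfl

theorem pairing_pointLift (hg : C.IsInverseMetric G g) (hG : C.IsGeneralizedMetric G) (ε' : ℝ) :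
    C.pairing x (C.pointLift G g ε x v) (C.pointLift G g ε' x w) = (ε + ε') * g x v w := by
  simp only [pointLift_apply, map_add, map_smul, LinearMap.add_apply, LinearMap.smul_apply,
    smul_eq_mul, IsInverseMetric.pairing_metricSplitting hG, hg.pairing_metricSplitting_coanchor,
    C.pairing_coanchor, hg.anchor_metricSplitting, C.anchor_coanchor, map_zero]
  rw [hg.symm hG x w]
  ring

theorem proj_apply (G : ∀ x : M, E x →ₗ[ℝ] E x) (ε : ℝ) (x : M) (e : E x) :
    proj G ε x e = (1 / 2 : ℝ) • (e + ε • G x e) := by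
  simp [proj]

theorem proj_pointLift (hG : C.IsGeneralizedMetric G) (hε : ε * ε = 1) :
    proj G ε x (C.pointLift G g ε x v) = C.pointLift G g ε x v := by
  rw [proj_apply, map_pointLift hG hε, smul_smul, hε]
  module

theorem proj_pointLift_neg (hG : C.IsGeneralizedMetric G) (hε : ε * ε = 1) :
    proj G ε x (C.pointLift G g (-ε) x v) = 0 := by
  rw [proj_apply, map_pointLift hG (by simpa using hε), smul_smul, mul_neg, hε]
  module

theorem pairing_proj (hG : C.IsGeneralizedMetric G) (e e' : E x) :
    C.pairing x (proj G ε x e) e' = C.pairing x e (proj G ε x e') := by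
  simp only [proj_apply, map_smul, map_add, LinearMap.smul_apply, LinearMap.add_apply]
  rw [hG.selfAdjoint]

theorem map_proj (hG : C.IsGeneralizedMetric G) (hε : ε * ε = 1) (e : E x) :
    G x (proj G ε x e) = ε • proj G ε x e := by
  simp only [proj_apply, map_smul, map_add, hG.involutive, smul_add, smul_smul]
  rw [add_comm, show ε * (1 / 2 * ε) = 1 / 2 by linear_combination (1 / 2) * hε, mul_comm ε]

/-- The projection to the `ε`-eigenbundle of `G`, seen through its isometry (up to a factor) with
`(T, g)`. -/
theorem metric_anchor_proj (hg : C.IsInverseMetric G g) (hG : C.IsGeneralizedMetric G)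
    (hε : ε * ε = 1) (e : E x) :
    g x (C.anchor x (proj G ε x e)) w = 1 / 2 * ε * C.pairing x e (C.pointLift G g ε x w) := by
  rw [hg.symm hG, ← C.pairing_coanchor, C.pairing_symm, pointLift_apply, proj_apply]
  simp only [map_smul, map_add, LinearMap.smul_apply, LinearMap.add_apply, smul_eq_mul,
    metricSplitting, LinearMap.comp_apply]
  rw [hG.selfAdjoint]
  linear_combination (-(1 / 2) * C.pairing x e (C.coanchor x (g x w))) * hε

theorem proj_add_proj_neg (G : ∀ x : M, E x →ₗ[ℝ] E x) (ε : ℝ) (x : M) (e : E x) :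
    proj G ε x e + proj G (-ε) x e = e := by
  rw [proj_apply, proj_apply]
  module

end Lift

section Bismut

variable [T2Space M] [FiniteDimensional ℝ F] [ContMDiffVectorBundle ∞ F E (𝓡 n)]
  {s₀ : ∀ x : M, TangentSpace (𝓡 n) x →ₗ[ℝ] E x}

theorem isSmoothSection_coanchor_metric (hg : C.IsInverseMetric G g)
    (hG : C.IsGeneralizedMetric G) (hs₀ : C.IsIsotropicSplitting s₀) (hX : IsSmoothVField X) :
    IsSmoothSection n F (fun x => C.coanchor x (g x (X x))) := by
  have h := hG.smooth _ ((hg.isIsotropicSplitting hG hs₀).smooth X hX)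
  rwa [funext fun x => IsInverseMetric.map_metricSplitting (g := g) hG x (X x)] at h

theorem isSmoothSection_lift (hg : C.IsInverseMetric G g)
    (hG : C.IsGeneralizedMetric G) (hs₀ : C.IsIsotropicSplitting s₀) (ε : ℝ)
    (hX : IsSmoothVField X) : IsSmoothSection n F (C.lift G g ε X) := by
  exact ((hg.isIsotropicSplitting hG hs₀).smooth X hX).add
    ((isSmoothSection_coanchor_metric hg hG hs₀ hX).const_smul ε)

theorem metric_bismut (hg : C.IsInverseMetric G g) (hG : C.IsGeneralizedMetric G)
    (hε : ε * ε = 1) (x : M) : g x (C.bismut G g ε X Y x) (Z x) = 1 / 2 * ε *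
      C.pairing x (C.bracketFun (C.lift G g (-ε) X) (C.lift G g ε Y) x) (C.lift G g ε Z x) :=
  metric_anchor_proj hg hG hε _

/-- The Leibniz rule defects of the Courant bracket in the first slot involve the first section and
its pairing with the second one. Both disappear, because `P_ε` kills `X^{-ε}` and `X^{-ε}` is
orthogonal to `Y^ε`. -/
theorem isAffineConnection_bismut (hg : C.IsInverseMetric G g) (hG : C.IsGeneralizedMetric G)
    (hs₀ : C.IsIsotropicSplitting s₀) (hε : ε * ε = 1) :
    IsAffineConnection (C.bismut G g ε) where
  smooth X Y hX hY := by
    have h := C.isSmoothSection_bracketFun (isSmoothSection_lift hg hG hs₀ (-ε) hX)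
      (isSmoothSection_lift hg hG hs₀ ε hY)
    refine C.isSmoothVField_anchor ?_
    rw [funext fun x => proj_apply G ε x _]
    exact (h.add ((hG.smooth _ h).const_smul ε)).const_smul (1 / 2)
  add_left X X' Y hX hX' hY x := by
    simp only [bismut, lift_add]
    rw [C.bracketFun_add_left (isSmoothSection_lift hg hG hs₀ (-ε) hX)
      (isSmoothSection_lift hg hG hs₀ (-ε) hX') (isSmoothSection_lift hg hG hs₀ ε hY), map_add,
      map_add]
  smul_left f X Y hf hX hY x := by
    simp only [bismut, lift_smul]
    rw [C.bracketFun_smul_left hf (isSmoothSection_lift hg hG hs₀ (-ε) hX)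
      (isSmoothSection_lift hg hG hs₀ ε hY), lift_eq_pointLift, lift_eq_pointLift,
      pairing_pointLift hg hG, map_add, map_sub, map_smul, map_smul, proj_pointLift_neg hG hε]
    simp
  add_right X Y Y' hX hY hY' x := by
    simp only [bismut, lift_add]
    rw [C.bracketFun_add_right (isSmoothSection_lift hg hG hs₀ (-ε) hX)
      (isSmoothSection_lift hg hG hs₀ ε hY) (isSmoothSection_lift hg hG hs₀ ε hY'), map_add,
      map_add]
  leibniz f X Y hf hX hY x := by
    simp only [bismut, lift_smul]
    rw [C.bracketFun_smul_right hf (isSmoothSection_lift hg hG hs₀ (-ε) hX)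
      (isSmoothSection_lift hg hG hs₀ ε hY)]
    simp [lift_eq_pointLift, proj_pointLift hG hε, anchor_pointLift hg]

/-- The two Bismut connections have opposite torsion. -/
theorem bismut_sub_bismut_neg (hg : C.IsInverseMetric G g) (hG : C.IsGeneralizedMetric G)
    (hs₀ : C.IsIsotropicSplitting s₀) (ε : ℝ) (hX : IsSmoothVField X)
    (hY : IsSmoothVField Y) (x : M) :
    C.bismut G g ε X Y x - C.bismut G g (-ε) Y X x = lieBr X Y x := by
  have h1 := isSmoothSection_lift hg hG hs₀ (-ε) hX
  have h2 := isSmoothSection_lift hg hG hs₀ ε hY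
  simp only [bismut, neg_neg]
  rw [C.bracketFun_swap_of_orthogonal h2 h1 (fun y => by
    rw [lift_eq_pointLift, lift_eq_pointLift, pairing_pointLift hg hG]; simp),
    map_neg, map_neg, sub_neg_eq_add, ← map_add, proj_add_proj_neg, C.anchor_bracketFun h1 h2]
  simp only [anchor_lift hg]

/-- The Bismut connections are metric. -/
theorem bismut_metric (hg : C.IsInducedMetric G g) (hG : C.IsGeneralizedMetric G)
    (hs₀ : C.IsIsotropicSplitting s₀) (hε : ε * ε = 1) (hX : IsSmoothVField X)
    (hY : IsSmoothVField Y) (hZ : IsSmoothVField Z) (x : M) :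
    dfun n (fun y => g y (Y y) (Z y)) x (X x) =
      g x (C.bismut G g ε X Y x) (Z x) + g x (Y x) (C.bismut G g ε X Z x) := by
  have hi := hg.isInverseMetric
  have h := C.dfun_pairing (isSmoothSection_lift hi hG hs₀ (-ε) hX)
    (isSmoothSection_lift hi hG hs₀ ε hY) (isSmoothSection_lift hi hG hs₀ ε hZ) x
  have hp : (fun y => C.pairing y (C.lift G g ε Y y) (C.lift G g ε Z y)) =
      fun y => (ε + ε) * g y (Y y) (Z y) := funext fun y => pairing_pointLift hi hG ε
  rw [hp, anchor_lift hi,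
    dfun_mul (isSmoothFun_const _) (hg.riemannian.smooth Y Z hY hZ), dfun_const] at h
  rw [hi.symm hG x (Y x), metric_bismut hi hG hε, metric_bismut hi hG hε]
  simp only [LinearMap.add_apply, LinearMap.smul_apply, smul_eq_mul, LinearMap.zero_apply, mul_zero,
    add_zero] at h
  rw [C.pairing_symm x (C.lift G g ε Y x)] at h
  linear_combination (1 / 2 * ε) * h - dfun n (fun y => g y (Y y) (Z y)) x (X x) * hε

/-- The mean of the two Bismut connections. -/
noncomputable def meanConnection (C : ExactCourantAlgebroid n M F E)
    (G : ∀ x : M, E x →ₗ[ℝ] E x) (g : TwoTensor n M) (X Y : VField n M) : VField n M :=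
  fun x => (1 / 2 : ℝ) • (C.bismut G g 1 X Y x + C.bismut G g (-1) X Y x)

theorem isLeviCivita_meanConnection (hg : C.IsInducedMetric G g) (hG : C.IsGeneralizedMetric G)
    (hs₀ : C.IsIsotropicSplitting s₀) : IsLeviCivita g (C.meanConnection G g) := by
  have hi := hg.isInverseMetric
  have h1 := isAffineConnection_bismut hi hG hs₀ (ε := 1) (by norm_num)
  have h2 := isAffineConnection_bismut hi hG hs₀ (ε := -1) (by norm_num)
  refine { smooth := ?_, add_left := ?_, smul_left := ?_, add_right := ?_, leibniz := ?_,
           torsion_free := ?_, metric := ?_ }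
  · intro X Y hX hY
    exact ((h1.smooth X Y hX hY).add (h2.smooth X Y hX hY)).const_smul (1 / 2)
  · intro X X' Y hX hX' hY x
    simp only [meanConnection, h1.add_left _ _ _ hX hX' hY, h2.add_left _ _ _ hX hX' hY]
    module
  · intro f X Y hf hX hY x
    simp only [meanConnection, h1.smul_left _ _ _ hf hX hY, h2.smul_left _ _ _ hf hX hY]
    module
  · intro X Y Y' hX hY hY' x
    simp only [meanConnection, h1.add_right _ _ _ hX hY hY', h2.add_right _ _ _ hX hY hY']
    module
  · intro f X Y hf hX hY x
    simp only [meanConnection, h1.leibniz _ _ _ hf hX hY, h2.leibniz _ _ _ hf hX hY]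
    module
  · intro X Y hX hY x
    have e1 := bismut_sub_bismut_neg hi hG hs₀ 1 hX hY x
    have e2 := bismut_sub_bismut_neg hi hG hs₀ (-1) hX hY x
    rw [neg_neg] at e2
    have e3 : lieBr X Y x = (1 / 2 : ℝ) • (lieBr X Y x + lieBr X Y x) := by module
    rw [e3]
    nth_rewrite 1 [← e1]
    rw [← e2]
    simp only [meanConnection]
    module
  · intro X Y Z hX hY hZ x
    have e1 := bismut_metric hg hG hs₀ (ε := 1) (by norm_num) hX hY hZ x
    have e2 := bismut_metric hg hG hs₀ (ε := -1) (by norm_num) hX hY hZ x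
    simp only [meanConnection, map_smul, map_add, LinearMap.smul_apply, LinearMap.add_apply,
      smul_eq_mul]
    linarith

/-- The difference of the two Bismut connections is the three-form of the splitting `s_G`. -/
theorem metric_bismut_sub_bismut (hg : C.IsInverseMetric G g) (hG : C.IsGeneralizedMetric G)
    (hs₀ : C.IsIsotropicSplitting s₀) (hX : IsSmoothVField X) (hY : IsSmoothVField Y)
    (hZ : IsSmoothVField Z) (x : M) :
    g x (C.bismut G g 1 X Y x - C.bismut G g (-1) X Y x) (Z x) =
      C.torsionFun (metricSplitting C G g) X Y Z x := by
  have hs := hg.isIsotropicSplitting hG hs₀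
  set s := metricSplitting C G g with hsdef
  let γ : VField n M → ∀ x : M, E x := fun X x => C.coanchor x (g x (X x))
  have hγ : ∀ {X}, IsSmoothVField X → IsSmoothSection n F (γ X) :=
    fun hX => isSmoothSection_coanchor_metric hg hG hs₀ hX
  have hγv : ∀ X x, C.anchor x (γ X x) = 0 := fun X x => C.anchor_coanchor _
  have hlift : ∀ ε X, C.lift G g ε X = fun x => s x (X x) + ε • γ X x := fun ε X =>
    funext fun x => pointLift_apply C G g ε x (X x)
  -- Terms with two or three vertical sections vanish, so only orders `0` and `1` in `ε` remain; the
  -- term of order `1` cancels in the difference.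
  have key : ∀ ε : ℝ, C.pairing x (C.bracketFun (C.lift G g (-ε) X) (C.lift G g ε Y) x)
      (C.lift G g ε Z x) = C.torsionFun s X Y Z x
        + ε * (C.pairing x (C.bracketFun (fun y => s y (X y)) (fun y => s y (Y y)) x) (γ Z x)
          + C.pairing x (C.bracketFun (fun y => s y (X y)) (γ Y) x) (s x (Z x))
          - C.pairing x (C.bracketFun (γ X) (fun y => s y (Y y)) x) (s x (Z x))) := by
    intro ε
    have hc : IsSmoothFun n (fun _ : M => ε) := isSmoothFun_const ε
    have hc' : IsSmoothFun n (fun _ : M => -ε) := isSmoothFun_const (-ε)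
    have z1 := C.pairing_bracketFun_vertical (hγ hX) (hγ hY) (hs.smooth Z hZ) (hγv X) (hγv Y) x
    have z2 := C.pairing_bracketFun_vertical (hγ hX) (hγ hY) (hγ hZ) (hγv X) (hγv Y) x
    have z3 := C.pairing_vertical (C.anchor_bracketFun_vertical_left (hγ hX) (hs.smooth Y hY)
      (hγv X) x) (hγv Z x)
    have z4 := C.pairing_vertical (C.anchor_bracketFun_vertical_right (hs.smooth X hX) (hγ hY)
      (hγv Y) x) (hγv Z x)
    rw [hlift, hlift, hlift,
      C.bracketFun_add_left (hs.smooth X hX) ((hγ hX).const_smul (-ε))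
        ((hs.smooth Y hY).add ((hγ hY).const_smul ε)),
      C.bracketFun_add_right (hs.smooth X hX) (hs.smooth Y hY) ((hγ hY).const_smul ε),
      C.bracketFun_smul_left hc' (hγ hX) ((hs.smooth Y hY).add ((hγ hY).const_smul ε)),
      C.bracketFun_smul_right hc (hs.smooth X hX) (hγ hY),
      C.bracketFun_add_right (hγ hX) (hs.smooth Y hY) ((hγ hY).const_smul ε),
      C.bracketFun_smul_right hc (hγ hX) (hγ hY)]
    simp only [dfun_const, LinearMap.zero_apply, zero_smul, add_zero, sub_zero, map_zero, smul_zero]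
    simp only [map_add, map_smul, LinearMap.add_apply, LinearMap.smul_apply, smul_eq_mul, z1, z2,
      z3, z4, torsionFun]
    ring
  have k1 := key 1
  have k2 := key (-1)
  rw [map_sub, LinearMap.sub_apply, metric_bismut hg hG (by norm_num),
    metric_bismut hg hG (by norm_num), k1, k2]
  ring

end Bismut

end ExactCourantAlgebroid

/-! ### Ricci tensors of connections with skew torsion -/

section Contraction

variable {n : ℕ} {M : Type*} [TopologicalSpace M] [ChartedSpace (EuclideanSpace ℝ (Fin n)) M]
  [IsManifold (𝓡 n) ∞ M] {g : TwoTensor n M} {x : M}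

variable (n) in
/-- The standard frame `tanBasis` at a point, as a basis of the tangent space. -/
noncomputable def tangentBasis (x : M) : Module.Basis (Fin n) ℝ (TangentSpace (𝓡 n) x) :=
  (EuclideanSpace.basisFun (Fin n) ℝ).toBasis

theorem tangentBasis_apply (x : M) (i : Fin n) : tangentBasis n x i = tanBasis n x i :=
  (by simp : (EuclideanSpace.basisFun (Fin n) ℝ).toBasis i = EuclideanSpace.single i 1)

theorem IsRiemannianMetric.gram_mul_gInv (hg : IsRiemannianMetric g) (x : M) :
    (Matrix.of fun i j => g x (tanBasis n x i) (tanBasis n x j)) * gInv g x = 1 := by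
  refine Matrix.mul_nonsing_inv _ (isUnit_iff_ne_zero.2 fun h0 => ?_)
  obtain ⟨w, hw, hw0⟩ := Matrix.exists_mulVec_eq_zero_iff.2 h0
  refine hw ?_
  have hz : ∑ k, w k • tangentBasis n x k = 0 := by
    by_contra hne
    refine (hg.pos x _ hne).ne' ?_
    conv_lhs => rw [map_sum]
    refine Finset.sum_eq_zero fun j _ => ?_
    have := congrFun hw0 j
    simp only [Matrix.mulVec, dotProduct, Matrix.of_apply, Pi.zero_apply] at this
    simp only [map_smul, map_sum, LinearMap.sum_apply, LinearMap.smul_apply, smul_eq_mul,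
      tangentBasis_apply]
    rw [← mul_zero (w j), ← this]
    simp [mul_comm, hg.symm x (tanBasis n x j)]
  exact funext fun k => Fintype.linearIndependent_iff.1 (tangentBasis n x).linearIndependent w hz k

theorem IsRiemannianMetric.gInv_symm (hg : IsRiemannianMetric g) (x : M) (i j : Fin n) :
    gInv g x i j = gInv g x j i := by
  have h : (gInv g x).transpose = gInv g x := by
    rw [gInv, Matrix.transpose_nonsing_inv]
    congr 1
    ext i j
    exact hg.symm x _ _
  exact congrFun (congrFun h j) i

theorem IsRiemannianMetric.repr_eq (hg : IsRiemannianMetric g) (x : M) (a : TangentSpace (𝓡 n) x)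
    (q : Fin n) : (tangentBasis n x).repr a q = ∑ p, gInv g x p q * g x a (tanBasis n x p) := by
  have h : ∀ p, g x a (tanBasis n x p) =
      ∑ k, (tangentBasis n x).repr a k * g x (tanBasis n x k) (tanBasis n x p) := by
    intro p
    conv_lhs => rw [← (tangentBasis n x).sum_repr a]
    simp [tangentBasis_apply]
  have h2 : ∀ k, ∑ p, g x (tanBasis n x k) (tanBasis n x p) * gInv g x p q =
      (1 : Matrix (Fin n) (Fin n) ℝ) k q := fun k => by
    rw [← hg.gram_mul_gInv x]; rfl
  simp only [h, Finset.mul_sum]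
  rw [Finset.sum_comm]
  have h3 : ∀ k, ∑ p, gInv g x p q * ((tangentBasis n x).repr a k *
      g x (tanBasis n x k) (tanBasis n x p)) =
      (tangentBasis n x).repr a k * (1 : Matrix (Fin n) (Fin n) ℝ) k q := fun k => by
    rw [← h2, Finset.mul_sum]
    exact Finset.sum_congr rfl fun p _ => by ring
  simp only [h3, Matrix.one_apply]
  simp

theorem IsRiemannianMetric.trace_eq (hg : IsRiemannianMetric g) (x : M)
    (L : TangentSpace (𝓡 n) x →ₗ[ℝ] TangentSpace (𝓡 n) x) :
    LinearMap.trace ℝ (TangentSpace (𝓡 n) x) L =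
      ∑ i, ∑ j, gInv g x i j * g x (L (tanBasis n x i)) (tanBasis n x j) := by
  rw [LinearMap.trace_eq_matrix_trace ℝ (tangentBasis n x), Matrix.trace]
  refine Finset.sum_congr rfl fun i _ => ?_
  rw [Matrix.diag_apply, LinearMap.toMatrix_apply, hg.repr_eq, tangentBasis_apply]
  exact Finset.sum_congr rfl fun j _ => by rw [hg.gInv_symm x j i]

theorem IsRiemannianMetric.sum_gInv_skew (hg : IsRiemannianMetric g) (x : M)
    (S : Fin n → Fin n → ℝ) (hS : ∀ i j, S i j = - S j i) : ∑ i, ∑ j, gInv g x i j * S i j = 0 := by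
  have h : ∑ i, ∑ j, gInv g x i j * S i j = - ∑ i, ∑ j, gInv g x i j * S i j := by
    conv_rhs => rw [Finset.sum_comm]
    simp only [← Finset.sum_neg_distrib]
    refine Finset.sum_congr rfl fun i _ => Finset.sum_congr rfl fun j _ => ?_
    rw [hS i j, hg.gInv_symm x i j]; ring
  linarith

/-- If `a u w` is dual to `c H(u, w, ·)`, the contraction of `H(v, a u w, ·)` over `u` and the free
slot is `c` times the square of `H`. -/
theorem IsRiemannianMetric.sum_contract_eq_hSquare (hg : IsRiemannianMetric g)
    {H : ThreeTensor n M} (hH₁ : ∀ x u v w, H x u v w = - H x v u w)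
    (hH₂ : ∀ x u v w, H x u v w = - H x u w v) (x : M) (v w : TangentSpace (𝓡 n) x) (c : ℝ)
    (a : TangentSpace (𝓡 n) x → TangentSpace (𝓡 n) x)
    (ha : ∀ u z, g x (a u) z = c * H x u w z) :
    ∑ i, ∑ j, gInv g x i j * H x v (a (tanBasis n x i)) (tanBasis n x j) =
      c * hSquare g H x v w := by
  have hexp : ∀ u, a u = ∑ q, (∑ p, gInv g x p q * (c * H x u w (tanBasis n x p))) •
      tanBasis n x q := by
    intro u
    conv_lhs => rw [← (tangentBasis n x).sum_repr (a u)]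
    simp only [hg.repr_eq, ha, tangentBasis_apply]
  have h1 : ∀ i j, gInv g x i j * H x v (a (tanBasis n x i)) (tanBasis n x j) =
      ∑ p, ∑ q, c * (gInv g x p q * gInv g x j i * H x v (tanBasis n x p) (tanBasis n x j) *
        H x w (tanBasis n x q) (tanBasis n x i)) := by
    intro i j
    rw [hexp]
    simp only [map_sum, map_smul, LinearMap.sum_apply, LinearMap.smul_apply, smul_eq_mul,
      Finset.mul_sum, Finset.sum_mul]
    refine Finset.sum_congr rfl fun p _ => Finset.sum_congr rfl fun q _ => ?_
    rw [hH₁ x (tanBasis n x i), hH₂ x w (tanBasis n x i), hg.gInv_symm x q p, hg.gInv_symm x i j]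
    ring
  simp only [h1, hSquare, Finset.mul_sum]
  calc _ = ∑ i, ∑ p, ∑ j, ∑ q, c * (gInv g x p q * gInv g x j i *
        H x v (tanBasis n x p) (tanBasis n x j) * H x w (tanBasis n x q) (tanBasis n x i)) :=
        Finset.sum_congr rfl fun _ _ => Finset.sum_comm
    _ = ∑ p, ∑ i, ∑ j, ∑ q, c * (gInv g x p q * gInv g x j i *
        H x v (tanBasis n x p) (tanBasis n x j) * H x w (tanBasis n x q) (tanBasis n x i)) :=
        Finset.sum_comm
    _ = ∑ p, ∑ j, ∑ i, ∑ q, c * (gInv g x p q * gInv g x j i *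
        H x v (tanBasis n x p) (tanBasis n x j) * H x w (tanBasis n x q) (tanBasis n x i)) :=
        Finset.sum_congr rfl fun _ _ => Finset.sum_comm
    _ = _ := Finset.sum_congr rfl fun _ _ => Finset.sum_congr rfl fun _ _ => Finset.sum_comm

theorem hSquare_symm (hg : IsRiemannianMetric g) (H : ThreeTensor n M) (x : M)
    (v w : TangentSpace (𝓡 n) x) : hSquare g H x v w = hSquare g H x w v := by
  have h : ∀ f : Fin n → Fin n → Fin n → Fin n → ℝ,
      ∑ p, ∑ q, ∑ r, ∑ s, f p q r s = ∑ p, ∑ q, ∑ r, ∑ s, f r s p q := by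
    intro f
    have := Finset.sum_comm (s := Finset.univ) (t := Finset.univ)
      (f := fun a b : Fin n × Fin n => f a.1 a.2 b.1 b.2)
    simpa only [Fintype.sum_prod_type] using this
  rw [hSquare, h, hSquare]
  refine Finset.sum_congr rfl fun p _ => Finset.sum_congr rfl fun q _ =>
    Finset.sum_congr rfl fun r _ => Finset.sum_congr rfl fun s _ => ?_
  rw [hg.gInv_symm x p r, hg.gInv_symm x q s]
  ring

end Contraction

section RicciWithTorsion

variable {n : ℕ} {M : Type*} [TopologicalSpace M] [ChartedSpace (EuclideanSpace ℝ (Fin n)) M]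
  [IsManifold (𝓡 n) ∞ M] [T2Space M] {g : TwoTensor n M} {H : ThreeTensor n M}
  {D D' : VField n M → VField n M → VField n M}

/-- The curvature of the connection `D' = D - H / 2`, where `H` is read as a form with values in
`T` through the metric. -/
theorem metric_curvature (hg : IsRiemannianMetric g) (hD : IsLeviCivita g D)
    (hD' : IsAffineConnection D')
    (hH : ∀ X Y Z : VField n M, IsSmoothVField X → IsSmoothVField Y → IsSmoothVField Z →
      IsSmoothFun n (fun x => H x (X x) (Y x) (Z x)))
    (hDD' : ∀ X Y : VField n M, IsSmoothVField X → IsSmoothVField Y → ∀ x z,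
      g x (D' X Y x) z = g x (D X Y x) z - 1 / 2 * H x (X x) (Y x) z)
    {X Y Z W : VField n M} (hX : IsSmoothVField X) (hY : IsSmoothVField Y) (hZ : IsSmoothVField Z)
    (hW : IsSmoothVField W) (x : M) :
    g x (curvature D' X Y Z x) (W x) = g x (curvature D X Y Z x) (W x)
      - 1 / 2 * ((dfun n (fun y => H y (Y y) (Z y) (W y)) x (X x) - H x (D X Y x) (Z x) (W x)
          - H x (Y x) (D X Z x) (W x) - H x (Y x) (Z x) (D X W x))
        - (dfun n (fun y => H y (X y) (Z y) (W y)) x (Y x) - H x (D Y X x) (Z x) (W x)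
          - H x (X x) (D Y Z x) (W x) - H x (X x) (Z x) (D Y W x)))
      + 1 / 2 * (H x (X x) (D Y Z x - D' Y Z x) (W x)
          - H x (Y x) (D X Z x - D' X Z x) (W x)) := by
  have key : ∀ {X Y : VField n M}, IsSmoothVField X → IsSmoothVField Y →
      g x (D' X (D' Y Z) x) (W x) = g x (D X (D Y Z) x) (W x)
        - 1 / 2 * (dfun n (fun y => H y (Y y) (Z y) (W y)) x (X x) - H x (Y x) (Z x) (D X W x)
          + H x (X x) (D' Y Z x) (W x)) := by
    intro X Y hX hY
    have e1 := hD.metric X (D' Y Z) W hX (hD'.smooth Y Z hY hZ) hW x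
    have e2 := hD.metric X (D Y Z) W hX (hD.smooth Y Z hY hZ) hW x
    have hsm : IsSmoothFun n (fun y => g y (D Y Z y) (W y)) :=
      hg.smooth _ _ (hD.smooth Y Z hY hZ) hW
    rw [funext fun y => hDD' Y Z hY hZ y (W y), dfun_sub hsm
      ((isSmoothFun_const (1 / 2)).mul (hH Y Z W hY hZ hW)),
      dfun_mul (isSmoothFun_const _) (hH Y Z W hY hZ hW), dfun_const, hDD' Y Z hY hZ] at e1
    simp only [LinearMap.sub_apply, LinearMap.add_apply, LinearMap.smul_apply, smul_eq_mul,
      LinearMap.zero_apply, mul_zero, add_zero] at e1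
    rw [hDD' X _ hX (hD'.smooth Y Z hY hZ)]
    linear_combination e2 - e1
  have htor : H x (lieBr X Y x) (Z x) (W x) =
      H x (D X Y x) (Z x) (W x) - H x (D Y X x) (Z x) (W x) := by
    rw [← hD.torsion_free X Y hX hY]
    simp
  simp only [curvature, map_sub, LinearMap.sub_apply]
  rw [key hX hY, key hY hX, hDD' _ _ (hX.lieBr hY) hZ, htor]
  ring

theorem covariantDerivative_swap_right
    (hH : ∀ X Y Z : VField n M, IsSmoothVField X → IsSmoothVField Y → IsSmoothVField Z →
      IsSmoothFun n (fun x => H x (X x) (Y x) (Z x)))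
    (hH₂ : ∀ x u v w, H x u v w = - H x u w v)
    {DH : ∀ x : M, TangentSpace (𝓡 n) x →ₗ[ℝ] TangentSpace (𝓡 n) x →ₗ[ℝ]
      TangentSpace (𝓡 n) x →ₗ[ℝ] TangentSpace (𝓡 n) x →ₗ[ℝ] ℝ}
    (hDH : ∀ W X Y Z : VField n M, IsSmoothVField W → IsSmoothVField X → IsSmoothVField Y →
      IsSmoothVField Z → ∀ x,
      DH x (W x) (X x) (Y x) (Z x) = dfun n (fun y => H y (X y) (Y y) (Z y)) x (W x)
        - H x (D W X x) (Y x) (Z x) - H x (X x) (D W Y x) (Z x) - H x (X x) (Y x) (D W Z x))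
    (x : M) (t u v w : TangentSpace (𝓡 n) x) : DH x t u v w = - DH x t u w v := by
  choose ext hext hextx using exists_smooth_vField (n := n) x
  have h1 := hDH _ _ _ _ (hext t) (hext u) (hext v) (hext w) x
  have h2 := hDH _ _ _ _ (hext t) (hext u) (hext w) (hext v) x
  rw [funext fun y => hH₂ y (ext u y) (ext v y) (ext w y),
    dfun_neg (hH _ _ _ (hext u) (hext w) (hext v))] at h1
  simp only [hextx, LinearMap.neg_apply] at h1 h2
  rw [h1, h2, hH₂ x _ v w, hH₂ x _ _ w, hH₂ x _ v]
  ring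

/-- `d^*H` is a two-form. -/
theorem IsCodifferential.skew
    (hH : ∀ X Y Z : VField n M, IsSmoothVField X → IsSmoothVField Y → IsSmoothVField Z →
      IsSmoothFun n (fun x => H x (X x) (Y x) (Z x)))
    (hH₂ : ∀ x u v w, H x u v w = - H x u w v) {δ : TwoTensor n M}
    (hδ : IsCodifferential g D H δ) (x : M) (v w : TangentSpace (𝓡 n) x) :
    δ x v w = - δ x w v := by
  obtain ⟨DH, hDH, hδ⟩ := hδ
  rw [hδ, hδ, ← Finset.sum_neg_distrib]
  simp only [← Finset.sum_neg_distrib]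
  refine Finset.sum_congr rfl fun i _ => Finset.sum_congr rfl fun j _ => ?_
  rw [covariantDerivative_swap_right hH hH₂ hDH x _ _ v w]
  ring

/-- The Ricci tensor of the metric connection with skew torsion `-H` is
`Rc - (1/4) H² + (1/2) d^*H`. -/
theorem ricci_of_skew_torsion (hg : IsRiemannianMetric g) (hD : IsLeviCivita g D)
    (hD' : IsAffineConnection D')
    (hH : ∀ X Y Z : VField n M, IsSmoothVField X → IsSmoothVField Y → IsSmoothVField Z →
      IsSmoothFun n (fun x => H x (X x) (Y x) (Z x)))
    (hH₁ : ∀ x u v w, H x u v w = - H x v u w) (hH₂ : ∀ x u v w, H x u v w = - H x u w v)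
    (hDD' : ∀ X Y : VField n M, IsSmoothVField X → IsSmoothVField Y → ∀ x z,
      g x (D' X Y x) z = g x (D X Y x) z - 1 / 2 * H x (X x) (Y x) z)
    {Rc Rc' δ : TwoTensor n M} (hRc : IsRicciTensor D Rc) (hRc' : IsRicciTensor D' Rc')
    (hδ : IsCodifferential g D H δ) (x : M) (v w : TangentSpace (𝓡 n) x) :
    Rc' x v w = Rc x v w - 1 / 4 * hSquare g H x v w + 1 / 2 * δ x v w := by
  obtain ⟨Rm, hRm, hRc⟩ := hRc
  obtain ⟨Rm', hRm', hRc'⟩ := hRc'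
  obtain ⟨DH, hDH, hδ⟩ := hδ
  obtain ⟨Y, hY, rfl⟩ := exists_smooth_vField x v
  obtain ⟨Z, hZ, rfl⟩ := exists_smooth_vField x w
  choose ext hext hextx using exists_smooth_vField (n := n) x
  -- the value at `x` of the tensor `D - D'`
  let a : TangentSpace (𝓡 n) x → TangentSpace (𝓡 n) x := fun u => D (ext u) Z x - D' (ext u) Z x
  have ha : ∀ u z, g x (a u) z = 1 / 2 * H x u (Z x) z := by
    intro u z
    simp only [a, map_sub, LinearMap.sub_apply, hDD' _ _ (hext u) hZ, hextx]
    ring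
  have hDH₂ := covariantDerivative_swap_right hH hH₂ hDH x
  have hDH₁ : ∀ t u v w, DH x t u v w = - DH x t v u w := by
    intro t u v w
    have h1 := hDH _ _ _ _ (hext t) (hext u) (hext v) (hext w) x
    have h2 := hDH _ _ _ _ (hext t) (hext v) (hext u) (hext w) x
    rw [funext fun y => hH₁ y (ext u y) (ext v y) (ext w y),
      dfun_neg (hH _ _ _ (hext v) (hext u) (hext w))] at h1
    simp only [hextx, LinearMap.neg_apply] at h1 h2
    rw [h1, h2, hH₁ x _ v w, hH₁ x u _ w, hH₁ x u v]
    ring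
  have hcurv : ∀ u z, g x (Rm' x u (Y x) (Z x)) z = g x (Rm x u (Y x) (Z x)) z
      - 1 / 2 * (DH x u z (Y x) (Z x) - DH x (Y x) u (Z x) z)
      + 1 / 2 * (H x u (D Y Z x - D' Y Z x) z - H x (Y x) (a u) z) := by
    intro u z
    have h := metric_curvature hg hD hD' hH hDD' (hext u) hY hZ (hext z) x
    have e1 := hRm _ _ _ (hext u) hY hZ x
    have e2 := hRm' _ _ _ (hext u) hY hZ x
    simp only [curvature] at h
    rw [← e1, ← e2, ← hDH _ _ _ _ (hext u) hY hZ (hext z),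
      ← hDH _ _ _ _ hY (hext u) hZ (hext z)] at h
    simp only [hextx] at h
    rw [h, hDH₂ u (Y x), hDH₁ u (Y x), neg_neg]
  rw [hRc', hRc, hg.trace_eq, hg.trace_eq, hδ]
  simp only [LinearMap.flip_apply, hcurv]
  have s1 := hg.sum_gInv_skew x (fun i j => DH x (Y x) (tanBasis n x i) (Z x) (tanBasis n x j))
    (fun i j => by rw [hDH₁, hDH₂, hDH₁]; ring)
  have s2 := hg.sum_gInv_skew x
    (fun i j => H x (tanBasis n x i) (D Y Z x - D' Y Z x) (tanBasis n x j))
    (fun i j => by rw [hH₁, hH₂, hH₁]; ring)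
  have s3 := hg.sum_contract_eq_hSquare hH₁ hH₂ x (Y x) (Z x) (1 / 2) a ha
  have hsplit : ∀ (R P Q S T : Fin n → Fin n → ℝ),
      ∑ i, ∑ j, gInv g x i j * (R i j - 1 / 2 * (P i j - Q i j) + 1 / 2 * (S i j - T i j)) =
        ∑ i, ∑ j, gInv g x i j * R i j
        - 1 / 2 * (∑ i, ∑ j, gInv g x i j * P i j - ∑ i, ∑ j, gInv g x i j * Q i j)
        + 1 / 2 * (∑ i, ∑ j, gInv g x i j * S i j - ∑ i, ∑ j, gInv g x i j * T i j) := by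
    intro R P Q S T
    simp only [Finset.mul_sum, ← Finset.sum_sub_distrib, ← Finset.sum_add_distrib]
    exact Finset.sum_congr rfl fun i _ => Finset.sum_congr rfl fun j _ => by ring
  rw [hsplit (fun i j => g x (Rm x (tanBasis n x i) (Y x) (Z x)) (tanBasis n x j))
    (fun i j => DH x (tanBasis n x i) (tanBasis n x j) (Y x) (Z x))
    (fun i j => DH x (Y x) (tanBasis n x i) (Z x) (tanBasis n x j))
    (fun i j => H x (tanBasis n x i) (D Y Z x - D' Y Z x) (tanBasis n x j))
    (fun i j => H x (Y x) (a (tanBasis n x i)) (tanBasis n x j)), s1, s2, s3]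
  ring

end RicciWithTorsion

section RicciSymmetric

variable {n : ℕ} {M : Type*} [TopologicalSpace M] [ChartedSpace (EuclideanSpace ℝ (Fin n)) M]
  [IsManifold (𝓡 n) ∞ M] [T2Space M] {g : TwoTensor n M}
  {D : VField n M → VField n M → VField n M} {X Y Z W : VField n M}

/-- The first Bianchi identity. -/
theorem IsLeviCivita.bianchi (hD : IsLeviCivita g D) (hX : IsSmoothVField X)
    (hY : IsSmoothVField Y) (hZ : IsSmoothVField Z) (x : M) :
    curvature D X Y Z x + curvature D Y Z X x + curvature D Z X Y x = 0 := by
  have key : ∀ {X Y Z : VField n M}, IsSmoothVField X → IsSmoothVField Y → IsSmoothVField Z →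
      D X (D Y Z) x = D X (D Z Y) x + D (lieBr Y Z) X x + lieBr X (lieBr Y Z) x := by
    intro X Y Z hX hY hZ
    have h : D Y Z = fun y => D Z Y y + lieBr Y Z y := funext fun y => by
      rw [← hD.torsion_free Y Z hY hZ]; abel
    rw [h, hD.add_right _ _ _ hX (hD.smooth Z Y hZ hY) (hY.lieBr hZ),
      ← hD.torsion_free X _ hX (hY.lieBr hZ)]
    abel
  have hJ := lieBr_jacobi hX hY hZ x
  have s1 : lieBr (lieBr X Y) Z x = - lieBr Z (lieBr X Y) x := lieBr_swap _ _ _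
  have s2 : lieBr Y (lieBr X Z) x = - lieBr Y (lieBr Z X) x := by
    rw [show lieBr X Z = fun y => (-1 : ℝ) • lieBr Z X y from
      funext fun y => by rw [lieBr_swap]; simp,
      lieBr_smul_right (isSmoothFun_const _) (hZ.lieBr hX), dfun_const]
    simp
  rw [s1, s2] at hJ
  simp only [curvature]
  rw [key hX hY hZ, key hY hZ hX, key hZ hX hY, hJ]
  abel

/-- The curvature of a metric connection is skew. The field `W` with `W x ≠ 0` gives access to
`dfun_lieBr_smul`. -/
theorem IsLeviCivita.metric_curvature_swap (hg : IsRiemannianMetric g) (hD : IsLeviCivita g D)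
    (hX : IsSmoothVField X) (hY : IsSmoothVField Y) (hZ : IsSmoothVField Z)
    (hW : IsSmoothVField W) {x : M} (hx : W x ≠ 0) :
    g x (curvature D X Y Z x) (W x) = - g x (curvature D X Y W x) (Z x) := by
  have hf := hg.smooth Z W hZ hW
  have key : ∀ {X Y : VField n M}, IsSmoothVField X → IsSmoothVField Y →
      dfun n (fun y => dfun n (fun y => g y (Z y) (W y)) y (Y y)) x (X x) =
        g x (D X (D Y Z) x) (W x) + g x (D Y Z x) (D X W x) + g x (D X Z x) (D Y W x)
          + g x (Z x) (D X (D Y W) x) := by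
    intro X Y hX hY
    rw [funext fun y => hD.metric Y Z W hY hZ hW y,
      dfun_add (hg.smooth _ _ (hD.smooth Y Z hY hZ) hW) (hg.smooth _ _ hZ (hD.smooth Y W hY hW)),
      LinearMap.add_apply, hD.metric X _ _ hX (hD.smooth Y Z hY hZ) hW,
      hD.metric X _ _ hX hZ (hD.smooth Y W hY hW)]
    ring
  have h := dfun_lieBr_smul hf hX hY hW x
  have h' := smul_left_injective ℝ hx h
  rw [key hX hY, key hY hX, hD.metric _ _ _ (hX.lieBr hY) hZ hW] at h'
  rw [hg.symm x _ (Z x)]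
  simp only [curvature, map_sub, LinearMap.sub_apply]
  linear_combination -h'

/-- By the Bianchi identity `Rc(v, w) - Rc(w, v)` is the trace of `-R(v, w)`, which is skew. -/
theorem IsLeviCivita.ricci_symm (hg : IsRiemannianMetric g) (hD : IsLeviCivita g D)
    {Rc : TwoTensor n M} (hRc : IsRicciTensor D Rc) (x : M) (v w : TangentSpace (𝓡 n) x) :
    Rc x v w = Rc x w v := by
  obtain ⟨Rm, hRm, hRc⟩ := hRc
  choose ext hext hextx using exists_smooth_vField (n := n) x
  have hc : ∀ u v w, Rm x u v w = curvature D (ext u) (ext v) (ext w) x := fun u v w => by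
    have := hRm _ _ _ (hext u) (hext v) (hext w) x
    simp only [hextx] at this
    exact this
  have hb : ∀ u, Rm x u v w - Rm x u w v = - Rm x v w u := by
    intro u
    have h1 := hD.bianchi (hext u) (hext v) (hext w) x
    rw [curvature_swap hD.toIsAffineConnection (hext w) (hext u) (hext v)] at h1
    rw [hc, hc, hc, ← sub_eq_zero, ← h1]
    abel
  have hs : ∀ a c, g x (Rm x v w a) c = - g x (Rm x v w c) a := by
    intro a c
    by_cases h0 : c = 0
    · simp [h0]
    · have h := hD.metric_curvature_swap hg (hext v) (hext w) (hext a) (hext c) (x := x)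
        (by rwa [hextx])
      rw [hc, hc]
      simpa only [hextx] using h
  rw [← sub_eq_zero, hRc, hRc, hg.trace_eq, hg.trace_eq]
  simp only [← Finset.sum_sub_distrib, ← mul_sub, ← LinearMap.sub_apply, ← map_sub,
    LinearMap.flip_apply, hb]
  exact hg.sum_gInv_skew x (fun i j => g x (- Rm x v w (tanBasis n x i)) (tanBasis n x j))
    fun i j => by simp only [map_neg, LinearMap.neg_apply]; rw [hs]

end RicciSymmetric

/-! ### Derivatives of curves in finite-dimensional spaces -/

section Derivatives

/-- The chain rule with a continuous linear map, for topological vector spaces without a norm. -/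
theorem ContinuousLinearMap.hasDerivWithinAt_comp {V W : Type*} [AddCommGroup V] [Module ℝ V]
    [TopologicalSpace V] [IsTopologicalAddGroup V] [ContinuousSMul ℝ V] [AddCommGroup W]
    [Module ℝ W] [TopologicalSpace W] [IsTopologicalAddGroup W] [ContinuousSMul ℝ W]
    (A : V →L[ℝ] W) {f : ℝ → V} {f' : V} {J : Set ℝ} {t : ℝ} (hf : HasDerivWithinAt f f' J t) :
    HasDerivWithinAt (fun τ => A (f τ)) (A f') J t := by
  have h := (A.isBigOTVS_fun_comp).trans_isLittleOTVS hf.isLittleOTVS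
  refine ⟨h.congr_left fun p => ?_⟩
  simp

/-- On a finite-dimensional space, differentiability and derivatives of curves are tested by the
functionals of a nondegenerate symmetric form. -/
theorem hasDerivWithinAt_iff_bilin {V : Type*} [AddCommGroup V] [Module ℝ V]
    [TopologicalSpace V] [IsTopologicalAddGroup V] [ContinuousSMul ℝ V] [T2Space V]
    [FiniteDimensional ℝ V] {B : V →ₗ[ℝ] V →ₗ[ℝ] ℝ} (hsymm : ∀ v w, B v w = B w v)
    (hB : ∀ v, (∀ w, B v w = 0) → v = 0) {f : ℝ → V} {f' : V} {J : Set ℝ} {t : ℝ} :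
    HasDerivWithinAt f f' J t ↔
      ∀ e, HasDerivWithinAt (fun τ => B (f τ) e) (B f' e) J t := by
  have hfun : ∀ φ : Module.Dual ℝ V, ∃ e, ∀ v, φ v = B v e := by
    have hinj : Function.Injective B := by
      rw [← LinearMap.ker_eq_bot, LinearMap.ker_eq_bot']
      exact fun v hv => hB v fun w => by rw [hv, LinearMap.zero_apply]
    have hsurj := (LinearMap.injective_iff_surjective_of_finrank_eq_finrank
      (Subspace.dual_finrank_eq (K := ℝ) (V := V)).symm).1 hinj
    intro φ
    obtain ⟨e, rfl⟩ := hsurj φ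
    exact ⟨e, fun v => hsymm e v⟩
  constructor
  · intro h e
    have := (LinearMap.toContinuousLinearMap (B.flip e)).hasDerivWithinAt_comp h
    simpa using this
  · intro h
    let β := Module.finBasis ℝ V
    have hpi : HasDerivWithinAt (fun τ => β.equivFunL (f τ)) (β.equivFunL f') J t := by
      rw [hasDerivWithinAt_pi]
      intro i
      obtain ⟨e, he⟩ := hfun (β.coord i)
      simp only [Module.Basis.equivFunL_apply, ← Module.Basis.coord_apply, he]
      exact h e
    have := (β.equivFunL.symm : _ →L[ℝ] V).hasDerivWithinAt_comp hpi
    simpa using this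

theorem DifferentiableWithinAt.congr_of_mem {p q : ℝ → ℝ} {J : Set ℝ} {t : ℝ}
    (hp : DifferentiableWithinAt ℝ p J t) (h : ∀ τ ∈ J, q τ = p τ) (ht : t ∈ J) :
    DifferentiableWithinAt ℝ q J t :=
  hp.congr h (h t ht)

theorem differentiableWithinAt_det {ι : Type*} [Fintype ι] [DecidableEq ι]
    {A : ℝ → Matrix ι ι ℝ} {J : Set ℝ} {t : ℝ}
    (hA : ∀ i j, DifferentiableWithinAt ℝ (fun τ => A τ i j) J t) :
    DifferentiableWithinAt ℝ (fun τ => (A τ).det) J t := by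
  simp only [Matrix.det_apply']
  refine DifferentiableWithinAt.fun_sum fun σ _ => DifferentiableWithinAt.const_mul ?_ _
  exact DifferentiableWithinAt.fun_finsetProd fun i _ => hA _ _

theorem differentiableWithinAt_matrix_inv {ι : Type*} [Fintype ι] [DecidableEq ι]
    {A : ℝ → Matrix ι ι ℝ} {J : Set ℝ} {t : ℝ} (hdet : (A t).det ≠ 0)
    (hA : ∀ i j, DifferentiableWithinAt ℝ (fun τ => A τ i j) J t) (i j : ι) :
    DifferentiableWithinAt ℝ (fun τ => (A τ)⁻¹ i j) J t := by
  simp only [Matrix.inv_def, Ring.inverse_eq_inv', Matrix.smul_apply, smul_eq_mul,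
    Matrix.adjugate_apply]
  refine ((differentiableWithinAt_det hA).inv hdet).mul (differentiableWithinAt_det fun k l => ?_)
  by_cases h : k = j
  · subst h
    simp only [Matrix.updateRow_self]
    exact differentiableWithinAt_const _
  · simpa [Matrix.updateRow_ne h] using hA k l

theorem HasDerivWithinAt.mul_of_eq_zero {p q : ℝ → ℝ} {J : Set ℝ} {t : ℝ}
    (hp : DifferentiableWithinAt ℝ p J t) (hq : DifferentiableWithinAt ℝ q J t)
    (hp0 : p t = 0) (hq0 : q t = 0) : HasDerivWithinAt (fun τ => p τ * q τ) 0 J t := by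
  exact (hp.hasDerivWithinAt.fun_mul hq.hasDerivWithinAt).congr_deriv (by simp [hp0, hq0])

end Derivatives

namespace ExactCourantAlgebroid

variable {n : ℕ} {M : Type*} [TopologicalSpace M] [ChartedSpace (EuclideanSpace ℝ (Fin n)) M]
  [IsManifold (𝓡 n) ∞ M]
  {F : Type*} [NormedAddCommGroup F] [NormedSpace ℝ F]
  {E : M → Type*} [TopologicalSpace (Bundle.TotalSpace F E)]
  [∀ x, AddCommGroup (E x)] [∀ x, Module ℝ (E x)] [∀ x, TopologicalSpace (E x)]
  [∀ x, IsTopologicalAddGroup (E x)] [∀ x, ContinuousSMul ℝ (E x)]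
  [FiberBundle F E] [VectorBundle ℝ F E] [FiniteDimensional ℝ F]

/-- The fibre `E x` carries no norm, but it is isomorphic to `F` through a trivialization. -/
theorem hasDerivWithinAt_iff_pairing (C : ExactCourantAlgebroid n M F E) {x : M} {f : ℝ → E x}
    {f' : E x} {J : Set ℝ} {t : ℝ} :
    HasDerivWithinAt f f' J t ↔
      ∀ e, HasDerivWithinAt (fun τ => C.pairing x (f τ) e) (C.pairing x f' e) J t := by
  let Φ : E x ≃L[ℝ] F := (trivializationAt F E x).continuousLinearEquivAt ℝ x
    (FiberBundle.mem_baseSet_trivializationAt' x)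
  have : T2Space (E x) := Φ.toHomeomorph.isEmbedding.t2Space
  have : FiniteDimensional ℝ (E x) := Φ.symm.toLinearEquiv.finiteDimensional
  exact hasDerivWithinAt_iff_bilin (C.pairing_symm x) (C.pairing_nondegenerate x)

end ExactCourantAlgebroid

/-! ### The derivative of a generalized metric in terms of the induced pair -/

namespace ExactCourantAlgebroid

variable {n : ℕ} {M : Type*} [TopologicalSpace M] [ChartedSpace (EuclideanSpace ℝ (Fin n)) M]
  [IsManifold (𝓡 n) ∞ M]
  {F : Type*} [NormedAddCommGroup F] [NormedSpace ℝ F]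
  {E : M → Type*} [TopologicalSpace (Bundle.TotalSpace F E)]
  [∀ x, AddCommGroup (E x)] [∀ x, Module ℝ (E x)] [∀ x, TopologicalSpace (E x)]
  [FiberBundle F E] [VectorBundle ℝ F E]
  {C : ExactCourantAlgebroid n M F E} {x : M}
  {s₀ : ∀ x : M, TangentSpace (𝓡 n) x →ₗ[ℝ] E x}

theorem coanchor_eq_sum (C : ExactCourantAlgebroid n M F E)
    (ζ : Module.Dual ℝ (TangentSpace (𝓡 n) x)) :
    C.coanchor x ζ = ∑ i, ζ (tanBasis n x i) • C.coanchor x ((tangentBasis n x).coord i) := by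
  conv_lhs => rw [← (tangentBasis n x).sum_dual_apply_smul_coord ζ]
  simp [tangentBasis_apply]

section Single

variable {G : ∀ x : M, E x →ₗ[ℝ] E x} {g b : TwoTensor n M}

theorem IsInducedMetric.anchor_map_coanchor_coord (hg : C.IsInducedMetric G g) (i : Fin n) :
    C.anchor x (G x (C.coanchor x ((tangentBasis n x).coord i))) =
      ∑ j, gInv g x i j • tanBasis n x j := by
  set a := C.anchor x (G x (C.coanchor x ((tangentBasis n x).coord i))) with ha
  have h : g x a = (tangentBasis n x).coord i := (hg.inverse x _ _).2 ha.symm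
  conv_lhs => rw [← (tangentBasis n x).sum_repr a]
  refine Finset.sum_congr rfl fun j _ => ?_
  rw [hg.riemannian.repr_eq, h, tangentBasis_apply]
  congr 1
  rw [Finset.sum_eq_single i]
  · simp [← tangentBasis_apply]
  · intro p _ hp
    simp [← tangentBasis_apply, hp]
  · simp

/-- The matrix `g^{ij}` consists of the values of `⟨G ·, ·⟩` on `T*`. -/
theorem IsInducedMetric.gInv_eq (hg : C.IsInducedMetric G g) (i j : Fin n) :
    gInv g x i j = C.pairing x (G x (C.coanchor x ((tangentBasis n x).coord i)))
      (C.coanchor x ((tangentBasis n x).coord j)) := by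
  rw [C.pairing_coanchor_right, hg.anchor_map_coanchor_coord]
  simp [← tangentBasis_apply, Finsupp.single_apply]

/-- On `T*` the generalized metric is `G π^* = s_G g⁻¹ = (s₀ + π^* b) g⁻¹`. -/
theorem IsInducedPair.map_coanchor_coord (h : C.IsInducedPair s₀ G g b)
    (hs₀ : C.IsIsotropicSplitting s₀) (i : Fin n) :
    G x (C.coanchor x ((tangentBasis n x).coord i)) =
      ∑ j, gInv g x i j • (s₀ x (tanBasis n x j) + C.coanchor x (b x (tanBasis n x j))) := by
  have h1 := (h.metric.inverse x _ ((tangentBasis n x).coord i)).2 rfl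
  have h2 : metricSplitting C G g x (∑ j, gInv g x i j • tanBasis n x j) =
      G x (C.coanchor x ((tangentBasis n x).coord i)) := by
    rw [← h.metric.anchor_map_coanchor_coord, metricSplitting, LinearMap.comp_apply,
      LinearMap.comp_apply, h1]
  rw [← h2, map_sum]
  exact Finset.sum_congr rfl fun j _ => by rw [map_smul, h.metricSplitting_apply hs₀]

theorem IsInducedPair.pointLift_eq (h : C.IsInducedPair s₀ G g b)
    (hs₀ : C.IsIsotropicSplitting s₀) (ε : ℝ) (v : TangentSpace (𝓡 n) x) :
    C.pointLift G g ε x v = s₀ x v + C.coanchor x (b x v + ε • g x v) := by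
  rw [pointLift_apply, h.metricSplitting_apply hs₀, map_add, map_smul, add_assoc]

theorem pairing_lieElement_pos (hg : C.IsInverseMetric G g) (hG : C.IsGeneralizedMetric G)
    (r : TwoTensor n M) (v w : TangentSpace (𝓡 n) x) :
    C.pairing x (C.lieElement G r x (C.pointLift G g 1 x v)) (C.pointLift G g (-1) x w) =
      r x v w := by
  have h1 := proj_pointLift (g := g) (x := x) (v := v) hG (ε := 1) (by norm_num)
  have h2 := proj_pointLift_neg (g := g) (x := x) (v := v) hG (ε := -1) (by norm_num)
  have h3 := proj_pointLift (g := g) (x := x) (v := w) hG (ε := -1) (by norm_num)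
  rw [neg_neg] at h2
  simp only [lieElement, LinearMap.sub_apply, LinearMap.comp_apply, h1, h2, map_zero, sub_zero,
    bElement, anchor_pointLift hg]
  rw [pairing_proj hG, h3, C.pairing_coanchor, anchor_pointLift hg]

theorem pairing_lieElement_neg (hg : C.IsInverseMetric G g) (hG : C.IsGeneralizedMetric G)
    (r : TwoTensor n M) (v w : TangentSpace (𝓡 n) x) :
    C.pairing x (C.lieElement G r x (C.pointLift G g (-1) x v)) (C.pointLift G g 1 x w) =
      - r x w v := by
  have h1 := proj_pointLift (g := g) (x := x) (v := v) hG (ε := -1) (by norm_num)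
  have h2 := proj_pointLift_neg (g := g) (x := x) (v := v) hG (ε := 1) (by norm_num)
  have h3 := proj_pointLift (g := g) (x := x) (v := w) hG (ε := 1) (by norm_num)
  simp only [lieElement, LinearMap.sub_apply, LinearMap.comp_apply, h1, h2, map_zero, zero_sub,
    bElement, anchor_pointLift hg, map_neg, LinearMap.neg_apply]
  rw [pairing_proj hG, h3, C.pairing_coanchor, anchor_pointLift hg, LinearMap.flip_apply]

/-- The commutator with `G` maps an eigenbundle of `G` to the opposite one. -/
theorem pairing_commutator (hG : C.IsGeneralizedMetric G) {ε ε' : ℝ} (hε : ε * ε = 1)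
    (hε' : ε' * ε' = 1) (A : E x →ₗ[ℝ] E x) (v w : TangentSpace (𝓡 n) x) :
    C.pairing x (((-2 : ℝ) • (A ∘ₗ G x - G x ∘ₗ A)) (C.pointLift G g ε x v))
      (C.pointLift G g ε' x w) =
      2 * (ε' - ε) * C.pairing x (A (C.pointLift G g ε x v)) (C.pointLift G g ε' x w) := by
  simp only [LinearMap.smul_apply, LinearMap.sub_apply, LinearMap.comp_apply, map_smul, map_sub,
    map_pointLift hG hε, smul_eq_mul]
  rw [hG.selfAdjoint, map_pointLift hG hε', map_smul, smul_eq_mul]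
  ring

/-- The lifts `X^±` parametrize the two eigenbundles of `G`. -/
theorem exists_pointLift_add (hg : C.IsInverseMetric G g) (hG : C.IsGeneralizedMetric G)
    (e : E x) : ∃ v w, e = C.pointLift G g 1 x v + C.pointLift G g (-1) x w := by
  have key : ∀ ε : ℝ, ε * ε = 1 → ∃ v, proj G ε x e = C.pointLift G g ε x v := by
    intro ε hε
    refine ⟨C.anchor x (proj G ε x e), ?_⟩
    -- The difference is vertical and `G` acts on it as `ε`, so `⟨G u, u⟩ = ε ⟨u, u⟩ = 0`.
    set u := proj G ε x e - C.pointLift G g ε x (C.anchor x (proj G ε x e)) with hu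
    have hu0 : C.anchor x u = 0 := by rw [hu, map_sub, anchor_pointLift hg, sub_self]
    have huG : G x u = ε • u := by
      rw [hu, map_sub, map_proj hG hε, map_pointLift hG hε, smul_sub]
    by_contra hne
    have hpos := hG.pos x u (sub_ne_zero.2 hne)
    rw [huG, map_smul, LinearMap.smul_apply, C.pairing_vertical hu0 hu0, smul_zero] at hpos
    exact lt_irrefl _ hpos
  obtain ⟨v, hv⟩ := key 1 (by norm_num)
  obtain ⟨w, hw⟩ := key (-1) (by norm_num)
  exact ⟨v, w, by rw [← hv, ← hw, proj_add_proj_neg]⟩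

end Single

section Family

variable {G : ℝ → ∀ x : M, E x →ₗ[ℝ] E x} {g b : ℝ → TwoTensor n M} {J : Set ℝ} {t : ℝ}

theorem _root_.differentiableWithinAt_twoTensor {m : ℝ → TwoTensor n M}
    (hm : ∀ i j, DifferentiableWithinAt ℝ (fun τ => m τ x (tanBasis n x i) (tanBasis n x j)) J t)
    (v w : TangentSpace (𝓡 n) x) : DifferentiableWithinAt ℝ (fun τ => m τ x v w) J t := by
  have h : ∀ τ, m τ x v w = ∑ i, ∑ j, (tangentBasis n x).repr v j * ((tangentBasis n x).repr w i *
      m τ x (tanBasis n x j) (tanBasis n x i)) := by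
    intro τ
    conv_lhs => rw [← (tangentBasis n x).sum_repr v, ← (tangentBasis n x).sum_repr w]
    simp only [map_sum, map_smul, LinearMap.sum_apply, LinearMap.smul_apply, smul_eq_mul,
      tangentBasis_apply, Finset.mul_sum]
    exact Finset.sum_congr rfl fun _ _ => Finset.sum_congr rfl fun _ _ => by ring
  simp only [h]
  exact DifferentiableWithinAt.fun_sum fun i _ => DifferentiableWithinAt.fun_sum fun j _ =>
    ((hm j i).const_mul _).const_mul _

theorem differentiableWithinAt_pairing_map_coanchor {e : E x}
    {ζ : ℝ → Module.Dual ℝ (TangentSpace (𝓡 n) x)}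
    (hG : ∀ i, DifferentiableWithinAt ℝ
      (fun τ => C.pairing x (G τ x (C.coanchor x ((tangentBasis n x).coord i))) e) J t)
    (hζ : ∀ v, DifferentiableWithinAt ℝ (fun τ => ζ τ v) J t) :
    DifferentiableWithinAt ℝ (fun τ => C.pairing x (G τ x (C.coanchor x (ζ τ))) e) J t := by
  have h : ∀ τ, C.pairing x (G τ x (C.coanchor x (ζ τ))) e = ∑ i, ζ τ (tanBasis n x i) *
      C.pairing x (G τ x (C.coanchor x ((tangentBasis n x).coord i))) e := by
    intro τ
    rw [C.coanchor_eq_sum (ζ τ)]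
    simp [LinearMap.sum_apply]
  simp only [h]
  exact DifferentiableWithinAt.fun_sum fun i _ => (hζ _).mul (hG i)

/-- If `G` is differentiable in time, so is `g`, whose matrix is inverse to a matrix of values of
`⟨G ·, ·⟩`. -/
theorem differentiableWithinAt_metric (ht : t ∈ J) (hg : ∀ t ∈ J, C.IsInducedMetric (G t) (g t))
    (hd : ∀ e e', DifferentiableWithinAt ℝ (fun τ => C.pairing x (G τ x e) e') J t)
    (v w : TangentSpace (𝓡 n) x) : DifferentiableWithinAt ℝ (fun τ => g τ x v w) J t := by
  have hinv : ∀ i j, DifferentiableWithinAt ℝ (fun τ => gInv (g τ) x i j) J t := fun i j =>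
    (hd _ _).congr_of_mem (fun τ hτ => (hg τ hτ).gInv_eq i j) ht
  have hdet : (gInv (g t) x).det ≠ 0 := fun h0 => by
    have := congrArg Matrix.det ((hg t ht).riemannian.gram_mul_gInv x)
    rw [Matrix.det_mul, h0, mul_zero, Matrix.det_one] at this
    exact zero_ne_one this
  refine differentiableWithinAt_twoTensor (fun i j => ?_) v w
  refine (differentiableWithinAt_matrix_inv hdet hinv i j).congr_of_mem (fun τ hτ => ?_) ht
  rw [Matrix.inv_eq_left_inv ((hg τ hτ).riemannian.gram_mul_gInv x)]
  rfl

/-- Here `b(v, w) = ⟨G π^* g v, s₀ w⟩`. -/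
theorem differentiableWithinAt_torsionPotential (ht : t ∈ J) (hs₀ : C.IsIsotropicSplitting s₀)
    (h : ∀ t ∈ J, C.IsInducedPair s₀ (G t) (g t) (b t))
    (hd : ∀ e e', DifferentiableWithinAt ℝ (fun τ => C.pairing x (G τ x e) e') J t)
    (v w : TangentSpace (𝓡 n) x) : DifferentiableWithinAt ℝ (fun τ => b τ x v w) J t := by
  refine (differentiableWithinAt_pairing_map_coanchor (ζ := fun τ => g τ x v) (e := s₀ x w)
    (fun i => hd _ _) fun u => differentiableWithinAt_metric ht (fun τ hτ => (h τ hτ).metric) hd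
      v u).congr_of_mem (fun τ hτ => ?_) ht
  have h1 := (h τ hτ).metricSplitting_apply hs₀ x v
  simp only [metricSplitting, LinearMap.comp_apply] at h1
  rw [h1, map_add, LinearMap.add_apply, hs₀.isotropic, zero_add, C.pairing_coanchor, hs₀.splits]

/-- Conversely `G` is a rational function of `g` and `b`: on `T*` it is `(s₀ + π^* b) g⁻¹`, and on
`s₀ T` it is `π^* g - G π^* b`. -/
theorem differentiableWithinAt_generalizedMetric (ht : t ∈ J) (hs₀ : C.IsIsotropicSplitting s₀)
    (hG : ∀ t ∈ J, C.IsGeneralizedMetric (G t))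
    (h : ∀ t ∈ J, C.IsInducedPair s₀ (G t) (g t) (b t))
    (hdg : ∀ v w, DifferentiableWithinAt ℝ (fun τ => g τ x v w) J t)
    (hdb : ∀ v w, DifferentiableWithinAt ℝ (fun τ => b τ x v w) J t) (e e' : E x) :
    DifferentiableWithinAt ℝ (fun τ => C.pairing x (G τ x e) e') J t := by
  have hdet : (Matrix.of fun i j => g t x (tanBasis n x i) (tanBasis n x j)).det ≠ 0 := fun h0 => by
    have := congrArg Matrix.det ((h t ht).metric.riemannian.gram_mul_gInv x)
    rw [Matrix.det_mul, h0, zero_mul, Matrix.det_one] at this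
    exact zero_ne_one this
  have hinv : ∀ i j, DifferentiableWithinAt ℝ (fun τ => gInv (g τ) x i j) J t :=
    differentiableWithinAt_matrix_inv (A := fun τ => Matrix.of fun i j =>
      g τ x (tanBasis n x i) (tanBasis n x j)) hdet fun i j => hdg _ _
  have hcoord : ∀ i, DifferentiableWithinAt ℝ
      (fun τ => C.pairing x (G τ x (C.coanchor x ((tangentBasis n x).coord i))) e') J t := by
    intro i
    refine DifferentiableWithinAt.congr_of_mem (p := fun τ => ∑ j, gInv (g τ) x i j *
      (C.pairing x (s₀ x (tanBasis n x j)) e' + b τ x (tanBasis n x j) (C.anchor x e')))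
      (DifferentiableWithinAt.fun_sum fun j _ => (hinv i j).mul ((hdb _ _).const_add _))
      (fun τ hτ => ?_) ht
    rw [(h τ hτ).map_coanchor_coord hs₀]
    simp [C.pairing_coanchor, mul_add]
  obtain ⟨ζ, hζ⟩ := C.exists_coanchor_eq (x := x) (e := e - s₀ x (C.anchor x e))
    (by rw [map_sub, hs₀.splits, sub_self])
  have hA := differentiableWithinAt_pairing_map_coanchor (ζ := fun _ => ζ) hcoord
    fun v => differentiableWithinAt_const _
  have hB := differentiableWithinAt_pairing_map_coanchor (ζ := fun τ => b τ x (C.anchor x e))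
    hcoord fun v => hdb _ v
  refine (((hdg (C.anchor x e) (C.anchor x e')).sub hB).add hA).congr_of_mem (fun τ hτ => ?_) ht
  have h1 := (h τ hτ).metricSplitting_apply hs₀ x (C.anchor x e)
  have h2 : e = metricSplitting C (G τ) (g τ) x (C.anchor x e)
      - C.coanchor x (b τ x (C.anchor x e)) + C.coanchor x ζ := by rw [h1, hζ]; abel
  conv_lhs => rw [h2]
  rw [map_add, map_sub, IsInverseMetric.map_metricSplitting (hG τ hτ)]
  simp [C.pairing_coanchor]

/-- A product of two differentiable quantities that vanish at time `t` has derivative zero. -/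
theorem hasDerivWithinAt_pairing_sub_coanchor {e : E x}
    {ζ : ℝ → Module.Dual ℝ (TangentSpace (𝓡 n) x)}
    (hd : ∀ e', DifferentiableWithinAt ℝ (fun τ => C.pairing x (G τ x e) e') J t)
    (hζ : ∀ v, DifferentiableWithinAt ℝ (fun τ => ζ τ v) J t) (hζ0 : ζ t = 0) :
    HasDerivWithinAt (fun τ => C.pairing x (G τ x e - G t x e) (C.coanchor x (ζ τ))) 0 J t := by
  have h : ∀ τ, C.pairing x (G τ x e - G t x e) (C.coanchor x (ζ τ)) = ∑ i, ζ τ (tanBasis n x i) *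
      (C.pairing x (G τ x e) (C.coanchor x ((tangentBasis n x).coord i)) -
        C.pairing x (G t x e) (C.coanchor x ((tangentBasis n x).coord i))) := by
    intro τ
    rw [C.coanchor_eq_sum (ζ τ)]
    simp
  simp only [h]
  have h0 : (0 : ℝ) = ∑ i : Fin n, 0 := by simp
  rw [h0]
  exact HasDerivWithinAt.fun_sum fun i _ => HasDerivWithinAt.mul_of_eq_zero (hζ _)
    ((hd _).sub_const _) (by rw [hζ0, LinearMap.zero_apply]) (sub_self _)

/-- For the derivative of `⟨G e, X^ε⟩` it is the same whether the lift `X^ε` is taken at the fixed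
time `t`, or at the running time `τ` with `G` replaced by its increment. -/
theorem hasDerivWithinAt_pairing_pointLift_iff (ht : t ∈ J) (hs₀ : C.IsIsotropicSplitting s₀)
    (h : ∀ t ∈ J, C.IsInducedPair s₀ (G t) (g t) (b t))
    (hdg : ∀ v w, DifferentiableWithinAt ℝ (fun τ => g τ x v w) J t)
    (hdb : ∀ v w, DifferentiableWithinAt ℝ (fun τ => b τ x v w) J t) {e : E x}
    (hd : ∀ e', DifferentiableWithinAt ℝ (fun τ => C.pairing x (G τ x e) e') J t) (ε : ℝ)
    (w : TangentSpace (𝓡 n) x) (p : ℝ) :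
    HasDerivWithinAt (fun τ => C.pairing x (G τ x e) (C.pointLift (G t) (g t) ε x w)) p J t ↔
      HasDerivWithinAt
        (fun τ => C.pairing x (G τ x e - G t x e) (C.pointLift (G τ) (g τ) ε x w)) p J t := by
  have h0 := hasDerivWithinAt_pairing_sub_coanchor (C := C) (e := e)
    (ζ := fun τ => (b τ x w + ε • g τ x w) - (b t x w + ε • g t x w)) hd
    (fun v => ((hdb w v).add ((hdg w v).const_mul ε)).sub_const _) (sub_self _)
  have hL : ∀ τ ∈ J, C.pointLift (G τ) (g τ) ε x w = C.pointLift (G t) (g t) ε x w +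
      C.coanchor x ((b τ x w + ε • g τ x w) - (b t x w + ε • g t x w)) := by
    intro τ hτ
    rw [(h τ hτ).pointLift_eq hs₀, (h t ht).pointLift_eq hs₀, map_sub]
    abel
  constructor
  · intro h1
    have h2 := (h1.sub_const (C.pairing x (G t x e) (C.pointLift (G t) (g t) ε x w))).add h0
    rw [add_zero] at h2
    refine h2.congr_of_mem (fun τ hτ => ?_) ht
    simp only [Pi.add_apply]
    rw [hL τ hτ]
    simp only [map_add, map_sub, LinearMap.sub_apply]
  · intro h1
    have h2 := (h1.sub h0).add_const (C.pairing x (G t x e) (C.pointLift (G t) (g t) ε x w))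
    rw [sub_zero] at h2
    refine h2.congr_of_mem (fun τ hτ => ?_) ht
    simp only [Pi.sub_apply]
    rw [hL τ hτ]
    simp only [map_add, map_sub, LinearMap.sub_apply]
    ring

/-- The lift at time `t` is an eigenvector of `G t` and the lift at time `τ` one of `G τ`, so the
increment of `G` is computed without differentiation. -/
theorem pairing_sub_pointLift {τ : ℝ} (hG : ∀ t ∈ J, C.IsGeneralizedMetric (G t)) (ht : t ∈ J)
    (hτ : τ ∈ J) {ε ε' : ℝ} (hε : ε * ε = 1) (hε' : ε' * ε' = 1) (v w : TangentSpace (𝓡 n) x) :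
    C.pairing x (G τ x (C.pointLift (G t) (g t) ε x v) - G t x (C.pointLift (G t) (g t) ε x v))
      (C.pointLift (G τ) (g τ) ε' x w) = (ε' - ε) *
        C.pairing x (C.pointLift (G t) (g t) ε x v) (C.pointLift (G τ) (g τ) ε' x w) := by
  rw [map_sub, LinearMap.sub_apply, (hG τ hτ).selfAdjoint, map_pointLift (hG τ hτ) hε',
    map_pointLift (hG t ht) hε]
  simp only [map_smul, LinearMap.smul_apply, smul_eq_mul]
  ring

theorem pairing_pointLift_pointLift {τ : ℝ} (hs₀ : C.IsIsotropicSplitting s₀)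
    (h : ∀ t ∈ J, C.IsInducedPair s₀ (G t) (g t) (b t)) (ht : t ∈ J) (hτ : τ ∈ J)
    (ε ε' : ℝ) (v w : TangentSpace (𝓡 n) x) :
    C.pairing x (C.pointLift (G t) (g t) ε x v) (C.pointLift (G τ) (g τ) ε' x w) =
      (b t x v w + ε * g t x v w) - (b τ x v w - ε' * g τ x v w) := by
  rw [(h τ hτ).pointLift_eq hs₀, (h t ht).pointLift_eq hs₀]
  simp only [map_add, LinearMap.add_apply, hs₀.isotropic, C.pairing_coanchor, hs₀.splits,
    C.pairing_coanchor_right, C.anchor_coanchor, map_zero, LinearMap.smul_apply, smul_eq_mul]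
  rw [(h τ hτ).twoForm.skew, (h τ hτ).metric.riemannian.symm x w v]
  ring

variable [∀ x, IsTopologicalAddGroup (E x)] [∀ x, ContinuousSMul ℝ (E x)] [FiniteDimensional ℝ F]

/-- For any bilinear form `r`, with associated element `ℛ` of `so(E)`, the equation `∂G/∂t = -2
[ℛ, G]` at a point and a time is equivalent to `∂(g + b)/∂t = -2 r`, stated for the symmetric and
the skew part. The time `t` may be an end point or an isolated point of `J`. -/
theorem hasDerivWithinAt_generalizedMetric_iff (ht : t ∈ J) (hs₀ : C.IsIsotropicSplitting s₀)
    (hG : ∀ t ∈ J, C.IsGeneralizedMetric (G t))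
    (h : ∀ t ∈ J, C.IsInducedPair s₀ (G t) (g t) (b t)) (r : TwoTensor n M) (x : M) :
    (∀ e : E x, HasDerivWithinAt (fun τ => G τ x e)
      ((-2 : ℝ) • (C.lieElement (G t) r x ∘ₗ G t x - G t x ∘ₗ C.lieElement (G t) r x) e) J t) ↔
    ∀ v w, HasDerivWithinAt (fun τ => g τ x v w) (-(r x v w + r x w v)) J t ∧
      HasDerivWithinAt (fun τ => b τ x v w) (-(r x v w - r x w v)) J t := by
  have hi := (h t ht).metric.isInverseMetric
  have hGt := hG t ht
  set L : E x →ₗ[ℝ] E x :=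
    (-2 : ℝ) • (C.lieElement (G t) r x ∘ₗ G t x - G t x ∘ₗ C.lieElement (G t) r x) with hL
  set P := C.pointLift (G t) (g t) with hP
  have one : (1 : ℝ) * 1 = 1 := by norm_num
  have neg : (-1 : ℝ) * (-1) = 1 := by norm_num
  have Lpos : ∀ v w, C.pairing x (L (P 1 x v)) (P (-1) x w) = -4 * r x v w := fun v w => by
    rw [hL, hP, pairing_commutator hGt one neg, pairing_lieElement_pos hi hGt]; ring
  have Lneg : ∀ v w, C.pairing x (L (P (-1) x v)) (P 1 x w) = -4 * r x w v := fun v w => by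
    rw [hL, hP, pairing_commutator hGt neg one, pairing_lieElement_neg hi hGt]; ring
  have Lself : ∀ ε : ℝ, ε * ε = 1 → ∀ v w, C.pairing x (L (P ε x v)) (P ε x w) = 0 :=
    fun ε hε v w => by rw [hL, hP, pairing_commutator hGt hε hε]; ring
  -- exact formulas for the increment of `G` in terms of those of `g + b` and `g - b`
  have Ipos : ∀ τ ∈ J, ∀ v w, C.pairing x (G τ x (P 1 x v) - G t x (P 1 x v))
      (C.pointLift (G τ) (g τ) (-1) x w) =
        2 * (g τ x v w + b τ x v w) - 2 * (g t x v w + b t x v w) := fun τ hτ v w => by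
    rw [hP, pairing_sub_pointLift hG ht hτ one neg, pairing_pointLift_pointLift hs₀ h ht hτ]; ring
  have Ineg : ∀ τ ∈ J, ∀ v w, C.pairing x (G τ x (P (-1) x v) - G t x (P (-1) x v))
      (C.pointLift (G τ) (g τ) 1 x w) =
        2 * (g τ x v w - b τ x v w) - 2 * (g t x v w - b t x v w) := fun τ hτ v w => by
    rw [hP, pairing_sub_pointLift hG ht hτ neg one, pairing_pointLift_pointLift hs₀ h ht hτ]; ring
  have Iself : ∀ τ ∈ J, ∀ ε : ℝ, ε * ε = 1 → ∀ v w,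
      C.pairing x (G τ x (P ε x v) - G t x (P ε x v)) (C.pointLift (G τ) (g τ) ε x w) = 0 :=
    fun τ hτ ε hε v w => by rw [hP, pairing_sub_pointLift hG ht hτ hε hε]; ring
  constructor
  · intro hflow
    have hpair : ∀ e e', HasDerivWithinAt (fun τ => C.pairing x (G τ x e) e')
        (C.pairing x (L e) e') J t := fun e => C.hasDerivWithinAt_iff_pairing.1 (hflow e)
    have hd : ∀ e e', DifferentiableWithinAt ℝ (fun τ => C.pairing x (G τ x e) e') J t :=
      fun e e' => (hpair e e').differentiableWithinAt
    have hdg := differentiableWithinAt_metric ht (fun τ hτ => (h τ hτ).metric) hd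
    have hdb := differentiableWithinAt_torsionPotential ht hs₀ h hd
    intro v w
    have e1 := (hasDerivWithinAt_pairing_pointLift_iff ht hs₀ h hdg hdb (hd _) (-1) w _).1
      (hpair (P 1 x v) (P (-1) x w))
    have e2 := (hasDerivWithinAt_pairing_pointLift_iff ht hs₀ h hdg hdb (hd _) 1 w _).1
      (hpair (P (-1) x v) (P 1 x w))
    rw [Lpos] at e1
    rw [Lneg] at e2
    constructor
    · refine (((e1.add e2).const_mul (1 / 4)).add_const (g t x v w)).congr_of_mem
        (fun τ hτ => ?_) ht |>.congr_deriv (by ring)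
      simp only [Pi.add_apply]
      rw [Ipos τ hτ, Ineg τ hτ]
      ring
    · refine (((e1.sub e2).const_mul (1 / 4)).add_const (b t x v w)).congr_of_mem
        (fun τ hτ => ?_) ht |>.congr_deriv (by ring)
      simp only [Pi.sub_apply]
      rw [Ipos τ hτ, Ineg τ hτ]
      ring
  · intro hgb
    have hdg : ∀ v w, DifferentiableWithinAt ℝ (fun τ => g τ x v w) J t :=
      fun v w => (hgb v w).1.differentiableWithinAt
    have hdb : ∀ v w, DifferentiableWithinAt ℝ (fun τ => b τ x v w) J t :=
      fun v w => (hgb v w).2.differentiableWithinAt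
    have hd := differentiableWithinAt_generalizedMetric ht hs₀ hG h hdg hdb
    have hself : ∀ ε : ℝ, ε * ε = 1 → ∀ v w, HasDerivWithinAt
        (fun τ => C.pairing x (G τ x (P ε x v)) (P ε x w))
        (C.pairing x (L (P ε x v)) (P ε x w)) J t := by
      intro ε hε v w
      rw [Lself ε hε]
      refine (hasDerivWithinAt_pairing_pointLift_iff ht hs₀ h hdg hdb (hd _) ε w _).2 ?_
      exact (hasDerivWithinAt_const t J (0 : ℝ)).congr_of_mem
        (fun τ hτ => Iself τ hτ ε hε v w) ht
    have hpos : ∀ v w, HasDerivWithinAt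
        (fun τ => C.pairing x (G τ x (P 1 x v)) (P (-1) x w))
        (C.pairing x (L (P 1 x v)) (P (-1) x w)) J t := by
      intro v w
      refine (hasDerivWithinAt_pairing_pointLift_iff ht hs₀ h hdg hdb (hd _) (-1) w _).2 ?_
      refine ((((hgb v w).1.add (hgb v w).2).const_mul 2).sub_const
        (2 * (g t x v w + b t x v w))).congr_of_mem (fun τ hτ => Ipos τ hτ v w) ht
        |>.congr_deriv ?_
      rw [Lpos]; ring
    have hneg : ∀ v w, HasDerivWithinAt
        (fun τ => C.pairing x (G τ x (P (-1) x v)) (P 1 x w))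
        (C.pairing x (L (P (-1) x v)) (P 1 x w)) J t := by
      intro v w
      refine (hasDerivWithinAt_pairing_pointLift_iff ht hs₀ h hdg hdb (hd _) 1 w _).2 ?_
      refine ((((hgb v w).1.sub (hgb v w).2).const_mul 2).sub_const
        (2 * (g t x v w - b t x v w))).congr_of_mem (fun τ hτ => Ineg τ hτ v w) ht
        |>.congr_deriv ?_
      rw [Lneg]; ring
    intro e
    refine C.hasDerivWithinAt_iff_pairing.2 fun e' => ?_
    obtain ⟨v, v', rfl⟩ := exists_pointLift_add hi hGt e
    obtain ⟨w, w', rfl⟩ := exists_pointLift_add hi hGt e'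
    change HasDerivWithinAt (fun τ => C.pairing x (G τ x (P 1 x v + P (-1) x v'))
      (P 1 x w + P (-1) x w')) (C.pairing x (L (P 1 x v + P (-1) x v'))
      (P 1 x w + P (-1) x w')) J t
    simp only [map_add, LinearMap.add_apply]
    exact ((hself 1 one v w).add (hneg v' w)).add ((hpos v w').add (hself (-1) neg v' w'))

end Family

end ExactCourantAlgebroid

/-! ### Equivalence of the flows -/

namespace ExactCourantAlgebroid

variable {n : ℕ} {M : Type*} [TopologicalSpace M] [ChartedSpace (EuclideanSpace ℝ (Fin n)) M]
  [IsManifold (𝓡 n) ∞ M] [T2Space M]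
  {F : Type*} [NormedAddCommGroup F] [NormedSpace ℝ F] [FiniteDimensional ℝ F]
  {E : M → Type*} [TopologicalSpace (Bundle.TotalSpace F E)]
  [∀ x, AddCommGroup (E x)] [∀ x, Module ℝ (E x)] [∀ x, TopologicalSpace (E x)]
  [FiberBundle F E] [VectorBundle ℝ F E] [ContMDiffVectorBundle ∞ F E (𝓡 n)]
  {C : ExactCourantAlgebroid n M F E} {G : ∀ x : M, E x →ₗ[ℝ] E x} {g b : TwoTensor n M}
  {s₀ : ∀ x : M, TangentSpace (𝓡 n) x →ₗ[ℝ] E x} {H₀ db H : ThreeTensor n M}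

theorem IsInducedPair.isIsotropicSplitting (h : C.IsInducedPair s₀ G g b)
    (hG : C.IsGeneralizedMetric G) (hs₀ : C.IsIsotropicSplitting s₀) :
    C.IsIsotropicSplitting (metricSplitting C G g) :=
  h.metric.isInverseMetric.isIsotropicSplitting hG hs₀

/-- The three-form of the splitting `s_G` is `H₀ + db`. -/
theorem IsInducedPair.isTorsionForm (h : C.IsInducedPair s₀ G g b)
    (hG : C.IsGeneralizedMetric G) (hs₀ : C.IsIsotropicSplitting s₀) (hH₀ : C.IsTorsionForm s₀ H₀)
    (hdb : IsExteriorDerivative b db) :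
    C.IsTorsionForm (metricSplitting C G g) (fun x => H₀ x + db x) := by
  intro X Y Z hX hY hZ x
  have h1 := C.torsionFun_expB hs₀ (h.isIsotropicSplitting hG hs₀) h.twoForm
    (h.metricSplitting_apply hs₀) hX hY hZ x
  simp only [torsionFun] at h1
  rw [h1, LinearMap.add_apply, LinearMap.add_apply, LinearMap.add_apply, hH₀ X Y Z hX hY hZ,
    hdb X Y Z hX hY hZ]

/-- The exterior derivative of `b` exists as a tensor, being the difference of the three-forms of
two splittings. -/
theorem IsInducedPair.exists_isExteriorDerivative (h : C.IsInducedPair s₀ G g b)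
    (hG : C.IsGeneralizedMetric G) (hs₀ : C.IsIsotropicSplitting s₀) :
    ∃ db, IsExteriorDerivative b db := by
  obtain ⟨H₀, hH₀⟩ := exists_isTorsionForm (C := C) hs₀
  obtain ⟨H, hH⟩ := exists_isTorsionForm (C := C) (h.isIsotropicSplitting hG hs₀)
  refine ⟨fun x => H x + (-1 : ℝ) • H₀ x, fun X Y Z hX hY hZ x => ?_⟩
  have h1 := C.torsionFun_expB hs₀ (h.isIsotropicSplitting hG hs₀) h.twoForm
    (h.metricSplitting_apply hs₀) hX hY hZ x
  simp only [torsionFun] at h1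
  simp only [LinearMap.add_apply, LinearMap.smul_apply, smul_eq_mul]
  rw [hH X Y Z hX hY hZ, h1, hH₀ X Y Z hX hY hZ]
  ring

/-- With the three-form `H` of the splitting `s_G`, the lower Bismut connection is `∇ - H / 2`. -/
theorem metric_bismut_neg (hg : C.IsInducedMetric G g) (hG : C.IsGeneralizedMetric G)
    (hs₀ : C.IsIsotropicSplitting s₀) (hH : C.IsTorsionForm (metricSplitting C G g) H)
    {D : VField n M → VField n M → VField n M} (hD : IsLeviCivita g D) {X Y : VField n M}
    (hX : IsSmoothVField X) (hY : IsSmoothVField Y) (x : M) (z : TangentSpace (𝓡 n) x) :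
    g x (C.bismut G g (-1) X Y x) z = g x (D X Y x) z - 1 / 2 * H x (X x) (Y x) z := by
  obtain ⟨Z, hZ, rfl⟩ := exists_smooth_vField x z
  rw [hD.unique hg.riemannian (isLeviCivita_meanConnection hg hG hs₀) hX hY,
    hH X Y Z hX hY hZ]
  have h1 := metric_bismut_sub_bismut hg.isInverseMetric hG hs₀ hX hY hZ x
  simp only [torsionFun] at h1
  rw [← h1, meanConnection]
  simp only [map_sub, map_add, map_smul, LinearMap.sub_apply, LinearMap.add_apply,
    LinearMap.smul_apply, smul_eq_mul]
  ring

/-- The Ricci tensor of `∇^-` is `Rc - (1/4) H² + (1/2) d^*H`. -/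
theorem ricci_bismut_neg (hg : C.IsInducedMetric G g) (hG : C.IsGeneralizedMetric G)
    (hs₀ : C.IsIsotropicSplitting s₀) (hH : C.IsTorsionForm (metricSplitting C G g) H)
    {D : VField n M → VField n M → VField n M} (hD : IsLeviCivita g D) {Rc Rc' δ : TwoTensor n M}
    (hRc : IsRicciTensor D Rc) (hRc' : IsRicciTensor (C.bismut G g (-1)) Rc')
    (hδ : IsCodifferential g D H δ) (x : M) (v w : TangentSpace (𝓡 n) x) :
    Rc' x v w = Rc x v w - 1 / 4 * hSquare g H x v w + 1 / 2 * δ x v w := by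
  have hs := hg.isInverseMetric.isIsotropicSplitting hG hs₀
  exact ricci_of_skew_torsion hg.riemannian hD
    (isAffineConnection_bismut hg.isInverseMetric hG hs₀ (by norm_num))
    (fun X Y Z hX hY hZ => hH.smooth hs hX hY hZ) (fun x => hH.swap_left hs x)
    (fun x => hH.swap_right hs x) (fun X Y hX hY x z => metric_bismut_neg hg hG hs₀ hH hD hX hY x z)
    hRc hRc' hδ x v w

/-- The symmetric and the skew part of the Ricci tensor of `∇^-` are the right hand sides of the
`B`-field renormalization group flow. Of the three terms of `ricci_bismut_neg`, the first two are
symmetric and the third one is skew. -/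
theorem ricci_bismut_neg_parts (hg : C.IsInducedMetric G g) (hG : C.IsGeneralizedMetric G)
    (hs₀ : C.IsIsotropicSplitting s₀) (hH : C.IsTorsionForm (metricSplitting C G g) H)
    {D : VField n M → VField n M → VField n M} (hD : IsLeviCivita g D) {Rc Rc' δ : TwoTensor n M}
    (hRc : IsRicciTensor D Rc) (hRc' : IsRicciTensor (C.bismut G g (-1)) Rc')
    (hδ : IsCodifferential g D H δ) (x : M) (v w : TangentSpace (𝓡 n) x) :
    -(Rc' x v w + Rc' x w v) = -2 * Rc x v w + 1 / 2 * hSquare g H x v w ∧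
      -(Rc' x v w - Rc' x w v) = - δ x v w := by
  have hs := hg.isInverseMetric.isIsotropicSplitting hG hs₀
  rw [ricci_bismut_neg hg hG hs₀ hH hD hRc hRc' hδ, ricci_bismut_neg hg hG hs₀ hH hD hRc hRc' hδ,
    hD.ricci_symm hg.riemannian hRc x w v, hSquare_symm hg.riemannian H x w v,
    hδ.skew (fun X Y Z hX hY hZ => hH.smooth hs hX hY hZ) (fun x => hH.swap_right hs x) x w v]
  constructor <;> ring

end ExactCourantAlgebroid

/-- Let `C` be an exact real Courant algebroid over a smooth manifold `M`, with a background
isotropic splitting `s₀`, and let `G t`, `t ∈ J`, be generalized metrics. The background three-form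
`H₀` and the induced pairs `(g t, b t)` exist and are unique, and `G` solves generalized Ricci flow
on `J` if and only if `(g, b)` solves the `B`-field renormalization group flow on `J`. -/
theorem theorem1p1 {n : ℕ} {M : Type*} [TopologicalSpace M] [T2Space M]
    [SecondCountableTopology M] [ChartedSpace (EuclideanSpace ℝ (Fin n)) M]
    [IsManifold (𝓡 n) ∞ M]
    {F : Type*} [NormedAddCommGroup F] [NormedSpace ℝ F] [FiniteDimensional ℝ F]
    {E : M → Type*} [TopologicalSpace (Bundle.TotalSpace F E)]
    [∀ x, AddCommGroup (E x)] [∀ x, Module ℝ (E x)] [∀ x, TopologicalSpace (E x)]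
    [∀ x, IsTopologicalAddGroup (E x)] [∀ x, ContinuousSMul ℝ (E x)]
    [FiberBundle F E] [VectorBundle ℝ F E] [ContMDiffVectorBundle ∞ F E (𝓡 n)]
    (C : ExactCourantAlgebroid n M F E)
    (s₀ : ∀ x : M, TangentSpace (𝓡 n) x →ₗ[ℝ] E x) (hs₀ : C.IsIsotropicSplitting s₀)
    (J : Set ℝ) (hJ : J.OrdConnected)
    (G : ℝ → ∀ x : M, E x →ₗ[ℝ] E x) (hG : ∀ t ∈ J, C.IsGeneralizedMetric (G t)) :
    (∃! H₀ : ThreeTensor n M, C.IsTorsionForm s₀ H₀) ∧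
    (∀ t ∈ J, ∃! p : TwoTensor n M × TwoTensor n M, C.IsInducedPair s₀ (G t) p.1 p.2) ∧
    ∀ (H₀ : ThreeTensor n M) (g b : ℝ → TwoTensor n M),
      C.IsTorsionForm s₀ H₀ → (∀ t ∈ J, C.IsInducedPair s₀ (G t) (g t) (b t)) →
      (C.IsGeneralizedRicciFlow J G ↔ IsBFieldRGFlow J H₀ g b) := by
  refine ⟨?_, fun t ht => ?_, fun H₀ g b hH₀ h => ?_⟩
  · obtain ⟨H₀, hH₀⟩ := exists_isTorsionForm hs₀
    exact ⟨H₀, hH₀, fun H hH => hH.unique hH₀⟩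
  · obtain ⟨g, b, h⟩ := exists_isInducedPair (hG t ht) hs₀
    refine ⟨(g, b), h, fun p hp => ?_⟩
    obtain ⟨h1, h2⟩ := hp.unique h hs₀
    exact Prod.ext h1 h2
  · refine forall₂_congr fun t ht => ?_
    have hg := (h t ht).metric
    have hGt := hG t ht
    constructor
    · rintro ⟨-, g', Rc', hg', hRc', hflow⟩
      obtain rfl := hg'.isInverseMetric.unique hg.isInverseMetric
      obtain ⟨db, hdb⟩ := (h t ht).exists_isExteriorDerivative hGt hs₀
      have hH := (h t ht).isTorsionForm hGt hs₀ hH₀ hdb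
      have hD := isLeviCivita_meanConnection hg hGt hs₀
      obtain ⟨Rc, hRc⟩ := exists_isRicciTensor hD.toIsAffineConnection
      obtain ⟨δ, hδ⟩ := exists_isCodifferential hD.toIsAffineConnection (g t) _
        fun X Y Z hX hY hZ => hH.smooth ((h t ht).isIsotropicSplitting hGt hs₀) hX hY hZ
      refine ⟨hg.riemannian, (h t ht).twoForm, db, _, Rc, δ, hdb, hD, hRc, hδ, fun x v w => ?_⟩
      obtain ⟨e1, e2⟩ := ricci_bismut_neg_parts hg hGt hs₀ hH hD hRc hRc' hδ x v w
      rw [← e1, ← e2]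
      exact (hasDerivWithinAt_generalizedMetric_iff ht hs₀ hG h Rc' x).1 (hflow x) v w
    · rintro ⟨-, -, db, D, Rc, δ, hdb, hD, hRc, hδ, hflow⟩
      have hH := (h t ht).isTorsionForm hGt hs₀ hH₀ hdb
      obtain ⟨Rc', hRc'⟩ := exists_isRicciTensor
        (isAffineConnection_bismut (ε := -1) hg.isInverseMetric hGt hs₀ (by norm_num))
      refine ⟨hGt, g t, Rc', hg, hRc', fun x => ?_⟩
      refine (hasDerivWithinAt_generalizedMetric_iff ht hs₀ hG h Rc' x).2 fun v w => ?_
      obtain ⟨e1, e2⟩ := ricci_bismut_neg_parts hg hGt hs₀ hH hD hRc hRc' hδ x v w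
      rw [e1, e2]
      exact hflow x v w
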